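/- Let $M$ be a smooth manifold of dimension $n$ (Hausdorff, second countable), $E\to M$ a smooth real vector bundle of rank $r$, $H$ a closed $3$-form on $M$ and $k\in\mathbb Z$. Let ${\cal M}=T^*[2]T[1]M$ be the graded manifold with local coordinates $(x^\mu,\psi^\mu,b_\mu,p_\mu)$ of degrees $(0,1,1,2)$ which under a change of coordinates of $M$ with Jacobian $J$ transform by $\psi'=J\psi$, $b'=J^{-1\,T}b$, $p'=J^{-1\,T}p-J^{-1\,T}(dJ)^TJ^{-1\,T}b$, $dJ=\psi^\mu\partial_\mu J$, with the homological vector field $$d_{\cal M}=\psi^\mu\frac{\partial}{\partial x^\mu}+\Bigl(p_\mu+\tfrac12H_{\mu\nu\rho}\psi^\nu\psi^\rho\Bigr)\frac{\partial}{\partial b_\mu}-\tfrac1{3!}\,\partial_\kappa H_{\mu\nu\rho}\,\psi^\mu\psi^\nu\psi^\rho\frac{\partial}{\partial p_\kappa},$$ and let $p:{\cal M}\to M$ be the projection. Let ${\cal E}=p^*E[k]$; its dual ${\cal E}^*$ has the additional linear fibre coordinates $s_\alpha$ of degree $-k$, corresponding to a local frame $(e_\alpha)$ of $E$. A $Q$-connection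 on ${\cal E}$ is a degree $1$ vector field $Q_{\cal E}$ on ${\cal E}^*$ (a graded derivation of the algebra $C({\cal E}^*)=\bigoplus_jC^j({\cal E}^*)$ of global functions) which preserves the space $\Gamma({\cal E})=C({\cal E}^*)_{lin}$ of functions linear in the fibre coordinates, and which projects to $d_{\cal M}$, i.e. preserves $C({\cal M})$ and restricts to $d_{\cal M}$ on it. A generalized connection on $E$ is an $\mathbb R$-linear map $D:\Gamma(E)\to\Gamma(\mathbb TM\otimes E)$, $\mathbb TM=TM\oplus T^*M$, with $D(f\sigma)=fD\sigma+(\rho^*df)\otimes\sigma$, where $\rho^*:T^*M\to\mathbb TM$ is the inclusion. Then the following hold. (1) $Q$-connections on $p^*E[k]$ over $(T^*[2]T[1]M,d_{\cal M})$ are in bijection with generalized connections on $E$: $Q_{\cal E}$ corresponds to the $D$ with $Q_{\cal E}(\sigma)=D\sigma$ for all $\sigma\in\Gamma(E)$, where $\sigma=\sigma^\alpha e_\alpha$ is identified with $\sigma^\alpha s_\alpha\in C({\cal E}^*)_{lin}$, and $\Gamma(\mathbb TM\otimes E)$ is mapped to $C({\cal E}^*)_{lin}$ by $dx^\mu\otimes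 e_\alpha\mapsto\psi^\mu s_\alpha$, $\partial_\mu\otimes e_\alpha\mapsto b_\mu s_\alpha$. (2) $(\nabla,V)\mapsto D=\nabla+V$ is a bijection from pairs consisting of an ordinary connection $\nabla$ on $E$ and a section $V\in\Gamma(TM\otimes{\rm End}\,E)$ to generalized connections on $E$. (3) Let $Q_{\cal E}$ correspond to $D=\nabla^\Gamma+V$, where locally $\nabla^\Gamma_\mu e_\beta=\Gamma_\mu{}^\alpha{}_\beta e_\alpha$ and $V(dx^\mu)e_\beta=V^{\mu\,\alpha}{}_\beta e_\alpha$. Then in local coordinates $$Q_{\cal E}=d_{\cal M}+\bigl(\Gamma_\mu{}^\alpha{}_\beta\,\psi^\mu+V^{\mu\,\alpha}{}_\beta\,b_\mu\bigr)s_\alpha\frac{\partial}{\partial s_\beta},\qquad Q_{\cal E}^2=R^\alpha{}_\beta\,s_\alpha\frac{\partial}{\partial s_\beta},$$ with $$R=R_\nabla+H_V+V\,V+R^{(1,1)},$$ where $$(R_\nabla)^\alpha{}_\beta=(\partial_\mu\Gamma_\nu{}^\alpha{}_\beta+\Gamma_\mu{}^\alpha{}_\gamma\Gamma_\nu{}^\gamma{}_\beta)\psi^\mu\psi^\nu,\qquad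 (H_V)^\alpha{}_\beta=\tfrac12H_{\rho\mu\nu}V^{\rho\,\alpha}{}_\beta\,\psi^\mu\psi^\nu,$$ $$(VV)^\alpha{}_\beta=V^{\mu\,\alpha}{}_\gamma V^{\nu\,\gamma}{}_\beta\,b_\mu b_\nu,$$ $$(R^{(1,1)})^\alpha{}_\beta=(\partial_\mu V^{\nu\,\alpha}{}_\beta+\Gamma_\mu{}^\alpha{}_\gamma V^{\nu\,\gamma}{}_\beta-\Gamma_\mu{}^\gamma{}_\beta V^{\nu\,\alpha}{}_\gamma)\psi^\mu b_\nu+V^{\mu\,\alpha}{}_\beta\,p_\mu .$$ Here $R_\nabla$ is the curvature of $\nabla^\Gamma$. -/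

import Mathlib

set_option linter.unusedSectionVars false

open Bundle Set Topology
open scoped Manifold ContDiff TensorProduct

noncomputable section

namespace GradedCourant

/-! ## The free graded-commutative algebra on the graded coordinates -/

/-- The graded coordinates on `𝓔*`, where `𝓔 = p*E[k]` over `T*[2]T[1]M`: the coordinates
`ψ^μ`, `b_μ`, `p_μ` of the base, and the fibre coordinates `s_α`. -/
inductive Gen (n r : ℕ) : Type
  | psi (μ : Fin n) : Gen n r
  | b (μ : Fin n) : Gen n r
  | p (μ : Fin n) : Gen n r
  | s (α : Fin r) : Gen n r

/-- The degrees: `|ψ^μ| = 1`, `|b_μ| = 1`, `|p_μ| = 2`; the fibre coordinates of `p*E[k]` have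
degree `k`, so the dual ones `s_α` have degree `-k`. -/
def Gen.deg {n r : ℕ} (k : ℤ) : Gen n r → ℤ
  | .psi _ => 1
  | .b _ => 1
  | .p _ => 2
  | .s _ => -k

/-- Graded commutativity of the generators, `g h = (-1)^{|g||h|} h g`. -/
inductive CommRel (n r : ℕ) (k : ℤ) :
    FreeAlgebra ℝ (Gen n r) → FreeAlgebra ℝ (Gen n r) → Prop
  | swap (g h : Gen n r) : CommRel n r k
      (FreeAlgebra.ι ℝ g * FreeAlgebra.ι ℝ h)
      ((-1 : ℝ) ^ (g.deg k * h.deg k) • (FreeAlgebra.ι ℝ h * FreeAlgebra.ι ℝ g))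

/-- The graded symmetric algebra `SV` (over `ℝ`) on the coordinates `ψ^μ, b_μ, p_μ, s_α`. -/
def GAlg (n r : ℕ) (k : ℤ) : Type := RingQuot (CommRel n r k)

instance (n r : ℕ) (k : ℤ) : Ring (GAlg n r k) :=
  inferInstanceAs (Ring (RingQuot (CommRel n r k)))

instance (n r : ℕ) (k : ℤ) : Algebra ℝ (GAlg n r k) :=
  inferInstanceAs (Algebra ℝ (RingQuot (CommRel n r k)))

section Algebra

variable {n r : ℕ} {k : ℤ}

/-- A coordinate as an element of `SV`. -/
def gen (k : ℤ) (g : Gen n r) : GAlg n r k :=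
  RingQuot.mkAlgHom ℝ (CommRel n r k) (FreeAlgebra.ι ℝ g)

/-- The homogeneous elements of degree `j` of `SV`. -/
def homog (n r : ℕ) (k j : ℤ) : Submodule ℝ (GAlg n r k) :=
  Submodule.span ℝ {a | ∃ l : List (Gen n r),
    (l.map (Gen.deg k)).sum = j ∧ (l.map (gen k)).prod = a}

/-- The elements of `SV` not involving the fibre coordinates `s_α`. -/
def basePart (n r : ℕ) (k : ℤ) : Subalgebra ℝ (GAlg n r k) :=
  Algebra.adjoin ℝ (range (fun μ : Fin n => gen k (.psi μ)) ∪
    range (fun μ : Fin n => gen k (.b μ)) ∪ range (fun μ : Fin n => gen k (.p μ)))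

/-- The elements of `SV` linear in the fibre coordinates `s_α`. -/
def linPart (n r : ℕ) (k : ℤ) : Submodule ℝ (GAlg n r k) :=
  Submodule.span ℝ {c | ∃ a ∈ basePart n r k, ∃ α : Fin r, a * gen k (.s α) = c}

theorem gen_mul_gen (g h : Gen n r) :
    gen k g * gen k h = (-1 : ℝ) ^ (g.deg k * h.deg k) • (gen k h * gen k g) := by
  have := RingQuot.mkAlgHom_rel ℝ (CommRel.swap (k := k) g h)
  simp only [map_mul, map_smul] at this
  exact this

theorem gen_mem_homog (g : Gen n r) : gen k g ∈ homog n r k (g.deg k) :=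
  Submodule.subset_span ⟨[g], by simp, by simp⟩

theorem psi_mem_homog (μ : Fin n) : gen k (.psi μ : Gen n r) ∈ homog n r k 1 := by
  simpa only [Gen.deg] using gen_mem_homog (k := k) (.psi μ : Gen n r)

theorem b_mem_homog (μ : Fin n) : gen k (.b μ : Gen n r) ∈ homog n r k 1 := by
  simpa only [Gen.deg] using gen_mem_homog (k := k) (.b μ : Gen n r)

theorem p_mem_homog (μ : Fin n) : gen k (.p μ : Gen n r) ∈ homog n r k 2 := by
  simpa only [Gen.deg] using gen_mem_homog (k := k) (.p μ : Gen n r)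

theorem s_mem_homog (α : Fin r) : gen k (.s α : Gen n r) ∈ homog n r k (-k) := by
  simpa only [Gen.deg] using gen_mem_homog (k := k) (.s α : Gen n r)

theorem one_mem_homog : (1 : GAlg n r k) ∈ homog n r k 0 :=
  Submodule.subset_span ⟨[], by simp, by simp⟩

theorem mul_mem_homog {i j : ℤ} {a b : GAlg n r k} (ha : a ∈ homog n r k i)
    (hb : b ∈ homog n r k j) : a * b ∈ homog n r k (i + j) := by
  have h : homog n r k i * homog n r k j ≤ homog n r k (i + j) := by
    rw [homog, homog, Submodule.span_mul_span]
    refine Submodule.span_le.2 ?_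
    rintro _ ⟨_, ⟨l, hl, rfl⟩, _, ⟨l', hl', rfl⟩, rfl⟩
    exact Submodule.subset_span ⟨l ++ l', by simp [hl, hl'], by simp⟩
  exact h (Submodule.mul_mem_mul ha hb)

theorem mul_mem_homog_of_eq {i j l : ℤ} {a b : GAlg n r k} (ha : a ∈ homog n r k i)
    (hb : b ∈ homog n r k j) (h : i + j = l) : a * b ∈ homog n r k l :=
  h ▸ mul_mem_homog ha hb

theorem zpow_neg_one_sq (m : ℤ) : (-1 : ℝ) ^ m * (-1 : ℝ) ^ m = 1 := by
  rw [← mul_zpow]; simp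

theorem homog_comm {i j : ℤ} {a b : GAlg n r k} (ha : a ∈ homog n r k i)
    (hb : b ∈ homog n r k j) : a * b = (-1 : ℝ) ^ (i * j) • (b * a) := by
  have one : ∀ (g : Gen n r) (l : List (Gen n r)),
      gen k g * (l.map (gen k)).prod =
        (-1 : ℝ) ^ (g.deg k * (l.map (Gen.deg k)).sum) • ((l.map (gen k)).prod * gen k g) := by
    intro g l
    induction l with
    | nil => simp
    | cons h l ih =>
      simp only [List.map_cons, List.prod_cons, List.sum_cons]
      rw [← mul_assoc, gen_mul_gen, smul_mul_assoc, mul_assoc, ih, mul_smul_comm, smul_smul,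
        mul_add, zpow_add₀ (by norm_num), mul_assoc]
  have two : ∀ (l l' : List (Gen n r)),
      (l.map (gen k)).prod * (l'.map (gen k)).prod =
        (-1 : ℝ) ^ ((l.map (Gen.deg k)).sum * (l'.map (Gen.deg k)).sum) •
          ((l'.map (gen k)).prod * (l.map (gen k)).prod) := by
    intro l l'
    induction l with
    | nil => simp
    | cons h l ih =>
      simp only [List.map_cons, List.prod_cons, List.sum_cons]
      rw [mul_assoc, ih, mul_smul_comm, ← mul_assoc, one, smul_mul_assoc, smul_smul,
        add_mul, zpow_add₀ (by norm_num), mul_assoc, mul_comm ((-1 : ℝ) ^ _)]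
  refine Submodule.span_induction₂ (p := fun x y _ _ => x * y = (-1 : ℝ) ^ (i * j) • (y * x))
    ?_ ?_ ?_ ?_ ?_ ?_ ?_ ha hb
  · rintro _ _ ⟨l, rfl, rfl⟩ ⟨l', rfl, rfl⟩
    exact two l l'
  · intro y _; simp
  · intro x _; simp
  · intro x y z _ _ _ h1 h2; rw [add_mul, h1, h2, mul_add, smul_add]
  · intro x y z _ _ _ h1 h2; rw [mul_add, h1, h2, add_mul, smul_add]
  · intro t x y _ _ h; rw [smul_mul_assoc, h, mul_smul_comm, smul_comm]
  · intro t x y _ _ h; rw [mul_smul_comm, h, smul_mul_assoc, smul_comm]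

/-- Universal property of `SV`. -/
def liftAlg {B : Type*} [Ring B] [Algebra ℝ B] (f : Gen n r → B)
    (hf : ∀ g h : Gen n r, f g * f h = (-1 : ℝ) ^ (g.deg k * h.deg k) • (f h * f g)) :
    GAlg n r k →ₐ[ℝ] B :=
  RingQuot.liftAlgHom ℝ ⟨FreeAlgebra.lift ℝ f, by
    rintro _ _ ⟨g, h⟩
    simpa using hf g h⟩

theorem liftAlg_gen {B : Type*} [Ring B] [Algebra ℝ B] (f : Gen n r → B)
    (hf : ∀ g h : Gen n r, f g * f h = (-1 : ℝ) ^ (g.deg k * h.deg k) • (f h * f g)) (g : Gen n r) :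
    liftAlg (k := k) f hf (gen k g) = f g := by
  exact (RingQuot.liftAlgHom_mkAlgHom_apply ℝ (FreeAlgebra.lift ℝ f) _ _).trans (by simp)

/-- The degree-preserving algebra morphism given by a substitution of the coordinates. -/
def substHom (v : Gen n r → GAlg n r k) (hv : ∀ g : Gen n r, v g ∈ homog n r k (g.deg k)) :
    GAlg n r k →ₐ[ℝ] GAlg n r k :=
  liftAlg v fun g h => homog_comm (hv g) (hv h)

theorem substHom_gen (v : Gen n r → GAlg n r k) (hv : ∀ g : Gen n r, v g ∈ homog n r k (g.deg k))
    (g : Gen n r) : substHom v hv (gen k g) = v g :=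
  liftAlg_gen _ _ g

theorem substHom_mem_homog (v : Gen n r → GAlg n r k) (hv : ∀ g : Gen n r, v g ∈ homog n r k (g.deg k))
    {j : ℤ} {a : GAlg n r k} (ha : a ∈ homog n r k j) : substHom (k := k) v hv a ∈ homog n r k j := by
  have key : ∀ l : List (Gen n r),
      substHom v hv (l.map (gen k)).prod ∈ homog n r k (l.map (Gen.deg k)).sum := by
    intro l
    induction l with
    | nil => simpa using one_mem_homog
    | cons g l ih =>
      simp only [List.map_cons, List.prod_cons, List.sum_cons, map_mul]
      refine mul_mem_homog ?_ ih
      rw [substHom, liftAlg_gen]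
      exact hv g
  refine Submodule.span_induction (p := fun x _ => substHom v hv x ∈ homog n r k j)
    ?_ ?_ ?_ ?_ ha
  · rintro _ ⟨l, rfl, rfl⟩; exact key l
  · simp
  · intro x y _ _ hx hy; rw [map_add]; exact add_mem hx hy
  · intro t x _ hx; rw [map_smul]; exact Submodule.smul_mem _ _ hx

/-- The `ℝ`-linear graded (left) derivation of `SV` of degree `d` with `g ↦ v g` on the
coordinates, i.e. the vector field `∑_g v_g ∂/∂g`.  It is the upper right corner of the algebra
morphism `g ↦ ((-1)^{d|g|} g, v g; 0, g)` to triangular matrices. -/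
def der (d : ℤ) (v : Gen n r → GAlg n r k) (hv : ∀ g : Gen n r, v g ∈ homog n r k (g.deg k + d)) :
    GAlg n r k →ₗ[ℝ] GAlg n r k where
  toFun a := (liftAlg (k := k) (B := Matrix (Fin 2) (Fin 2) (GAlg n r k))
    (fun g => !![(-1 : ℝ) ^ (d * g.deg k) • gen k g, v g; 0, gen k g]) (by
      intro g h
      have e1 := homog_comm (gen_mem_homog (k := k) g) (hv h)
      have e2 := homog_comm (hv g) (gen_mem_homog (k := k) h)
      have e3 := gen_mul_gen (k := k) g h
      have s1 : ∀ m m' : ℤ, (-1 : ℝ) ^ (m + m') = (-1 : ℝ) ^ m * (-1 : ℝ) ^ m' :=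
        fun m m' => zpow_add₀ (by norm_num) m m'
      ext x y
      fin_cases x <;> fin_cases y
      · simp [Matrix.mul_apply, Fin.sum_univ_two, smul_smul, e3, mul_assoc, mul_comm, mul_left_comm]
      · simp only [Matrix.mul_apply, Fin.sum_univ_two, Matrix.smul_apply]
        simp [e1, e2, smul_smul]
        rw [add_comm]
        congr 2
        · rw [add_mul, s1, mul_comm d (h.deg k)]
        · rw [mul_add, s1, mul_comm (g.deg k) d, mul_left_comm, zpow_neg_one_sq, mul_one]
      · simp [Matrix.mul_apply, Fin.sum_univ_two]
      · simp [Matrix.mul_apply, Fin.sum_univ_two, e3]) a) 0 1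
  map_add' a b := by simp
  map_smul' t a := by simp

end Algebra

/-! ## Local coordinates on `M` and frames of `E` -/

section Coordinates

variable {n r : ℕ} {M : Type*} [TopologicalSpace M] [ChartedSpace (EuclideanSpace ℝ (Fin n)) M]

/-- The coordinate vector `∂_μ` at `x` of the chart `c`. -/
def coordVec (c : OpenPartialHomeomorph M (EuclideanSpace ℝ (Fin n))) (μ : Fin n) (x : M) :
    TangentSpace (𝓡 n) x :=
  (mfderiv (𝓡 n) (𝓡 n) c.symm (c x) (EuclideanSpace.single μ (1 : ℝ)) :
    EuclideanSpace ℝ (Fin n))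

/-- The coordinate covector `dx^μ` at `x` of the chart `c`. -/
def coordCovec (c : OpenPartialHomeomorph M (EuclideanSpace ℝ (Fin n))) (μ : Fin n) (x : M) :
    Module.Dual ℝ (TangentSpace (𝓡 n) x) where
  toFun v :=
    let w : EuclideanSpace ℝ (Fin n) := mfderiv (𝓡 n) (𝓡 n) c x v
    w μ
  map_add' v w := by simp only [map_add]; rfl
  map_smul' t v := by simp only [map_smul]; rfl

/-- The partial derivative `∂g/∂x^μ` at `x` in the chart `c`. -/
def partialDeriv (c : OpenPartialHomeomorph M (EuclideanSpace ℝ (Fin n))) (μ : Fin n)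
    (g : M → ℝ) (x : M) : ℝ :=
  fderiv ℝ (fun y => g (c.symm y)) (c x) (EuclideanSpace.single μ 1)

/-- The expression of a `3`-form in the chart `c`. -/
def formInChart (c : OpenPartialHomeomorph M (EuclideanSpace ℝ (Fin n)))
    (θ : ∀ x : M, TangentSpace (𝓡 n) x [⋀^Fin 3]→L[ℝ] ℝ) (y : EuclideanSpace ℝ (Fin n)) :
    EuclideanSpace ℝ (Fin n) [⋀^Fin 3]→L[ℝ] ℝ :=
  (θ (c.symm y)).compContinuousLinearMap (mfderiv (𝓡 n) (𝓡 n) c.symm y)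

variable (n M) in
/-- A closed smooth `3`-form on `M`. -/
structure ClosedThreeForm where
  toFun : ∀ x : M, TangentSpace (𝓡 n) x [⋀^Fin 3]→L[ℝ] ℝ
  smooth : ∀ c ∈ atlas (EuclideanSpace ℝ (Fin n)) M, ContDiffOn ℝ ∞ (formInChart c toFun) c.target
  closed : ∀ c ∈ atlas (EuclideanSpace ℝ (Fin n)) M, ∀ y ∈ c.target,
    extDeriv (formInChart c toFun) y = 0

/-- The components `H_{μνρ} = H(∂_μ, ∂_ν, ∂_ρ)`. -/
def ClosedThreeForm.comp (H : ClosedThreeForm n M)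
    (c : OpenPartialHomeomorph M (EuclideanSpace ℝ (Fin n))) (μ ν ρ : Fin n) (x : M) : ℝ :=
  H.toFun x ![coordVec c μ x, coordVec c ν x, coordVec c ρ x]

variable (E : M → Type*) [TopologicalSpace (TotalSpace (EuclideanSpace ℝ (Fin r)) E)]
  [∀ x, AddCommGroup (E x)] [∀ x, TopologicalSpace (E x)]
  [FiberBundle (EuclideanSpace ℝ (Fin r)) E]

variable (n r) in
/-- A chart of `M` together with a local trivialization of `E`; it provides the graded coordinates
`(x^μ, ψ^μ, b_μ, p_μ, s_α)` over `dom`. -/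
structure LocalChart where
  chart : OpenPartialHomeomorph M (EuclideanSpace ℝ (Fin n))
  chart_mem : chart ∈ atlas (EuclideanSpace ℝ (Fin n)) M
  triv : Trivialization (EuclideanSpace ℝ (Fin r)) (π (EuclideanSpace ℝ (Fin r)) E)
  triv_mem : MemTrivializationAtlas triv

namespace LocalChart

variable {E}

/-- The open subset of `M` where both the coordinates and the frame are defined. -/
def dom (i : LocalChart n r E) : Set M := i.chart.source ∩ i.triv.baseSet

/-- The frame vector `e_α` of `E` at `x`. -/
def frame (i : LocalChart n r E) (α : Fin r) (x : M) : E x :=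
  i.triv.symm x (EuclideanSpace.single α 1)

/-- The component `u^α` of `u = u^α e_α`. -/
def coeff (i : LocalChart n r E) (α : Fin r) {x : M} (u : E x) : ℝ := (i.triv ⟨x, u⟩).2 α

variable (i j : LocalChart n r E)

/-- `J^σ_ρ = ∂x'^σ/∂x^ρ`, where `x` are the coordinates of `i` and `x'` those of `j`. -/
def jac (x : M) (σ ρ : Fin n) : ℝ :=
  fderiv ℝ (fun y => j.chart (i.chart.symm y)) (i.chart x) (EuclideanSpace.single ρ 1) σ

/-- `∂J^σ_ρ/∂x^l`. -/
def jacDeriv (x : M) (l σ ρ : Fin n) : ℝ :=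
  fderiv ℝ (fun y => fderiv ℝ (fun z => j.chart (i.chart.symm z)) y (EuclideanSpace.single ρ 1))
    (i.chart x) (EuclideanSpace.single l 1) σ

/-- The coordinates `ψ', b', p', s'` of `j` in terms of the coordinates `ψ, b, p, s` of `i`:
`ψ' = Jψ`, `b' = J⁻¹ᵀ b`, `p' = J⁻¹ᵀ p - J⁻¹ᵀ (dJ)ᵀ J⁻¹ᵀ b` with `dJ = ψ^l ∂_l J`, and `s_α`
transforms as the frame `e_α` of `E`. (`J⁻¹` is the Jacobian of `x` with respect to `x'`.) -/
def transGen (k : ℤ) (x : M) : Gen n r → GAlg n r k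
  | .psi σ => ∑ ρ, i.jac j x σ ρ • gen k (.psi ρ)
  | .b μ => ∑ ν, j.jac i x ν μ • gen k (.b ν)
  | .p μ => (∑ ν, j.jac i x ν μ • gen k (.p ν)) -
      ∑ l, ∑ ν, ∑ ρ, ∑ σ, (j.jac i x ρ μ * i.jacDeriv j x l σ ρ * j.jac i x ν σ) •
        (gen k (.psi l) * gen k (.b ν))
  | .s α => ∑ β, i.coeff β (j.frame α x) • gen k (.s β)

theorem transGen_mem (k : ℤ) (x : M) (g : Gen n r) :
    i.transGen j k x g ∈ homog n r k (g.deg k) := by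
  have h2 : ∀ l ν : Fin n, gen k (Gen.psi l : Gen n r) * gen k (.b ν) ∈ homog n r k 2 :=
    fun l ν => mul_mem_homog_of_eq (psi_mem_homog l) (b_mem_homog ν) (by norm_num)
  cases g with
  | psi σ =>
    simp only [transGen, Gen.deg]
    exact sum_mem fun ρ _ => Submodule.smul_mem _ _ (psi_mem_homog ρ)
  | b μ =>
    simp only [transGen, Gen.deg]
    exact sum_mem fun ρ _ => Submodule.smul_mem _ _ (b_mem_homog ρ)
  | p μ =>
    simp only [transGen, Gen.deg]
    exact sub_mem
      (sum_mem fun ρ _ => Submodule.smul_mem _ _ (p_mem_homog ρ))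
      (sum_mem fun l _ => sum_mem fun ν _ => sum_mem fun ρ _ => sum_mem fun σ _ =>
        Submodule.smul_mem _ _ (h2 l ν))
  | s α =>
    simp only [transGen, Gen.deg]
    exact sum_mem fun β _ => Submodule.smul_mem _ _ (s_mem_homog β)

/-- The coordinate transformation from `j` to `i` at the point `x`. -/
def trans (k : ℤ) (x : M) : GAlg n r k →ₐ[ℝ] GAlg n r k :=
  substHom (i.transGen j k x) (i.transGen_mem j k x)

/-- `f` belongs locally to `C^∞ ⊗ SV`. -/
def IsSmooth {k : ℤ} (f : i.dom → GAlg n r k) : Prop :=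
  ∀ x₀ ∈ i.dom, ∃ U : Set M, IsOpen U ∧ x₀ ∈ U ∧
    ∃ (ι : Type) (_ : Fintype ι) (g : ι → M → ℝ) (a : ι → GAlg n r k),
      (∀ m, ContMDiffOn (𝓡 n) 𝓘(ℝ, ℝ) ∞ (g m) U) ∧
      ∀ x : i.dom, (x : M) ∈ U → f x = ∑ m, g m x • a m

end LocalChart

end Coordinates

/-! ## Functions and vector fields on the graded manifold `𝓔*` -/

section Functions

variable {n r : ℕ} {M : Type*} [TopologicalSpace M] [ChartedSpace (EuclideanSpace ℝ (Fin n)) M]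
  (E : M → Type*) [TopologicalSpace (TotalSpace (EuclideanSpace ℝ (Fin r)) E)]
  [∀ x, AddCommGroup (E x)] [∀ x, TopologicalSpace (E x)]
  [FiberBundle (EuclideanSpace ℝ (Fin r)) E]

variable (n r)

/-- A family of functions `f_i(x) ∈ SV`, one for each local coordinate system. -/
abbrev LocalFamily (k : ℤ) : Type _ := ∀ i : LocalChart n r E, i.dom → GAlg n r k

/-- The global functions of degree `j` on `𝓔*`: the families of local functions, i.e. of sections
of `C^∞ ⊗ SV` of degree `j`, which agree under the coordinate transformations. -/
def funDeg (k j : ℤ) : Submodule ℝ (LocalFamily n r E k) where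
  carrier := {f | (∀ i : LocalChart n r E, i.IsSmooth (f i)) ∧
    (∀ (i i' : LocalChart n r E) (x : M) (hx : x ∈ i.dom) (hx' : x ∈ i'.dom),
      f i ⟨x, hx⟩ = i.trans i' k x (f i' ⟨x, hx'⟩)) ∧
    ∀ i x, f i x ∈ homog n r k j}
  zero_mem' := by
    refine ⟨fun i x _ => ⟨univ, isOpen_univ, mem_univ _, Empty, inferInstance, nofun, nofun, nofun,
      fun x _ => by simp⟩, fun i i' x _ _ => by simp, fun i x => by simp⟩
  add_mem' := by
    rintro f f' ⟨h1, h2, h3⟩ ⟨h1', h2', h3'⟩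
    refine ⟨fun i x hx => ?_, fun i i' x hx hx' => ?_, fun i x => add_mem (h3 i x) (h3' i x)⟩
    · obtain ⟨U, hU, hxU, ι, _, g, a, hg, e⟩ := h1 i x hx
      obtain ⟨U', hU', hxU', ι', _, g', a', hg', e'⟩ := h1' i x hx
      refine ⟨U ∩ U', hU.inter hU', ⟨hxU, hxU'⟩, ι ⊕ ι', inferInstance, Sum.elim g g',
        Sum.elim a a', ?_, fun y hy => ?_⟩
      · rintro (m | m)
        · exact (hg m).mono inter_subset_left
        · exact (hg' m).mono inter_subset_right
      · simp [e y hy.1, e' y hy.2]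
    · simp [h2 i i' x hx hx', h2' i i' x hx hx']
  smul_mem' := by
    rintro t f ⟨h1, h2, h3⟩
    refine ⟨fun i x hx => ?_, fun i i' x hx hx' => ?_,
      fun i x => Submodule.smul_mem _ _ (h3 i x)⟩
    · obtain ⟨U, hU, hxU, ι, _, g, a, hg, e⟩ := h1 i x hx
      refine ⟨U, hU, hxU, ι, inferInstance, g, fun m => t • a m, hg, fun y hy => ?_⟩
      simp [e y hy, Finset.smul_sum, smul_comm t]
    · simp [h2 i i' x hx hx']

variable {n r E}

theorem mul_mem_funDeg {k j j' : ℤ} {f f' : LocalFamily n r E k} (h : f ∈ funDeg n r E k j)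
    (h' : f' ∈ funDeg n r E k j') : f * f' ∈ funDeg n r E k (j + j') := by
  obtain ⟨h1, h2, h3⟩ := h
  obtain ⟨h1', h2', h3'⟩ := h'
  refine ⟨fun i x hx => ?_, fun i i' x hx hx' => ?_, fun i x => mul_mem_homog (h3 i x) (h3' i x)⟩
  · obtain ⟨U, hU, hxU, ι, _, g, a, hg, e⟩ := h1 i x hx
    obtain ⟨U', hU', hxU', ι', _, g', a', hg', e'⟩ := h1' i x hx
    refine ⟨U ∩ U', hU.inter hU', ⟨hxU, hxU'⟩, ι × ι', inferInstance,
      fun m y => g m.1 y * g' m.2 y, fun m => a m.1 * a' m.2, ?_, fun y hy => ?_⟩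
    · intro m
      exact ((hg m.1).mono inter_subset_left).mul ((hg' m.2).mono inter_subset_right)
    · simp only [Pi.mul_apply, e y hy.1, e' y hy.2, Finset.sum_mul_sum, Fintype.sum_prod_type,
        smul_mul_smul_comm]
  · simp [h2 i i' x hx hx', h2' i i' x hx hx']

theorem one_mem_funDeg {k : ℤ} : (1 : LocalFamily n r E k) ∈ funDeg n r E k 0 := by
  refine ⟨fun i x _ => ⟨univ, isOpen_univ, mem_univ _, Unit, inferInstance, fun _ _ => 1,
    fun _ => 1, fun _ => contMDiffOn_const, fun x _ => by simp⟩,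
    fun i i' x _ _ => by simp, fun i x => one_mem_homog⟩

variable (n r E)

/-- The graded algebra `C(𝓔*) = ⊕_j C^j(𝓔*)` of global functions on `𝓔*`, for `𝓔 = p*E[k]`. -/
def globalFun (k : ℤ) : Subalgebra ℝ (LocalFamily n r E k) where
  carrier := (⨆ j : ℤ, funDeg n r E k j : Submodule ℝ (LocalFamily n r E k))
  add_mem' := fun h h' => add_mem h h'
  mul_mem' := by
    intro f f' h h'
    have key : (⨆ j : ℤ, funDeg n r E k j) * (⨆ j : ℤ, funDeg n r E k j) ≤ ⨆ j : ℤ, funDeg n r E k j := by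
      simp only [Submodule.iSup_mul, Submodule.mul_iSup, iSup_le_iff]
      intro j j'
      exact (Submodule.mul_le.2 fun a ha b hb => mul_mem_funDeg ha hb).trans
        (le_iSup (fun j => funDeg n r E k j) _)
    exact key (Submodule.mul_mem_mul h h')
  algebraMap_mem' t := by
    rw [Algebra.algebraMap_eq_smul_one]
    exact Submodule.smul_mem _ t (Submodule.mem_iSup_of_mem 0 one_mem_funDeg)

variable {n r E}

/-- `f` is (the pull-back of) a function on the base `T*[2]T[1]M`, i.e. `f ∈ C(𝓜) ⊆ C(𝓔*)`. -/
def IsBaseFun {k : ℤ} (f : globalFun n r E k) : Prop :=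
  ∀ i x, f.1 i x ∈ basePart n r k

/-- `f ∈ C(𝓔*)_lin = Γ(𝓔)`: linear in the fibre coordinates. -/
def IsLinFun {k : ℤ} (f : globalFun n r E k) : Prop :=
  ∀ i x, f.1 i x ∈ linPart n r k

/-- A vector field of degree `d` on `𝓔*`: a graded derivation of degree `d` of `C(𝓔*)`. -/
structure VectorField (n r : ℕ) {M : Type*} [TopologicalSpace M]
    [ChartedSpace (EuclideanSpace ℝ (Fin n)) M]
    (E : M → Type*) [TopologicalSpace (TotalSpace (EuclideanSpace ℝ (Fin r)) E)]
    [∀ x, AddCommGroup (E x)] [∀ x, TopologicalSpace (E x)]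
    [FiberBundle (EuclideanSpace ℝ (Fin r)) E] (k d : ℤ) where
  toFun : globalFun n r E k →ₗ[ℝ] globalFun n r E k
  degree : ∀ (j : ℤ) (f : globalFun n r E k), f.1 ∈ funDeg n r E k j → (toFun f).1 ∈ funDeg n r E k (j + d)
  leibniz : ∀ (j : ℤ) (f g : globalFun n r E k), f.1 ∈ funDeg n r E k j →
    toFun (f * g) = toFun f * g + (-1 : ℝ) ^ (d * j) • (f * toFun g)

open Classical in
/-- `a = ∂f/∂x^μ` at `x`, the derivative being taken coefficientwise. -/
def HasPartial {k : ℤ} (i : LocalChart n r E) (f : i.dom → GAlg n r k) (x : M) (μ : Fin n)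
    (a : GAlg n r k) : Prop :=
  ∀ ℓ : GAlg n r k →ₗ[ℝ] ℝ, HasLineDerivAt ℝ
    (fun y => if h : i.chart.symm y ∈ i.dom then ℓ (f ⟨i.chart.symm y, h⟩) else 0)
    (ℓ a) (i.chart x) (EuclideanSpace.single μ (1 : ℝ))

/-- `g = X f` at `x`, where `X = ψ^μ ∂/∂x^μ + X'` and `X'` is a vector field without
`∂/∂x^μ`-component, whose coefficients at `x` are given. -/
def IsFieldAt {k : ℤ} (i : LocalChart n r E) (X' : GAlg n r k →ₗ[ℝ] GAlg n r k)
    (f : i.dom → GAlg n r k) (x : i.dom) (g : GAlg n r k) : Prop :=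
  ∃ a : Fin n → GAlg n r k, (∀ μ, HasPartial i f x μ (a μ)) ∧
    g = ∑ μ, gen k (.psi μ) * a μ + X' (f x)

/-- The coefficients of `∂/∂b_μ` and `∂/∂p_μ` in the homological vector field `d_𝓜`. -/
def homologicalGen (H : ClosedThreeForm n M) (k : ℤ) (i : LocalChart n r E) (x : M) :
    Gen n r → GAlg n r k
  | .psi _ => 0
  | .b μ => gen k (.p μ) + (1 / 2 : ℝ) • ∑ ν, ∑ ρ,
      H.comp i.chart μ ν ρ x • (gen k (.psi ν) * gen k (.psi ρ))
  | .p κ => -((1 / 6 : ℝ) • ∑ μ, ∑ ν, ∑ ρ, partialDeriv i.chart κ (H.comp i.chart μ ν ρ) x •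
      (gen k (.psi μ) * gen k (.psi ν) * gen k (.psi ρ)))
  | .s _ => 0

theorem homologicalGen_mem (H : ClosedThreeForm n M) (k : ℤ) (i : LocalChart n r E) (x : M)
    (g : Gen n r) : homologicalGen H k i x g ∈ homog n r k (g.deg k + 1) := by
  have h2 : ∀ μ ν : Fin n, gen k (Gen.psi μ : Gen n r) * gen k (.psi ν) ∈ homog n r k 2 :=
    fun μ ν => mul_mem_homog_of_eq (psi_mem_homog μ) (psi_mem_homog ν) (by norm_num)
  have h3 : ∀ μ ν ρ : Fin n, gen k (Gen.psi μ : Gen n r) * gen k (.psi ν) * gen k (.psi ρ) ∈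
      homog n r k 3 :=
    fun μ ν ρ => mul_mem_homog_of_eq (h2 μ ν) (psi_mem_homog ρ) (by norm_num)
  cases g with
  | psi σ => exact zero_mem _
  | b μ =>
    rw [show Gen.deg k (Gen.b μ : Gen n r) + 1 = 2 by norm_num [Gen.deg]]
    simp only [homologicalGen]
    exact add_mem (p_mem_homog μ) (Submodule.smul_mem _ _
      (sum_mem fun ν _ => sum_mem fun ρ _ => Submodule.smul_mem _ _ (h2 ν ρ)))
  | p κ =>
    rw [show Gen.deg k (Gen.p κ : Gen n r) + 1 = 3 by norm_num [Gen.deg]]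
    simp only [homologicalGen]
    exact neg_mem (Submodule.smul_mem _ _
      (sum_mem fun μ _ => sum_mem fun ν _ => sum_mem fun ρ _ => Submodule.smul_mem _ _ (h3 μ ν ρ)))
  | s α => exact zero_mem _

/-- The part of `d_𝓜` without `∂/∂x^μ`, that is
`(p_μ + ½ H_{μνρ} ψ^ν ψ^ρ) ∂/∂b_μ - (1/3!) ∂_κ H_{μνρ} ψ^μ ψ^ν ψ^ρ ∂/∂p_κ`; thus
`d_𝓜 = ψ^μ ∂/∂x^μ + homologicalField`. -/
def homologicalField (H : ClosedThreeForm n M) (k : ℤ) (i : LocalChart n r E) (x : M) :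
    GAlg n r k →ₗ[ℝ] GAlg n r k :=
  der 1 (homologicalGen H k i x) (homologicalGen_mem H k i x)

/-- The vertical vector field `C^α_β s_α ∂/∂s_β`, with `C^α_β` (entered as `C α β`) of degree
`d`. -/
def fibreField {k : ℤ} (d : ℤ) (C : Fin r → Fin r → GAlg n r k)
    (hC : ∀ α β, C α β ∈ homog n r k d) : GAlg n r k →ₗ[ℝ] GAlg n r k :=
  der d (fun g : Gen n r => match g with
    | .s β => ∑ α, C α β * gen k (.s α)
    | _ => 0) (by
      intro g
      cases g with
      | s β =>
        simp only [Gen.deg]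
        exact sum_mem fun α _ => mul_mem_homog_of_eq (hC α β) (s_mem_homog α) (add_comm _ _)
      | _ => exact zero_mem _)

/-- A `Q`-connection on `𝓔 = p*E[k] → (T*[2]T[1]M, d_𝓜)`: a vector field `Q_𝓔` of degree `1` on
`𝓔*` which preserves `Γ(𝓔) = C(𝓔*)_lin` and projects to `d_𝓜`. -/
structure QConnection (r : ℕ) (E : M → Type*)
    [TopologicalSpace (TotalSpace (EuclideanSpace ℝ (Fin r)) E)]
    [∀ x, AddCommGroup (E x)] [∀ x, TopologicalSpace (E x)]
    [FiberBundle (EuclideanSpace ℝ (Fin r)) E] (H : ClosedThreeForm n M) (k : ℤ)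
    extends VectorField n r E k 1 where
  preserves_lin : ∀ f : globalFun n r E k, IsLinFun f → IsLinFun (toFun f)
  projects : ∀ f : globalFun n r E k, IsBaseFun f → IsBaseFun (toFun f) ∧
    ∀ (i : LocalChart n r E) (x : i.dom),
      IsFieldAt i (homologicalField H k i x) (f.1 i) x ((toFun f).1 i x)

end Functions

/-! ## Connections and generalized connections -/

section Connections

section Fibres

variable {n : ℕ} {M : Type*} [TopologicalSpace M] [ChartedSpace (EuclideanSpace ℝ (Fin n)) M]

variable (n) in
/-- The cotangent space of `M` at `x`. -/
abbrev CoTan (x : M) : Type := Module.Dual ℝ (TangentSpace (𝓡 n) x)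

variable (n) in
/-- The fibre at `x` of the generalized tangent bundle `𝕋M = TM ⊕ T*M`. -/
abbrev GTan (x : M) : Type := TangentSpace (𝓡 n) x × CoTan n x

/-- The pairing `⟨X + ξ, Y + ν⟩ = ν(X) + ξ(Y)` on `𝕋M`. -/
def pairing (x : M) : GTan n x →ₗ[ℝ] GTan n x →ₗ[ℝ] ℝ :=
  LinearMap.mk₂ ℝ (fun a b => b.2 a.1 + a.2 b.1)
    (fun a a' b => by simp; ring) (fun t a b => by simp; ring)
    (fun a b b' => by simp; ring) (fun t a b => by simp; ring)

/-- Contraction of the first factor of a tensor with a linear form. -/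
def contract {V W : Type*} [AddCommGroup V] [Module ℝ V] [AddCommGroup W] [Module ℝ W]
    (φ : V →ₗ[ℝ] ℝ) : V ⊗[ℝ] W →ₗ[ℝ] W :=
  (TensorProduct.lid ℝ W).toLinearMap ∘ₗ LinearMap.rTensor W φ

/-- The differential `df` at `x`. -/
def differential (f : C^∞⟮𝓡 n, M; ℝ⟯) (x : M) : CoTan n x where
  toFun v :=
    let w : ℝ := mfderiv (𝓡 n) 𝓘(ℝ, ℝ) f x v
    w
  map_add' v w := by simp only [map_add]; rfl
  map_smul' t v := by simp only [map_smul]; rfl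

end Fibres

variable {n r : ℕ} {M : Type*} [TopologicalSpace M] [ChartedSpace (EuclideanSpace ℝ (Fin n)) M]
  {E : M → Type*} [TopologicalSpace (TotalSpace (EuclideanSpace ℝ (Fin r)) E)]
  [∀ x, AddCommGroup (E x)] [∀ x, Module ℝ (E x)] [∀ x, TopologicalSpace (E x)]
  [FiberBundle (EuclideanSpace ℝ (Fin r)) E]

section Components

variable (i : LocalChart n r E) {x : M}

/-- The component of `t ∈ 𝕋M ⊗ E` along `dx^μ ⊗ e_α`. -/
def compForm (μ : Fin n) (α : Fin r) (t : GTan n x ⊗[ℝ] E x) : ℝ :=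
  i.coeff α (contract (pairing x (coordVec i.chart μ x, 0)) t)

/-- The component of `t ∈ 𝕋M ⊗ E` along `∂_μ ⊗ e_α`. -/
def compVec (μ : Fin n) (α : Fin r) (t : GTan n x ⊗[ℝ] E x) : ℝ :=
  i.coeff α (contract (pairing x (0, coordCovec i.chart μ x)) t)

/-- The component `t_μ^α` of `t ∈ T*M ⊗ E` along `dx^μ ⊗ e_α`. -/
def compCoTan (μ : Fin n) (α : Fin r) (t : CoTan n x ⊗[ℝ] E x) : ℝ :=
  i.coeff α (contract (Module.Dual.eval ℝ _ (coordVec i.chart μ x)) t)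

/-- The component `V^{μα}_β` of `V ∈ TM ⊗ End E`, that is `V(dx^μ) e_β = V^{μα}_β e_α`. -/
def compEnd (μ : Fin n) (α β : Fin r)
    (V : TangentSpace (𝓡 n) x ⊗[ℝ] Module.End ℝ (E x)) : ℝ :=
  i.coeff α (contract (coordCovec i.chart μ x) V (i.frame β x))

/-- The identification of `𝕋M ⊗ E` with the functions of degree `1 - k` on `𝓔*` that are linear
in the fibre coordinates: `dx^μ ⊗ e_α ↦ ψ^μ s_α` and `∂_μ ⊗ e_α ↦ b_μ s_α`. -/
def tensorToFun (k : ℤ) (t : GTan n x ⊗[ℝ] E x) : GAlg n r k :=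
  ∑ μ, ∑ α, (compForm i μ α t • (gen k (.psi μ) * gen k (.s α)) +
    compVec i μ α t • (gen k (.b μ) * gen k (.s α)))

end Components

/-- A smooth section of `𝕋M ⊗ E`: its components are smooth in all local coordinates. -/
def IsSmoothGTan (t : ∀ x : M, GTan n x ⊗[ℝ] E x) : Prop :=
  ∀ (i : LocalChart n r E) (μ : Fin n) (α : Fin r),
    ContMDiffOn (𝓡 n) 𝓘(ℝ, ℝ) ∞ (fun x => compForm i μ α (t x)) i.dom ∧
    ContMDiffOn (𝓡 n) 𝓘(ℝ, ℝ) ∞ (fun x => compVec i μ α (t x)) i.dom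

variable (n r M E) in
/-- A smooth section `V` of `TM ⊗ End E`. -/
structure EndSection where
  toFun : ∀ x : M, TangentSpace (𝓡 n) x ⊗[ℝ] Module.End ℝ (E x)
  smooth : ∀ (i : LocalChart n r E) (μ : Fin n) (α β : Fin r),
    ContMDiffOn (𝓡 n) 𝓘(ℝ, ℝ) ∞ (fun x => compEnd i μ α β (toFun x)) i.dom

variable [VectorBundle ℝ (EuclideanSpace ℝ (Fin r)) E]

/-- The product `f σ` of a smooth function and a smooth section. -/
def smulSection (f : C^∞⟮𝓡 n, M; ℝ⟯) (σ : Cₛ^∞⟮𝓡 n; EuclideanSpace ℝ (Fin r), E⟯) :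
    Cₛ^∞⟮𝓡 n; EuclideanSpace ℝ (Fin r), E⟯ :=
  ⟨fun x => f x • σ x, f.contMDiff.smul_section σ.contMDiff⟩

variable (n r M E) in
/-- An ordinary connection `∇ : Γ(E) → Γ(T*M ⊗ E)`, `∇(fσ) = f ∇σ + df ⊗ σ`. -/
structure Connection where
  toFun : Cₛ^∞⟮𝓡 n; EuclideanSpace ℝ (Fin r), E⟯ →ₗ[ℝ] ∀ x : M, CoTan n x ⊗[ℝ] E x
  smooth : ∀ σ (i : LocalChart n r E) (μ : Fin n) (α : Fin r),
    ContMDiffOn (𝓡 n) 𝓘(ℝ, ℝ) ∞ (fun x => compCoTan i μ α (toFun σ x)) i.dom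
  leibniz : ∀ (f : C^∞⟮𝓡 n, M; ℝ⟯) (σ : Cₛ^∞⟮𝓡 n; EuclideanSpace ℝ (Fin r), E⟯) (x : M),
    toFun (smulSection f σ) x = f x • toFun σ x + differential f x ⊗ₜ[ℝ] σ x

variable (n r M E) in
/-- A generalized connection `D : Γ(E) → Γ(𝕋M ⊗ E)`, `D(fσ) = f Dσ + (ρ* df) ⊗ σ`, where
`ρ* : T*M → 𝕋M` is the inclusion. -/
structure GenConnection where
  toFun : Cₛ^∞⟮𝓡 n; EuclideanSpace ℝ (Fin r), E⟯ →ₗ[ℝ] ∀ x : M, GTan n x ⊗[ℝ] E x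
  smooth : ∀ σ, IsSmoothGTan (r := r) (toFun σ)
  leibniz : ∀ (f : C^∞⟮𝓡 n, M; ℝ⟯) (σ : Cₛ^∞⟮𝓡 n; EuclideanSpace ℝ (Fin r), E⟯) (x : M),
    toFun (smulSection f σ) x =
      f x • toFun σ x + ((0, differential f x) : GTan n x) ⊗ₜ[ℝ] σ x

/-- The value at `x` of `(∇ + V) σ ∈ Γ(𝕋M ⊗ E)`. -/
def sumAt (N : Connection n r M E) (V : EndSection n r M E)
    (σ : Cₛ^∞⟮𝓡 n; EuclideanSpace ℝ (Fin r), E⟯) (x : M) : GTan n x ⊗[ℝ] E x :=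
  TensorProduct.map (LinearMap.inr ℝ (TangentSpace (𝓡 n) x) (CoTan n x)) LinearMap.id
      (N.toFun σ x) +
    TensorProduct.map (LinearMap.inl ℝ (TangentSpace (𝓡 n) x) (CoTan n x))
      (LinearMap.applyₗ (σ x)) (V.toFun x)

/-- `Γ_μ^α_β` (entered as `Γ μ α β`) are the connection coefficients of `∇` in the local
coordinates `i`: `(∇_μ σ)^α = ∂_μ σ^α + Γ_μ^α_β σ^β`. -/
def IsConnCoeff (N : Connection n r M E) (i : LocalChart n r E)
    (Γ : Fin n → Fin r → Fin r → M → ℝ) : Prop :=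
  (∀ μ α β, ContMDiffOn (𝓡 n) 𝓘(ℝ, ℝ) ∞ (Γ μ α β) i.dom) ∧
  ∀ (σ : Cₛ^∞⟮𝓡 n; EuclideanSpace ℝ (Fin r), E⟯), ∀ x ∈ i.dom, ∀ μ α,
    compCoTan i μ α (N.toFun σ x) =
      partialDeriv i.chart μ (fun y => i.coeff α (σ y)) x +
        ∑ β, Γ μ α β x * i.coeff β (σ x)

theorem coeff_eq_sum (i j : LocalChart n r E) {x : M} (hi : x ∈ i.dom) (hj : x ∈ j.dom) (u : E x)
    (β : Fin r) : i.coeff β u = ∑ α, j.coeff α u * i.coeff β (j.frame α x) := by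
  have := i.triv_mem
  have := j.triv_mem
  have hc : ∀ v : E x, (i.triv ⟨x, v⟩).2 = i.triv.linearMapAt ℝ x v := fun v => by
    rw [i.triv.coe_linearMapAt_of_mem hi.2]
  have hu : u = ∑ α, j.coeff α u • j.frame α x := by
    conv_lhs => rw [← j.triv.symm_apply_apply_mk hj.2 u]
    have hs : ∀ w, j.triv.symm x w = j.triv.symmₗ ℝ x w := fun w => by
      rw [Trivialization.coe_symmₗ]
      exact hj.2
    simp only [LocalChart.frame, hs, ← map_smul, ← map_sum]
    congr 1
    ext γ
    simp [LocalChart.coeff, Pi.single_apply]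
  conv_lhs => rw [hu]
  simp only [LocalChart.coeff, hc, map_sum, map_smul]
  simp

/-- A section `σ = σ^α e_α` of `E` as the linear function `σ^α s_α ∈ C(𝓔*)_lin`, of degree
`-k`. -/
def linSection [ContMDiffVectorBundle ∞ (EuclideanSpace ℝ (Fin r)) E (𝓡 n)]
    (k : ℤ) (σ : Cₛ^∞⟮𝓡 n; EuclideanSpace ℝ (Fin r), E⟯) : globalFun n r E k :=
  ⟨fun i x => ∑ α, i.coeff α (σ x) • gen k (.s α), by
    refine Submodule.mem_iSup_of_mem (-k) ⟨fun i x hx => ?_, fun i i' x hx hx' => ?_, fun i x =>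
      sum_mem fun α _ => Submodule.smul_mem _ _ (s_mem_homog α)⟩
    · have := i.triv_mem
      refine ⟨i.dom, i.chart.open_source.inter i.triv.open_baseSet, hx, Fin r, inferInstance,
        fun α y => i.coeff α (σ y), fun α => gen k (.s α), fun α => ?_, fun y _ => rfl⟩
      have h := (i.triv.contMDiffOn_section_baseSet_iff (n := ∞) (IB := 𝓡 n)).1
        (σ.contMDiff.contMDiffOn (s := i.triv.baseSet))
      have h' := (EuclideanSpace.proj α : EuclideanSpace ℝ (Fin r) →L[ℝ] ℝ).contMDiff.comp_contMDiffOn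
        (h.mono (inter_subset_right (s := i.chart.source)))
      exact h'
    · simp only [map_sum, map_smul]
      have : ∀ α : Fin r, i.trans i' k x (gen k (.s α)) =
          ∑ β, i.coeff β (i'.frame α x) • gen k (.s β) := fun α =>
        substHom_gen (i.transGen i' k x) (i.transGen_mem i' k x) (.s α)
      simp only [this, Finset.smul_sum, smul_smul]
      rw [Finset.sum_comm]
      exact Finset.sum_congr rfl fun β _ => by rw [← Finset.sum_smul, ← coeff_eq_sum i i' hx hx']⟩

end Connections

/-! ## Local components of the connection and of its curvature -/

section Curvature

variable {n r : ℕ} {k : ℤ}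

/-- `C^α_β = Γ_μ^α_β ψ^μ + V^{μα}_β b_μ`. -/
def connMatrix (k : ℤ) (Γ V : Fin n → Fin r → Fin r → ℝ) (α β : Fin r) : GAlg n r k :=
  ∑ μ, (Γ μ α β • gen k (.psi μ) + V μ α β • gen k (.b μ))

theorem connMatrix_mem (Γ V : Fin n → Fin r → Fin r → ℝ) (α β : Fin r) :
    connMatrix k Γ V α β ∈ homog n r k 1 :=
  sum_mem fun μ _ => add_mem (Submodule.smul_mem _ _ (psi_mem_homog μ))
    (Submodule.smul_mem _ _ (b_mem_homog μ))

/-- The curvature `R_∇ = (∂_μ Γ_ν^α_β + Γ_μ^α_γ Γ_ν^γ_β) ψ^μ ψ^ν` of `∇`; here and below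
`dΓ μ ν α β` stands for `∂_μ Γ_ν^α_β`. -/
def curvNabla (k : ℤ) (Γ : Fin n → Fin r → Fin r → ℝ) (dΓ : Fin n → Fin n → Fin r → Fin r → ℝ)
    (α β : Fin r) : GAlg n r k :=
  ∑ μ, ∑ ν, (dΓ μ ν α β + ∑ γ, Γ μ α γ * Γ ν γ β) • (gen k (.psi μ) * gen k (.psi ν))

/-- The term `½ H_{ρμν} V^{ρα}_β ψ^μ ψ^ν`. -/
def curvH (k : ℤ) (H : Fin n → Fin n → Fin n → ℝ) (V : Fin n → Fin r → Fin r → ℝ)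
    (α β : Fin r) : GAlg n r k :=
  ∑ μ, ∑ ν, ((1 / 2 : ℝ) * ∑ ρ, H ρ μ ν * V ρ α β) • (gen k (.psi μ) * gen k (.psi ν))

/-- The term `VV = V^{μα}_γ V^{νγ}_β b_μ b_ν`. -/
def curvVV (k : ℤ) (V : Fin n → Fin r → Fin r → ℝ) (α β : Fin r) : GAlg n r k :=
  ∑ μ, ∑ ν, (∑ γ, V μ α γ * V ν γ β) • (gen k (.b μ) * gen k (.b ν))

/-- The term `R^{(1,1)} = (∂_μ V^{να}_β + Γ_μ^α_γ V^{νγ}_β - Γ_μ^γ_β V^{να}_γ) ψ^μ b_ν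
+ V^{μα}_β p_μ`; here `dV μ ν α β` stands for `∂_μ V^{να}_β`. -/
def curvMixed (k : ℤ) (Γ V : Fin n → Fin r → Fin r → ℝ)
    (dV : Fin n → Fin n → Fin r → Fin r → ℝ) (α β : Fin r) : GAlg n r k :=
  ∑ μ, ∑ ν, (dV μ ν α β + ∑ γ, (Γ μ α γ * V ν γ β - Γ μ γ β * V ν α γ)) •
      (gen k (.psi μ) * gen k (.b ν)) +
    ∑ μ, V μ α β • gen k (.p μ)

/-- The components `R^α_β` of the curvature. -/
def curvMatrix (k : ℤ) (H : Fin n → Fin n → Fin n → ℝ) (Γ V : Fin n → Fin r → Fin r → ℝ)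
    (dΓ dV : Fin n → Fin n → Fin r → Fin r → ℝ) (α β : Fin r) : GAlg n r k :=
  curvNabla k Γ dΓ α β + curvH k H V α β + curvVV k V α β + curvMixed k Γ V dV α β

theorem curvMatrix_mem (H : Fin n → Fin n → Fin n → ℝ) (Γ V : Fin n → Fin r → Fin r → ℝ)
    (dΓ dV : Fin n → Fin n → Fin r → Fin r → ℝ) (α β : Fin r) :
    curvMatrix k H Γ V dΓ dV α β ∈ homog n r k 2 := by
  have e : (1 : ℤ) + 1 = 2 := by norm_num
  refine add_mem (add_mem (add_mem ?_ ?_) ?_) (add_mem ?_ ?_)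
  · exact sum_mem fun μ _ => sum_mem fun ν _ => Submodule.smul_mem _ _
      (mul_mem_homog_of_eq (psi_mem_homog μ) (psi_mem_homog ν) e)
  · exact sum_mem fun μ _ => sum_mem fun ν _ => Submodule.smul_mem _ _
      (mul_mem_homog_of_eq (psi_mem_homog μ) (psi_mem_homog ν) e)
  · exact sum_mem fun μ _ => sum_mem fun ν _ => Submodule.smul_mem _ _
      (mul_mem_homog_of_eq (b_mem_homog μ) (b_mem_homog ν) e)
  · exact sum_mem fun μ _ => sum_mem fun ν _ => Submodule.smul_mem _ _
      (mul_mem_homog_of_eq (psi_mem_homog μ) (b_mem_homog ν) e)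
  · exact sum_mem fun μ _ => Submodule.smul_mem _ _ (p_mem_homog μ)

end Curvature

end GradedCourant

end

/-! Derivations of the algebra of global functions are local: cutting off with bump functions shows
that the value of a vector field at a point of a chart depends only on its values on functions on
`M` and on the graded coordinates (`VectorField.apply_eq_zero`, `VectorField.apply_eq`). Projecting
to `d_𝓜` fixes all of these except the values on the `s_α`, that is, on sections of `E`. So a
`Q`-connection is determined by what it does to sections.

A section has degree `-k`, so its image is linear in the `s_α` with base coefficients of degree `1`.
All base coordinates have positive degree and `p_μ` has degree `2`, so only `ψ^μ` and `b_μ` can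
occur (`exists_linPoly`), and the image is a section of `𝕋M ⊗ E`. Since `d_𝓜 f = ψ^μ ∂_μ f`, the
graded Leibniz rule becomes that of a generalized connection. This is the map
`QConnection.genConnection`.

The `T*M` part of a generalized connection is an ordinary connection. The `TM` part sees no `df`, so
it is linear over functions and is a section of `TM ⊗ End E`. This is the bijection `sumEquiv`.

For surjectivity, `D = ∇ + V` gives in each chart the field `v = d_𝓜 + C^α_β s_α ∂/∂s_β` with `C =
Γψ + Vb`, and these fields must agree on overlaps (`IsLift.app_trans`). It suffices to look at the
coordinates of a second chart. The differential of `x'^σ` is `ψ'^σ`, and `v²` kills functions, so `v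
ψ' = 0`. The value `v b'` follows from the transformation law of `p`. For `p'` no second derivatives
of the Jacobian are computed: `v b'_μ = p'_μ + ½ H'_{μab} ψ'^a ψ'^b` and `v² b'_μ = 0`, so `v p'_μ =
-v(½ H'_{μab} ψ'^a ψ'^b)`, which is the required coefficient because `dH = 0` (`homologicalGen_p`).
Finally `v s'_α` is the tensor `D e'_α`, whose identification with a function does not depend on the
chart (`trans_tensorToFun`).

The square of `Q` is a derivation of degree `2`. It kills functions on `M` and the coordinates `ψ,
b, p`, because `d_𝓜² = 0`; hence it is vertical. Its value on `s_β` is `(vC + CC)^α_β s_α`, and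
expanding this with `b_μ ψ^ν = -ψ^ν b_μ` gives the four terms of the curvature
(`app_connAt_add_mul`, `app_app_s`). -/

noncomputable section

namespace GradedCourant

/-! ### Induction principles and graded derivations of the coordinate algebra -/

section AlgebraLemmas

variable {n r : ℕ} {k : ℤ}

/-- Generalizing from `P (q w)` to `P (q w * b)` for all `b` turns a product in the free algebra
into two successive left multiplications, so left multiplication by generators suffices. -/
theorem GAlg.induction {P : GAlg n r k → Prop} (one : P 1)
    (gen_mul : ∀ g a, P a → P (gen k g * a)) (add : ∀ a b, P a → P b → P (a + b))
    (smul : ∀ (t : ℝ) a, P a → P (t • a)) (a : GAlg n r k) : P a := by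
  let q : FreeAlgebra ℝ (Gen n r) →ₐ[ℝ] GAlg n r k := RingQuot.mkAlgHom ℝ (CommRel n r k)
  obtain ⟨w, rfl⟩ : ∃ w, q w = a := RingQuot.mkAlgHom_surjective ℝ (CommRel n r k) a
  suffices h : ∀ b : GAlg n r k, P b → P (q w * b) by
    have := h 1 one
    rwa [mul_one] at this
  induction w using FreeAlgebra.induction with
  | grade0 t =>
    intro b hb
    rw [AlgHom.commutes, ← Algebra.smul_def]
    exact smul t b hb
  | grade1 g => exact fun b hb => gen_mul g b hb
  | mul u v hu hv =>
    intro b hb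
    rw [map_mul]
    have := hu _ (hv b hb)
    rwa [← mul_assoc] at this
  | add u v hu hv =>
    intro b hb
    rw [map_add]
    have := add _ _ (hu b hb) (hv b hb)
    rwa [← add_mul] at this

/-- The degree is an index of the motive so that signs such as `(-1)^(d * j)` can depend on it. -/
theorem homog_induction {P : ℤ → GAlg n r k → Prop} (one : P 0 1)
    (gen_mul : ∀ g j a, a ∈ homog n r k j → P j a → P (g.deg k + j) (gen k g * a))
    (zero : ∀ j, P j 0) (add : ∀ j a b, P j a → P j b → P j (a + b))
    (smul : ∀ j (t : ℝ) a, P j a → P j (t • a)) {j : ℤ} {a : GAlg n r k}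
    (ha : a ∈ homog n r k j) : P j a := by
  have key : ∀ l : List (Gen n r), (l.map (gen k)).prod ∈ homog n r k (l.map (Gen.deg k)).sum ∧
      P (l.map (Gen.deg k)).sum (l.map (gen k)).prod := by
    intro l
    induction l with
    | nil => exact ⟨one_mem_homog, one⟩
    | cons g l ih =>
      simp only [List.map_cons, List.prod_cons, List.sum_cons]
      exact ⟨mul_mem_homog (gen_mem_homog g) ih.1, gen_mul g _ _ ih.1 ih.2⟩
  refine Submodule.span_induction (p := fun x _ => P j x) ?_ (zero j)
    (fun x y _ _ => add j x y) (fun t x _ => smul j t x) ha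
  rintro _ ⟨l, rfl, rfl⟩
  exact (key l).2

/-- Two maps satisfying the same graded Leibniz rule agree if they agree on the coordinates. -/
theorem ext_of_leibniz {A : Type*} [Ring A] [Algebra ℝ A] (φ : GAlg n r k → A)
    (ε : Gen n r → ℝ) (D D' : GAlg n r k →ₗ[ℝ] A) (h1 : D 1 = 0) (h1' : D' 1 = 0)
    (h : ∀ g a, D (gen k g * a) = D (gen k g) * φ a + ε g • (φ (gen k g) * D a))
    (h' : ∀ g a, D' (gen k g * a) = D' (gen k g) * φ a + ε g • (φ (gen k g) * D' a))
    (hg : ∀ g, D (gen k g) = D' (gen k g)) (a : GAlg n r k) : D a = D' a := by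
  induction a using GAlg.induction with
  | one => rw [h1, h1']
  | gen_mul g a ih => rw [h, h', hg, ih]
  | add a b ha hb => rw [map_add, map_add, ha, hb]
  | smul t a ha => rw [map_smul, map_smul, ha]

section Der

variable {d : ℤ} {v : Gen n r → GAlg n r k} {hv : ∀ g : Gen n r, v g ∈ homog n r k (g.deg k + d)}

theorem der_gen_mul (g : Gen n r) (a : GAlg n r k) :
    der d v hv (gen k g * a) = v g * a + (-1 : ℝ) ^ (d * g.deg k) • (gen k g * der d v hv a) := by
  -- Stated for any morphism with these values on the generators: the upper right entry of a product
  -- of triangular matrices is the Leibniz rule, once the lower row is known to be `(0, a)`.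
  have key : ∀ F : GAlg n r k →ₐ[ℝ] Matrix (Fin 2) (Fin 2) (GAlg n r k),
      (∀ g, F (gen k g) = !![(-1 : ℝ) ^ (d * g.deg k) • gen k g, v g; 0, gen k g]) →
      F (gen k g * a) 0 1 =
        v g * a + (-1 : ℝ) ^ (d * g.deg k) • (gen k g * F a 0 1) := by
    intro F hF
    have h11 : ∀ a, F a 1 1 = a ∧ F a 1 0 = 0 := by
      intro a
      induction a using GAlg.induction with
      | one => simp
      | gen_mul g a ih => simp [hF, Matrix.mul_apply, Fin.sum_univ_two, ih]
      | add a b ha hb => simp [ha, hb]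
      | smul t a ha => simp [ha]
    simp [hF, Matrix.mul_apply, Fin.sum_univ_two, h11, add_comm]
  exact key _ (liftAlg_gen _ _)

theorem der_one : der d v hv (1 : GAlg n r k) = 0 := by
  simp [der]

theorem der_gen (g : Gen n r) : der d v hv (gen k g) = v g := by
  have := der_gen_mul (hv := hv) g 1
  simpa [der_one] using this

theorem der_mul {j : ℤ} {a : GAlg n r k} (ha : a ∈ homog n r k j) (b : GAlg n r k) :
    der d v hv (a * b) = der d v hv a * b + (-1 : ℝ) ^ (d * j) • (a * der d v hv b) := by
  refine homog_induction (P := fun j a => der d v hv (a * b) =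
    der d v hv a * b + (-1 : ℝ) ^ (d * j) • (a * der d v hv b)) ?_ ?_ ?_ ?_ ?_ ha
  · simp [der_one]
  · intro g j a _ ih
    rw [mul_assoc, der_gen_mul, ih, der_gen_mul, mul_add d, zpow_add₀ (by norm_num)]
    simp only [mul_add, add_mul, smul_add, smul_smul, mul_assoc, mul_smul_comm, smul_mul_assoc,
      add_assoc]
  · intro j; simp
  · intro j a a' h h'
    rw [add_mul, map_add, h, h', map_add, add_mul, add_mul, smul_add]
    abel
  · intro j t a h
    rw [smul_mul_assoc, map_smul, h, map_smul, smul_add, smul_mul_assoc, smul_mul_assoc, smul_comm t]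

theorem der_mem_homog {j : ℤ} {a : GAlg n r k} (ha : a ∈ homog n r k j) :
    der d v hv a ∈ homog n r k (j + d) := by
  refine homog_induction (P := fun j a => der d v hv a ∈ homog n r k (j + d)) ?_ ?_ ?_ ?_ ?_ ha
  · simp [der_one]
  · intro g j a ha ih
    rw [der_gen_mul]
    exact add_mem (mul_mem_homog_of_eq (hv g) ha (by ring))
      (Submodule.smul_mem _ _ (mul_mem_homog_of_eq (gen_mem_homog g) ih (by ring)))
  · intro j; simp
  · intro j a a' h h'; rw [map_add]; exact add_mem h h'
  · intro j t a h; rw [map_smul]; exact Submodule.smul_mem _ _ h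

end Der

/-- The coordinates of the base. -/
def Gen.IsBase : Gen n r → Prop
  | .s _ => False
  | _ => True

theorem gen_mem_basePart {g : Gen n r} (hg : g.IsBase) : gen k g ∈ basePart n r k := by
  refine Algebra.subset_adjoin ?_
  cases g with
  | psi μ => exact Or.inl (Or.inl ⟨μ, rfl⟩)
  | b μ => exact Or.inl (Or.inr ⟨μ, rfl⟩)
  | p μ => exact Or.inr ⟨μ, rfl⟩
  | s α => exact hg.elim

theorem basePart_induction {P : GAlg n r k → Prop} (one : P 1)
    (gen_mul : ∀ g a, g.IsBase → a ∈ basePart n r k → P a → P (gen k g * a))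
    (zero : P 0) (add : ∀ a b, P a → P b → P (a + b))
    (smul : ∀ (t : ℝ) a, P a → P (t • a)) {a : GAlg n r k} (ha : a ∈ basePart n r k) : P a := by
  have ha' : a ∈ Subalgebra.toSubmodule (basePart n r k) := ha
  rw [basePart, Algebra.adjoin_eq_span] at ha'
  refine Submodule.span_induction (p := fun x _ => P x) ?_ zero
    (fun x y _ _ => add x y) (fun t x _ => smul t x) ha'
  intro x hx
  have : x ∈ basePart n r k ∧ P x := by
    refine Submonoid.closure_induction_left (motive := fun x _ => x ∈ basePart n r k ∧ P x)
      ⟨one_mem _, one⟩ ?_ hx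
    rintro x hx y _ ⟨hy, hP⟩
    obtain ⟨g, hg, rfl⟩ : ∃ g : Gen n r, g.IsBase ∧ gen k g = x := by
      rcases hx with (⟨μ, rfl⟩ | ⟨μ, rfl⟩) | ⟨μ, rfl⟩
      exacts [⟨.psi μ, trivial, rfl⟩, ⟨.b μ, trivial, rfl⟩, ⟨.p μ, trivial, rfl⟩]
    exact ⟨mul_mem (gen_mem_basePart hg) hy, gen_mul g y hg hy hP⟩
  exact this.2

theorem base_mul_mem_linPart {a c : GAlg n r k} (ha : a ∈ basePart n r k)
    (hc : c ∈ linPart n r k) : a * c ∈ linPart n r k := by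
  refine Submodule.span_induction (p := fun x _ => a * x ∈ linPart n r k) ?_ ?_ ?_ ?_ hc
  · rintro _ ⟨b, hb, α, rfl⟩
    rw [← mul_assoc]
    exact Submodule.subset_span ⟨a * b, mul_mem ha hb, α, rfl⟩
  · simp
  · intro x y _ _ hx hy; rw [mul_add]; exact add_mem hx hy
  · intro t x _ hx; rw [mul_smul_comm]; exact Submodule.smul_mem _ _ hx

theorem s_mem_linPart (α : Fin r) : gen k (.s α : Gen n r) ∈ linPart n r k :=
  Submodule.subset_span ⟨1, one_mem _, α, one_mul _⟩

theorem der_mem_basePart {d : ℤ} {v : Gen n r → GAlg n r k}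
    {hv : ∀ g : Gen n r, v g ∈ homog n r k (g.deg k + d)}
    (hb : ∀ g : Gen n r, g.IsBase → v g ∈ basePart n r k) {a : GAlg n r k}
    (ha : a ∈ basePart n r k) : der d v hv a ∈ basePart n r k := by
  refine basePart_induction (P := fun a => der d v hv a ∈ basePart n r k) ?_ ?_ ?_ ?_ ?_ ha
  · rw [der_one]; exact zero_mem _
  · intro g a hg ha ih
    rw [der_gen_mul]
    exact add_mem (mul_mem (hb g hg) ha)
      (Subalgebra.smul_mem _ (mul_mem (gen_mem_basePart hg) ih) _)
  · rw [map_zero]; exact zero_mem _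
  · intro a b h h'; rw [map_add]; exact add_mem h h'
  · intro t a h; rw [map_smul]; exact Subalgebra.smul_mem _ h _

theorem der_eq_zero_of_base {d : ℤ} {v : Gen n r → GAlg n r k}
    {hv : ∀ g : Gen n r, v g ∈ homog n r k (g.deg k + d)}
    (hb : ∀ g : Gen n r, g.IsBase → v g = 0) {a : GAlg n r k}
    (ha : a ∈ basePart n r k) : der d v hv a = 0 := by
  refine basePart_induction (P := fun a => der d v hv a = 0) der_one ?_ (map_zero _) ?_ ?_ ha
  · intro g a hg ha ih
    rw [der_gen_mul, ih, hb g hg]; simp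
  · intro a b h h'; rw [map_add, h, h', add_zero]
  · intro t a h; rw [map_smul, h, smul_zero]

theorem der_mem_linPart {d : ℤ} {v : Gen n r → GAlg n r k}
    {hv : ∀ g : Gen n r, v g ∈ homog n r k (g.deg k + d)}
    (hb : ∀ g : Gen n r, g.IsBase → v g ∈ basePart n r k)
    (hs : ∀ α, v (.s α) ∈ linPart n r k) {a : GAlg n r k}
    (ha : a ∈ linPart n r k) : der d v hv a ∈ linPart n r k := by
  have key : ∀ α, ∀ a ∈ basePart n r k, der d v hv (a * gen k (.s α)) ∈ linPart n r k := by
    intro α a ha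
    refine basePart_induction (P := fun a => der d v hv (a * gen k (.s α)) ∈ linPart n r k)
      ?_ ?_ ?_ ?_ ?_ ha
    · rw [one_mul, der_gen]; exact hs α
    · intro g a hg ha ih
      rw [mul_assoc, der_gen_mul]
      exact add_mem (base_mul_mem_linPart (hb g hg) (base_mul_mem_linPart ha (s_mem_linPart α)))
        (Submodule.smul_mem _ _ (base_mul_mem_linPart (gen_mem_basePart hg) ih))
    · simp
    · intro a b h h'; rw [add_mul, map_add]; exact add_mem h h'
    · intro t a h; rw [smul_mul_assoc, map_smul]; exact Submodule.smul_mem _ _ h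
  refine Submodule.span_induction (p := fun x _ => der d v hv x ∈ linPart n r k) ?_ ?_ ?_ ?_ ha
  · rintro _ ⟨b, hb, α, rfl⟩; exact key α b hb
  · simp
  · intro x y _ _ hx hy; rw [map_add]; exact add_mem hx hy
  · intro t x _ hx; rw [map_smul]; exact Submodule.smul_mem _ _ hx

/-- The evaluation at the origin of the graded coordinates. -/
def aug (n r : ℕ) (k : ℤ) : GAlg n r k →ₐ[ℝ] ℝ := liftAlg (fun _ => 0) (by simp)

open Classical in
/-- The coordinate vector field `∂/∂g`. -/
def dGen (k : ℤ) (g : Gen n r) : GAlg n r k →ₗ[ℝ] GAlg n r k :=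
  der (-g.deg k) (fun h => if h = g then 1 else 0) (by
    intro h
    split_ifs with e
    · subst e; simpa using one_mem_homog
    · exact zero_mem _)

/-- The coefficient of `g h` in a polynomial, where `g` is a coordinate of the base and `h` one of
the fibre. -/
def coef (k : ℤ) (g h : Gen n r) : GAlg n r k →ₗ[ℝ] ℝ :=
  (-1 : ℝ) ^ (h.deg k * g.deg k) • ((aug n r k).toLinearMap ∘ₗ dGen k g ∘ₗ dGen k h)

-- Moving `∂/∂s_α` past the base coordinate costs a sign, which the prefactor in `coef` cancels.
-- This gives the linear independence of the `ψ^μ s_α` and `b_μ s_α` without a basis of the whole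
-- algebra.
open Classical in
theorem coef_gen_mul_gen {g g' : Gen n r} (hg' : g'.IsBase) (α β : Fin r) :
    coef k g (.s α) (gen k g' * gen k (.s β)) = if g' = g ∧ α = β then 1 else 0 := by
  have hne : g' ≠ .s α := by rintro rfl; exact hg'
  simp only [coef, dGen, LinearMap.smul_apply, LinearMap.comp_apply, der_gen_mul, if_neg hne,
    der_gen, zero_mul, zero_add, map_smul, AlgHom.toLinearMap_apply]
  by_cases hαβ : α = β
  · subst hαβ
    by_cases hgg : g' = g
    · subst hgg
      simp only [if_true, mul_one, and_self, smul_eq_mul, neg_mul]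
      rw [zpow_neg, mul_inv_cancel_left₀]
      · simp [der_one]
      exact zpow_ne_zero _ (by norm_num)
    · simp [hgg, der_one]
  · simp [hαβ, Ne.symm hαβ]

end AlgebraLemmas

/-! ### Homogeneous components, and linear functions of degree `1 - k` -/

section DegreeOne

variable {n r : ℕ} {k : ℤ}

/-- The decomposition of a polynomial into homogeneous components. -/
def degSplit (n r : ℕ) (k : ℤ) : GAlg n r k →ₐ[ℝ] AddMonoidAlgebra (GAlg n r k) ℤ :=
  liftAlg (fun g => AddMonoidAlgebra.single (g.deg k) (gen k g)) (by
    intro g h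
    rw [AddMonoidAlgebra.single_mul_single, AddMonoidAlgebra.single_mul_single, gen_mul_gen,
      AddMonoidAlgebra.smul_single, add_comm])

/-- The homogeneous component of degree `j`. -/
def degPart (j : ℤ) : GAlg n r k →ₗ[ℝ] GAlg n r k where
  toFun a := (degSplit n r k a).coeff j
  map_add' a b := by simp
  map_smul' t a := by simp

theorem degPart_one (j : ℤ) : degPart j (1 : GAlg n r k) = if j = 0 then 1 else 0 := by
  have h : degPart j (1 : GAlg n r k) = (1 : AddMonoidAlgebra (GAlg n r k) ℤ).coeff j :=
    congrArg (fun x : AddMonoidAlgebra (GAlg n r k) ℤ => x.coeff j) (map_one _)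
  rw [h, AddMonoidAlgebra.one_def, AddMonoidAlgebra.coeff_single, Finsupp.single_apply]
  simp only [eq_comm]

theorem degPart_gen_mul (j : ℤ) (g : Gen n r) (a : GAlg n r k) :
    degPart j (gen k g * a) = gen k g * degPart (-g.deg k + j) a := by
  simp only [degPart, degSplit, LinearMap.coe_mk, AddHom.coe_mk, map_mul, liftAlg_gen,
    AddMonoidAlgebra.coeff_single_mul_apply]

theorem degPart_mul_gen (j : ℤ) (g : Gen n r) (a : GAlg n r k) :
    degPart j (a * gen k g) = degPart (j + -g.deg k) a * gen k g := by
  simp only [degPart, degSplit, LinearMap.coe_mk, AddHom.coe_mk, map_mul, liftAlg_gen,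
    AddMonoidAlgebra.coeff_mul_single_apply]

theorem degPart_of_mem {j : ℤ} {a : GAlg n r k} (ha : a ∈ homog n r k j) : degPart j a = a := by
  refine homog_induction (P := fun j a => degPart j a = a) ?_ ?_ ?_ ?_ ?_ ha
  · simp [degPart_one]
  · intro g j a _ ih
    rw [degPart_gen_mul]
    simp [ih]
  · simp
  · intro j a b ha hb; rw [map_add, ha, hb]
  · intro j t a ha; rw [map_smul, ha]

/-- The polynomials `ψ^μ` and `b_μ` span the base polynomials of degree `1`. -/
theorem degPart_base {a : GAlg n r k} (ha : a ∈ basePart n r k) :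
    (∀ j < 0, degPart j a = 0) ∧ degPart 0 a ∈ Submodule.span ℝ {(1 : GAlg n r k)} ∧
      degPart 1 a ∈ Submodule.span ℝ (range (fun μ : Fin n => gen k (.psi μ : Gen n r)) ∪
        range (fun μ : Fin n => gen k (.b μ : Gen n r))) := by
  refine basePart_induction (P := fun a => (∀ j < 0, degPart j a = 0) ∧
    degPart 0 a ∈ Submodule.span ℝ {(1 : GAlg n r k)} ∧
      degPart 1 a ∈ Submodule.span ℝ (range (fun μ : Fin n => gen k (.psi μ : Gen n r)) ∪
        range (fun μ : Fin n => gen k (.b μ : Gen n r)))) ?_ ?_ ?_ ?_ ?_ ha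
  · refine ⟨fun j hj => ?_, ?_, ?_⟩
    · simp [degPart_one, hj.ne]
    · simp [degPart_one]
    · simp [degPart_one]
  · rintro g a hg - ⟨h1, h2, -⟩
    simp only [degPart_gen_mul]
    -- Base coordinates have positive degree, so a product in degree at most `1` can only come from
    -- a constant times a coordinate of degree `1`, which excludes `p`.
    have hd : 1 ≤ g.deg k := by
      cases g with
      | s α => exact hg.elim
      | _ => simp [Gen.deg]
    refine ⟨fun j hj => ?_, ?_, ?_⟩
    · rw [h1 _ (by omega), mul_zero]
    · rw [h1 _ (by omega), mul_zero]; exact zero_mem _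
    · obtain ⟨t, ht⟩ := Submodule.mem_span_singleton.1 h2
      cases g with
      | s α => exact hg.elim
      | psi μ =>
        simp only [Gen.deg, neg_add_cancel, ← ht, mul_smul_comm, mul_one]
        exact Submodule.smul_mem _ _ (Submodule.subset_span (Or.inl ⟨μ, rfl⟩))
      | b μ =>
        simp only [Gen.deg, neg_add_cancel, ← ht, mul_smul_comm, mul_one]
        exact Submodule.smul_mem _ _ (Submodule.subset_span (Or.inr ⟨μ, rfl⟩))
      | p μ => rw [h1 _ (by simp [Gen.deg]), mul_zero]; exact zero_mem _
  · exact ⟨fun j _ => map_zero _, by rw [map_zero]; exact zero_mem _,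
      by rw [map_zero]; exact zero_mem _⟩
  · rintro a b ⟨h1, h2, h3⟩ ⟨h1', h2', h3'⟩
    exact ⟨fun j hj => by rw [map_add, h1 j hj, h1' j hj, add_zero],
      by rw [map_add]; exact add_mem h2 h2', by rw [map_add]; exact add_mem h3 h3'⟩
  · rintro t a ⟨h1, h2, h3⟩
    exact ⟨fun j hj => by rw [map_smul, h1 j hj, smul_zero],
      by rw [map_smul]; exact Submodule.smul_mem _ _ h2,
      by rw [map_smul]; exact Submodule.smul_mem _ _ h3⟩

/-- `∑ (A_μα ψ^μ s_α + B_μα b_μ s_α)`. -/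
def linPoly (k : ℤ) (A B : Fin n → Fin r → ℝ) : GAlg n r k :=
  ∑ μ, ∑ α, (A μ α • (gen k (.psi μ) * gen k (.s α)) + B μ α • (gen k (.b μ) * gen k (.s α)))

theorem coef_psi_linPoly (A B : Fin n → Fin r → ℝ) (μ : Fin n) (α : Fin r) :
    coef k (.psi μ) (.s α) (linPoly k A B) = A μ α := by
  have h1 : ∀ ν β, coef k (.psi μ : Gen n r) (.s α) (gen k (.psi ν) * gen k (.s β)) =
    if ν = μ ∧ α = β then 1 else 0 := fun ν β => by
      rw [coef_gen_mul_gen (by trivial : Gen.IsBase (.psi ν : Gen n r))]; simp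
  have h2 : ∀ ν β, coef k (.psi μ : Gen n r) (.s α) (gen k (.b ν) * gen k (.s β)) = 0 :=
    fun ν β => by
      rw [coef_gen_mul_gen (by trivial : Gen.IsBase (.b ν : Gen n r))]; simp
  simp only [linPoly, map_sum, map_add, map_smul, h1, h2, smul_eq_mul, mul_zero, add_zero, ite_and]
  simp

theorem coef_b_linPoly (A B : Fin n → Fin r → ℝ) (μ : Fin n) (α : Fin r) :
    coef k (.b μ) (.s α) (linPoly k A B) = B μ α := by
  have h1 : ∀ ν β, coef k (.b μ : Gen n r) (.s α) (gen k (.b ν) * gen k (.s β)) =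
    if ν = μ ∧ α = β then 1 else 0 := fun ν β => by
      rw [coef_gen_mul_gen (by trivial : Gen.IsBase (.b ν : Gen n r))]; simp
  have h2 : ∀ ν β, coef k (.b μ : Gen n r) (.s α) (gen k (.psi ν) * gen k (.s β)) = 0 :=
    fun ν β => by
      rw [coef_gen_mul_gen (by trivial : Gen.IsBase (.psi ν : Gen n r))]; simp
  simp only [linPoly, map_sum, map_add, map_smul, h1, h2, smul_eq_mul, mul_zero, zero_add, ite_and]
  simp

theorem linPoly_add (A B A' B' : Fin n → Fin r → ℝ) :
    linPoly k (A + A') (B + B') = linPoly k A B + linPoly k A' B' := by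
  simp only [linPoly, Pi.add_apply, add_smul, ← Finset.sum_add_distrib]
  exact Finset.sum_congr rfl fun _ _ => Finset.sum_congr rfl fun _ _ => by abel

theorem linPoly_smul (t : ℝ) (A B : Fin n → Fin r → ℝ) :
    linPoly k (t • A) (t • B) = t • linPoly k A B := by
  simp only [linPoly, Pi.smul_apply, smul_eq_mul, mul_smul, ← smul_add, ← Finset.smul_sum]

/-- The functions linear in the fibre coordinates of degree `1 - k`. -/
theorem exists_linPoly {a : GAlg n r k} (ha : a ∈ linPart n r k) (h : a ∈ homog n r k (-k + 1)) :
    ∃ A B, a = linPoly k A B := by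
  let S : Submodule ℝ (GAlg n r k) :=
    { carrier := {a | ∃ A B, a = linPoly k A B}
      zero_mem' := ⟨0, 0, by simp [linPoly]⟩
      add_mem' := by
        rintro _ _ ⟨A, B, rfl⟩ ⟨A', B', rfl⟩
        exact ⟨_, _, (linPoly_add A B A' B').symm⟩
      smul_mem' := by
        rintro t _ ⟨A, B, rfl⟩
        exact ⟨_, _, (linPoly_smul t A B).symm⟩ }
  have hψ : ∀ μ α, gen k (.psi μ) * gen k (.s α) ∈ S := fun μ α =>
    ⟨fun ν β => if ν = μ ∧ β = α then 1 else 0, 0, by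
      simp [linPoly, ite_and]⟩
  have hb : ∀ μ α, gen k (.b μ) * gen k (.s α) ∈ S := fun μ α =>
    ⟨0, fun ν β => if ν = μ ∧ β = α then 1 else 0, by
      simp [linPoly, ite_and]⟩
  -- An element of the span defining `linPart` need not be presented by homogeneous terms. Passing
  -- to the component of degree `1 - k` makes the claim linear, so that it can be checked on the
  -- spanning elements.
  rw [← degPart_of_mem h]
  suffices hS : degPart (-k + 1) a ∈ S from hS
  refine Submodule.span_induction (p := fun x _ => degPart (-k + 1) x ∈ S) ?_ ?_ ?_ ?_ ha
  · rintro _ ⟨c, hc, α, rfl⟩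
    rw [degPart_mul_gen]
    -- The base factor is forced into degree `1`, whatever `k` is.
    have e : -k + 1 + -Gen.deg k (.s α : Gen n r) = 1 := by simp [Gen.deg]
    rw [e]
    refine Submodule.span_induction (p := fun x _ => x * gen k (.s α) ∈ S) ?_ ?_ ?_ ?_
      (degPart_base hc).2.2
    · rintro _ (⟨μ, rfl⟩ | ⟨μ, rfl⟩)
      exacts [hψ μ α, hb μ α]
    · simp
    · intro x y _ _ hx hy; rw [add_mul]; exact add_mem hx hy
    · intro t x _ hx; rw [smul_mul_assoc]; exact Submodule.smul_mem _ _ hx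
  · simp
  · intro x y _ _ hx hy; rw [map_add]; exact add_mem hx hy
  · intro t x _ hx; rw [map_smul]; exact Submodule.smul_mem _ _ hx

theorem linPoly_injective {A B A' B' : Fin n → Fin r → ℝ}
    (h : linPoly k A B = linPoly k A' B') : A = A' ∧ B = B' := by
  refine ⟨?_, ?_⟩ <;> ext μ α
  · rw [← coef_psi_linPoly (k := k) A B, h, coef_psi_linPoly]
  · rw [← coef_b_linPoly (k := k) A B, h, coef_b_linPoly]

end DegreeOne

/-! ### Partial derivatives of functions on `M` in a chart -/

section Calculus

variable {n : ℕ} {M : Type*} [TopologicalSpace M] [ChartedSpace (EuclideanSpace ℝ (Fin n)) M]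

variable (n) in
/-- `g` is smooth on a neighbourhood of `x`. -/
def SmoothNear (g : M → ℝ) (x : M) : Prop :=
  ∀ᶠ y in 𝓝 x, ContMDiffAt (𝓡 n) 𝓘(ℝ, ℝ) ∞ g y

namespace SmoothNear

variable {g h : M → ℝ} {x : M}

/-- Class `C^∞` at a single point only gives neighbourhoods depending on the order of
differentiation. Requiring it at all nearby points makes the condition open, as iterated vector
fields need. -/
theorem eventually (hg : SmoothNear n g x) : ∀ᶠ y in 𝓝 x, SmoothNear n g y :=
  eventually_eventually_nhds.2 hg

theorem contMDiffAt (hg : SmoothNear n g x) : ContMDiffAt (𝓡 n) 𝓘(ℝ, ℝ) ∞ g x :=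
  hg.self_of_nhds

theorem congr (hg : SmoothNear n g x) (h' : h =ᶠ[𝓝 x] g) : SmoothNear n h x := by
  filter_upwards [eventually_eventually_nhds.2 h', hg] with y hy hy'
  exact hy'.congr_of_eventuallyEq hy

theorem of_contMDiffOn {U : Set M} (hU : IsOpen U) (hg : ContMDiffOn (𝓡 n) 𝓘(ℝ, ℝ) ∞ g U)
    (hx : x ∈ U) : SmoothNear n g x := by
  filter_upwards [hU.mem_nhds hx] with y hy
  exact hg.contMDiffAt (hU.mem_nhds hy)

theorem const (t : ℝ) : SmoothNear n (fun _ : M => t) x :=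
  Filter.Eventually.of_forall fun _ => contMDiffAt_const

theorem add (hg : SmoothNear n g x) (hh : SmoothNear n h x) :
    SmoothNear n (fun y => g y + h y) x := by
  filter_upwards [hg, hh] with y hy hy'
  exact hy.add hy'

theorem mul (hg : SmoothNear n g x) (hh : SmoothNear n h x) :
    SmoothNear n (fun y => g y * h y) x := by
  filter_upwards [hg, hh] with y hy hy'
  exact hy.mul hy'

theorem sum {ι : Type*} {s : Finset ι} {g : ι → M → ℝ} (hg : ∀ m ∈ s, SmoothNear n (g m) x) :
    SmoothNear n (fun y => ∑ m ∈ s, g m y) x := by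
  classical
  induction s using Finset.induction_on with
  | empty => simpa using const 0
  | insert a s ha ih =>
    simp only [Finset.sum_insert ha]
    exact (hg a (Finset.mem_insert_self _ _)).add
      (ih fun m hm => hg m (Finset.mem_insert_of_mem hm))

end SmoothNear

variable [IsManifold (𝓡 n) ∞ M] {c c' : OpenPartialHomeomorph M (EuclideanSpace ℝ (Fin n))}
  {g h : M → ℝ} {x : M}

theorem contMDiffOn_chart_of_mem (hc : c ∈ atlas (EuclideanSpace ℝ (Fin n)) M) :
    ContMDiffOn (𝓡 n) (𝓡 n) ∞ c c.source :=
  contMDiffOn_of_mem_maximalAtlas (IsManifold.subset_maximalAtlas hc)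

theorem contMDiffOn_chart_symm_of_mem (hc : c ∈ atlas (EuclideanSpace ℝ (Fin n)) M) :
    ContMDiffOn (𝓡 n) (𝓡 n) ∞ c.symm c.target :=
  contMDiffOn_symm_of_mem_maximalAtlas (IsManifold.subset_maximalAtlas hc)

theorem tendsto_chart_symm (hx : x ∈ c.source) : Filter.Tendsto c.symm (𝓝 (c x)) (𝓝 x) := by
  simpa [c.left_inv hx] using (c.symm.continuousAt (c.map_source hx)).tendsto

theorem SmoothNear.contDiffAt (hg : SmoothNear n g x)
    (hc : c ∈ atlas (EuclideanSpace ℝ (Fin n)) M) (hx : x ∈ c.source) :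
    ∀ᶠ z in 𝓝 (c x), ContDiffAt ℝ ∞ (fun z => g (c.symm z)) z := by
  filter_upwards [(tendsto_chart_symm hx).eventually hg, c.open_target.mem_nhds (c.map_source hx)]
    with z hz hz'
  have h1 := (contMDiffOn_chart_symm_of_mem hc).contMDiffAt (c.open_target.mem_nhds hz')
  exact contMDiffAt_iff_contDiffAt.1 (ContMDiffAt.comp z hz h1)

theorem SmoothNear.of_contDiffAt (hc : c ∈ atlas (EuclideanSpace ℝ (Fin n)) M) (hx : x ∈ c.source)
    {G : EuclideanSpace ℝ (Fin n) → ℝ} (hG : ∀ᶠ z in 𝓝 (c x), ContDiffAt ℝ ∞ G z) :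
    SmoothNear n (fun y => G (c y)) x := by
  filter_upwards [(c.continuousAt hx).eventually hG, c.open_source.mem_nhds hx] with y hy hy'
  have h1 := (contMDiffOn_chart_of_mem hc).contMDiffAt (c.open_source.mem_nhds hy')
  exact ContMDiffAt.comp y hy.contMDiffAt h1

theorem SmoothNear.coord (hc : c ∈ atlas (EuclideanSpace ℝ (Fin n)) M) (hx : x ∈ c.source)
    (σ : Fin n) : SmoothNear n (fun y => c y σ) x :=
  SmoothNear.of_contDiffAt (G := fun z => z σ) hc hx (Filter.Eventually.of_forall fun z => by
    fun_prop)

theorem SmoothNear.differentiableAt (hg : SmoothNear n g x)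
    (hc : c ∈ atlas (EuclideanSpace ℝ (Fin n)) M) (hx : x ∈ c.source) :
    DifferentiableAt ℝ (fun z => g (c.symm z)) (c x) :=
  (hg.contDiffAt hc hx).self_of_nhds.differentiableAt (by simp)

theorem partialDeriv_congr (hx : x ∈ c.source) (h' : g =ᶠ[𝓝 x] h) (μ : Fin n) :
    partialDeriv c μ g x = partialDeriv c μ h x := by
  unfold partialDeriv
  rw [Filter.EventuallyEq.fderiv_eq]
  exact (tendsto_chart_symm hx).eventually h'

@[simp] theorem partialDeriv_const (t : ℝ) (μ : Fin n) :
    partialDeriv c μ (fun _ => t) x = 0 := by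
  simp [partialDeriv]

theorem partialDeriv_add (hc : c ∈ atlas (EuclideanSpace ℝ (Fin n)) M) (hx : x ∈ c.source)
    (hg : SmoothNear n g x) (hh : SmoothNear n h x) (μ : Fin n) :
    partialDeriv c μ (fun y => g y + h y) x = partialDeriv c μ g x + partialDeriv c μ h x := by
  unfold partialDeriv
  rw [fderiv_fun_add (hg.differentiableAt hc hx) (hh.differentiableAt hc hx)]
  rfl

theorem partialDeriv_mul (hc : c ∈ atlas (EuclideanSpace ℝ (Fin n)) M) (hx : x ∈ c.source)
    (hg : SmoothNear n g x) (hh : SmoothNear n h x) (μ : Fin n) :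
    partialDeriv c μ (fun y => g y * h y) x =
      partialDeriv c μ g x * h x + g x * partialDeriv c μ h x := by
  unfold partialDeriv
  rw [fderiv_fun_mul (hg.differentiableAt hc hx) (hh.differentiableAt hc hx)]
  simp [c.left_inv hx]
  ring

theorem partialDeriv_const_mul (hc : c ∈ atlas (EuclideanSpace ℝ (Fin n)) M) (hx : x ∈ c.source)
    (t : ℝ) (hh : SmoothNear n h x) (μ : Fin n) :
    partialDeriv c μ (fun y => t * h y) x = t * partialDeriv c μ h x := by
  rw [partialDeriv_mul hc hx (SmoothNear.const t) hh]
  simp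

theorem partialDeriv_sum (hc : c ∈ atlas (EuclideanSpace ℝ (Fin n)) M) (hx : x ∈ c.source)
    {ι : Type*} {s : Finset ι} {g : ι → M → ℝ} (hg : ∀ m ∈ s, SmoothNear n (g m) x) (μ : Fin n) :
    partialDeriv c μ (fun y => ∑ m ∈ s, g m y) x = ∑ m ∈ s, partialDeriv c μ (g m) x := by
  unfold partialDeriv
  rw [fderiv_fun_sum fun m hm => (hg m hm).differentiableAt hc hx]
  simp

theorem SmoothNear.partialDeriv (hg : SmoothNear n g x)
    (hc : c ∈ atlas (EuclideanSpace ℝ (Fin n)) M) (hx : x ∈ c.source) (μ : Fin n) :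
    SmoothNear n (partialDeriv c μ g) x := by
  refine SmoothNear.of_contDiffAt (G := fun z => fderiv ℝ (fun y => g (c.symm y)) z
    (EuclideanSpace.single μ 1)) hc hx ?_
  filter_upwards [hg.contDiffAt hc hx] with z hz
  exact (hz.fderiv_right (m := ∞) (by simp)).clm_apply contDiffAt_const

/-- Iterated coordinate derivatives become the second Fréchet derivative of the function read in the
chart, whose symmetry gives `partialDeriv_comm`. -/
theorem partialDeriv_partialDeriv (hg : SmoothNear n g x)
    (hc : c ∈ atlas (EuclideanSpace ℝ (Fin n)) M) (hx : x ∈ c.source) (μ ν : Fin n) :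
    partialDeriv c μ (partialDeriv c ν g) x =
      fderiv ℝ (fderiv ℝ (fun y => g (c.symm y))) (c x) (EuclideanSpace.single μ 1)
        (EuclideanSpace.single ν 1) := by
  have h0 := (hg.contDiffAt hc hx).self_of_nhds
  have h1 : DifferentiableAt ℝ (fderiv ℝ (fun y => g (c.symm y))) (c x) :=
    (h0.fderiv_right (m := ∞) (by simp)).differentiableAt (by simp)
  have e : (fun z => partialDeriv c ν g (c.symm z)) =ᶠ[𝓝 (c x)]
      fun z => fderiv ℝ (fun y => g (c.symm y)) z (EuclideanSpace.single ν 1) := by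
    filter_upwards [c.open_target.mem_nhds (c.map_source hx)] with z hz
    simp [partialDeriv, c.right_inv hz]
  conv_lhs => rw [partialDeriv]
  rw [e.fderiv_eq, fderiv_clm_apply h1 (differentiableAt_const _)]
  simp

theorem partialDeriv_comm (hg : SmoothNear n g x)
    (hc : c ∈ atlas (EuclideanSpace ℝ (Fin n)) M) (hx : x ∈ c.source) (μ ν : Fin n) :
    partialDeriv c μ (partialDeriv c ν g) x = partialDeriv c ν (partialDeriv c μ g) x := by
  rw [partialDeriv_partialDeriv hg hc hx, partialDeriv_partialDeriv hg hc hx]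
  refine ((hg.contDiffAt hc hx).self_of_nhds.isSymmSndFDerivAt ?_) _ _
  -- Over `ℝ`, class `C^2` is enough for the second derivative to be symmetric.
  rw [minSmoothness_of_isRCLikeNormedField]
  exact WithTop.coe_le_coe.2 le_top

theorem partialDeriv_coord (hx : x ∈ c.source) (μ ν : Fin n) :
    partialDeriv c μ (fun y => c y ν) x = if ν = μ then 1 else 0 := by
  unfold partialDeriv
  have e : (fun z => c (c.symm z) ν) =ᶠ[𝓝 (c x)] fun z => EuclideanSpace.proj (𝕜 := ℝ) ν z := by
    filter_upwards [c.open_target.mem_nhds (c.map_source hx)] with z hz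
    simp [c.right_inv hz]
  rw [e.fderiv_eq, ContinuousLinearMap.fderiv]
  simp

theorem differentiableAt_transition (hc : c ∈ atlas (EuclideanSpace ℝ (Fin n)) M)
    (hc' : c' ∈ atlas (EuclideanSpace ℝ (Fin n)) M) (hx : x ∈ c.source) (hx' : x ∈ c'.source) :
    DifferentiableAt ℝ (fun y => c' (c.symm y)) (c x) := by
  rw [differentiableAt_euclidean]
  exact fun σ => (SmoothNear.coord hc' hx' σ).differentiableAt hc hx

theorem fderiv_transition_apply (hc : c ∈ atlas (EuclideanSpace ℝ (Fin n)) M)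
    (hc' : c' ∈ atlas (EuclideanSpace ℝ (Fin n)) M) (hx : x ∈ c.source) (hx' : x ∈ c'.source)
    (σ ρ : Fin n) :
    fderiv ℝ (fun y => c' (c.symm y)) (c x) (EuclideanSpace.single ρ 1) σ =
      partialDeriv c ρ (fun y => c' y σ) x := by
  have h1 := (EuclideanSpace.proj σ : EuclideanSpace ℝ (Fin n) →L[ℝ] ℝ).hasFDerivAt.comp (c x)
    (differentiableAt_transition hc hc' hx hx').hasFDerivAt
  unfold partialDeriv
  have h2 : HasFDerivAt (fun y => c' (c.symm y) σ) _ (c x) := h1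
  rw [h2.fderiv]
  rfl

theorem partialDeriv_chain (hc : c ∈ atlas (EuclideanSpace ℝ (Fin n)) M)
    (hc' : c' ∈ atlas (EuclideanSpace ℝ (Fin n)) M) (hx : x ∈ c.source) (hx' : x ∈ c'.source)
    (hg : SmoothNear n g x) (μ : Fin n) :
    partialDeriv c μ g x =
      ∑ σ, partialDeriv c μ (fun y => c' y σ) x * partialDeriv c' σ g x := by
  have e : (fun z => g (c.symm z)) =ᶠ[𝓝 (c x)]
      (fun z => g (c'.symm z)) ∘ fun z => c' (c.symm z) := by
    filter_upwards [(tendsto_chart_symm hx).eventually (c'.open_source.mem_nhds hx')] with z hz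
    simp [c'.left_inv hz]
  have hd : DifferentiableAt ℝ (fun z => g (c'.symm z)) (c' (c.symm (c x))) := by
    rw [c.left_inv hx]; exact hg.differentiableAt hc' hx'
  conv_lhs => rw [partialDeriv]
  rw [e.fderiv_eq, fderiv_comp (c x) hd (differentiableAt_transition hc hc' hx hx'),
    ContinuousLinearMap.comp_apply, c.left_inv hx]
  have hs : ∀ w : EuclideanSpace ℝ (Fin n), w = ∑ σ, w σ • EuclideanSpace.single σ (1 : ℝ) := by
    intro w; ext τ; simp [Pi.single_apply]
  rw [hs (fderiv ℝ (fun z => c' (c.symm z)) (c x) (EuclideanSpace.single μ 1)), map_sum]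
  simp only [map_smul, smul_eq_mul, fderiv_transition_apply hc hc' hx hx']
  rfl

end Calculus

/-! ### Smooth functions with values in the graded algebra -/

section GradedCalculus

variable {n r : ℕ} {k : ℤ} {M : Type*} [TopologicalSpace M]
  [ChartedSpace (EuclideanSpace ℝ (Fin n)) M]

/-- `F` belongs to `C^∞ ⊗ SV` near `x`. -/
def SmoothGr (F : M → GAlg n r k) (x : M) : Prop :=
  ∃ (ι : Type) (_ : Fintype ι) (g : ι → M → ℝ) (a : ι → GAlg n r k),
    (∀ m, SmoothNear n (g m) x) ∧ ∀ᶠ y in 𝓝 x, F y = ∑ m, g m y • a m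

namespace SmoothGr

variable {F G : M → GAlg n r k} {x : M}

theorem eventually (hF : SmoothGr F x) : ∀ᶠ y in 𝓝 x, SmoothGr F y := by
  obtain ⟨ι, _, g, a, hg, e⟩ := hF
  filter_upwards [Filter.eventually_all.2 fun m => (hg m).eventually,
    eventually_eventually_nhds.2 e] with y hy hy'
  exact ⟨ι, inferInstance, g, a, hy, hy'⟩

theorem congr (hF : SmoothGr F x) (h : G =ᶠ[𝓝 x] F) : SmoothGr G x := by
  obtain ⟨ι, _, g, a, hg, e⟩ := hF
  refine ⟨ι, inferInstance, g, a, hg, ?_⟩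
  filter_upwards [e, h] with y hy hy'
  rw [hy', hy]

theorem smul_const {g : M → ℝ} (hg : SmoothNear n g x) (a : GAlg n r k) :
    SmoothGr (fun y => g y • a) x :=
  ⟨Unit, inferInstance, fun _ => g, fun _ => a, fun _ => hg, by simp⟩

theorem const (a : GAlg n r k) : SmoothGr (fun _ : M => a) x := by
  simpa using smul_const (x := x) (SmoothNear.const (n := n) 1) a

theorem add (hF : SmoothGr F x) (hG : SmoothGr G x) : SmoothGr (fun y => F y + G y) x := by
  obtain ⟨ι, _, g, a, hg, e⟩ := hF
  obtain ⟨ι', _, g', a', hg', e'⟩ := hG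
  refine ⟨ι ⊕ ι', inferInstance, Sum.elim g g', Sum.elim a a', ?_, ?_⟩
  · rintro (m | m)
    exacts [hg m, hg' m]
  · filter_upwards [e, e'] with y hy hy'
    simp [hy, hy']

theorem mul (hF : SmoothGr F x) (hG : SmoothGr G x) : SmoothGr (fun y => F y * G y) x := by
  obtain ⟨ι, _, g, a, hg, e⟩ := hF
  obtain ⟨ι', _, g', a', hg', e'⟩ := hG
  refine ⟨ι × ι', inferInstance, fun m y => g m.1 y * g' m.2 y, fun m => a m.1 * a' m.2,
    fun m => (hg m.1).mul (hg' m.2), ?_⟩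
  filter_upwards [e, e'] with y hy hy'
  simp only [hy, hy', Finset.sum_mul_sum, Fintype.sum_prod_type, smul_mul_smul_comm]

theorem fun_smul {g : M → ℝ} (hg : SmoothNear n g x) (hF : SmoothGr F x) :
    SmoothGr (fun y => g y • F y) x := by
  simpa using (smul_const hg 1).mul hF

theorem const_smul (t : ℝ) (hF : SmoothGr F x) : SmoothGr (fun y => t • F y) x :=
  fun_smul (SmoothNear.const t) hF

theorem neg (hF : SmoothGr F x) : SmoothGr (fun y => -F y) x := by
  simpa using hF.const_smul (-1)

theorem sum {ι : Type*} {s : Finset ι} {F : ι → M → GAlg n r k}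
    (hF : ∀ m ∈ s, SmoothGr (F m) x) : SmoothGr (fun y => ∑ m ∈ s, F m y) x := by
  classical
  induction s using Finset.induction_on with
  | empty => simpa using const 0
  | insert a s ha ih =>
    simp only [Finset.sum_insert ha]
    exact (hF a (Finset.mem_insert_self _ _)).add
      (ih fun m hm => hF m (Finset.mem_insert_of_mem hm))

theorem functional (hF : SmoothGr F x) (ℓ : GAlg n r k →ₗ[ℝ] ℝ) :
    SmoothNear n (fun y => ℓ (F y)) x := by
  obtain ⟨ι, _, g, a, hg, e⟩ := hF
  refine SmoothNear.congr (SmoothNear.sum (s := Finset.univ)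
    (g := fun m y => g m y * ℓ (a m)) fun m _ => (hg m).mul (SmoothNear.const _)) ?_
  filter_upwards [e] with y hy
  simp [hy]

/-- A family of linear maps depending smoothly on the point preserves smoothness. -/
theorem apply (hF : SmoothGr F x) {L : M → GAlg n r k →ₗ[ℝ] GAlg n r k}
    (hL : ∀ a, SmoothGr (fun y => L y a) x) : SmoothGr (fun y => L y (F y)) x := by
  obtain ⟨ι, _, g, a, hg, e⟩ := hF
  refine congr (sum (s := Finset.univ) (F := fun m y => g m y • L y (a m))
    fun m _ => fun_smul (hg m) (hL _)) ?_
  filter_upwards [e] with y hy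
  simp [hy]

theorem isSmoothAt (hF : SmoothGr F x) : ∃ U : Set M, IsOpen U ∧ x ∈ U ∧
    ∃ (ι : Type) (_ : Fintype ι) (g : ι → M → ℝ) (a : ι → GAlg n r k),
      (∀ m, ContMDiffOn (𝓡 n) 𝓘(ℝ, ℝ) ∞ (g m) U) ∧ ∀ y ∈ U, F y = ∑ m, g m y • a m := by
  obtain ⟨ι, _, g, a, hg, e⟩ := hF
  obtain ⟨U, hU, hU', hxU⟩ := eventually_nhds_iff.1 ((Filter.eventually_all.2 hg).and e)
  exact ⟨U, hU', hxU, ι, inferInstance, g, a, fun m y hy => ((hU y hy).1 m).contMDiffWithinAt,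
    fun y hy => (hU y hy).2⟩

end SmoothGr

open Classical in
/-- The element of `SV` on which the linear functionals take prescribed values. -/
def ofFunctionals (φ : (GAlg n r k →ₗ[ℝ] ℝ) → ℝ) : GAlg n r k :=
  if h : ∃ a, ∀ ℓ : GAlg n r k →ₗ[ℝ] ℝ, ℓ a = φ ℓ then h.choose else 0

/-- The coefficientwise partial derivative of a function with values in `SV`. -/
def pd (c : OpenPartialHomeomorph M (EuclideanSpace ℝ (Fin n))) (μ : Fin n)
    (F : M → GAlg n r k) (x : M) : GAlg n r k :=
  ofFunctionals fun ℓ => partialDeriv c μ (fun y => ℓ (F y)) x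

/-- Linear functionals separate the points of a vector space over a field, so identities in the
graded algebra can be tested on scalar functions. -/
theorem eq_of_functional {a b : GAlg n r k} (h : ∀ ℓ : GAlg n r k →ₗ[ℝ] ℝ, ℓ a = ℓ b) : a = b := by
  rw [← sub_eq_zero, ← Module.forall_dual_apply_eq_zero_iff ℝ]
  intro ℓ
  rw [map_sub, h, sub_self]

theorem pd_unique {c : OpenPartialHomeomorph M (EuclideanSpace ℝ (Fin n))} {μ : Fin n}
    {F : M → GAlg n r k} {x : M} {a : GAlg n r k}
    (h : ∀ ℓ : GAlg n r k →ₗ[ℝ] ℝ, ℓ a = partialDeriv c μ (fun y => ℓ (F y)) x) :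
    pd c μ F x = a := by
  have h' : ∃ a, ∀ ℓ : GAlg n r k →ₗ[ℝ] ℝ, ℓ a = partialDeriv c μ (fun y => ℓ (F y)) x := ⟨a, h⟩
  rw [pd, ofFunctionals, dif_pos h']
  exact eq_of_functional fun ℓ => by rw [h'.choose_spec, h]

section

variable [IsManifold (𝓡 n) ∞ M] {c : OpenPartialHomeomorph M (EuclideanSpace ℝ (Fin n))}
  {F G : M → GAlg n r k} {x : M}

theorem pd_congr (hx : x ∈ c.source) (h : F =ᶠ[𝓝 x] G) (μ : Fin n) :
    pd c μ F x = pd c μ G x :=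
  congrArg ofFunctionals (funext fun ℓ => partialDeriv_congr hx (h.fun_comp ℓ) μ)

variable (hc : c ∈ atlas (EuclideanSpace ℝ (Fin n)) M) (hx : x ∈ c.source)
include hc hx

/-- For a finite sum of functions times constants the prescribed functional values do come from an
element, so the default value in `ofFunctionals` is never met for smooth `F`. -/
theorem pd_of_rep {ι : Type*} [Fintype ι] {g : ι → M → ℝ} {a : ι → GAlg n r k}
    (hg : ∀ m, SmoothNear n (g m) x) (h : ∀ᶠ y in 𝓝 x, F y = ∑ m, g m y • a m) (μ : Fin n) :
    pd c μ F x = ∑ m, partialDeriv c μ (g m) x • a m := by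
  refine pd_unique fun ℓ => ?_
  have e : (fun y => ℓ (F y)) =ᶠ[𝓝 x] fun y => ∑ m, ℓ (a m) * g m y := by
    filter_upwards [h] with y hy
    simp [hy, mul_comm]
  rw [partialDeriv_congr hx e, partialDeriv_sum hc hx
    (fun m _ => (SmoothNear.const (ℓ (a m))).mul (hg m))]
  simp only [map_sum, map_smul, smul_eq_mul]
  exact Finset.sum_congr rfl fun m _ => by rw [partialDeriv_const_mul hc hx _ (hg m), mul_comm]

theorem functional_pd (hF : SmoothGr F x) (μ : Fin n) (ℓ : GAlg n r k →ₗ[ℝ] ℝ) :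
    ℓ (pd c μ F x) = partialDeriv c μ (fun y => ℓ (F y)) x := by
  obtain ⟨ι, _, g, a, hg, e⟩ := hF
  rw [pd_of_rep hc hx hg e]
  have e : (fun y => ℓ (F y)) =ᶠ[𝓝 x] fun y => ∑ m, ℓ (a m) * g m y := by
    filter_upwards [e] with y hy
    simp [hy, mul_comm]
  rw [partialDeriv_congr hx e, partialDeriv_sum hc hx
    (fun m _ => (SmoothNear.const (ℓ (a m))).mul (hg m))]
  simp only [map_sum, map_smul, smul_eq_mul]
  exact Finset.sum_congr rfl fun m _ => by rw [partialDeriv_const_mul hc hx _ (hg m), mul_comm]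

theorem pd_smul_const {g : M → ℝ} (hg : SmoothNear n g x) (a : GAlg n r k) (μ : Fin n) :
    pd c μ (fun y => g y • a) x = partialDeriv c μ g x • a := by
  have := pd_of_rep (F := fun y => g y • a) (ι := Unit) (g := fun _ => g) (a := fun _ => a) hc hx
    (fun _ => hg) (by simp) μ
  simpa using this

theorem pd_const (a : GAlg n r k) (μ : Fin n) : pd c μ (fun _ => a) x = 0 := by
  have := pd_smul_const hc hx (SmoothNear.const 1) a μ
  simpa using this

theorem pd_add (hF : SmoothGr F x) (hG : SmoothGr G x) (μ : Fin n) :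
    pd c μ (fun y => F y + G y) x = pd c μ F x + pd c μ G x := by
  refine pd_unique fun ℓ => ?_
  simp only [map_add, functional_pd hc hx hF, functional_pd hc hx hG]
  rw [partialDeriv_add hc hx (hF.functional ℓ) (hG.functional ℓ)]

theorem pd_sum {ι : Type*} {s : Finset ι} {F : ι → M → GAlg n r k}
    (hF : ∀ m ∈ s, SmoothGr (F m) x) (μ : Fin n) :
    pd c μ (fun y => ∑ m ∈ s, F m y) x = ∑ m ∈ s, pd c μ (F m) x := by
  refine pd_unique fun ℓ => ?_
  simp only [map_sum]
  rw [partialDeriv_sum hc hx fun m hm => (hF m hm).functional ℓ]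
  exact Finset.sum_congr rfl fun m hm => functional_pd hc hx (hF m hm) μ ℓ

theorem pd_mul (hF : SmoothGr F x) (hG : SmoothGr G x) (μ : Fin n) :
    pd c μ (fun y => F y * G y) x = pd c μ F x * G x + F x * pd c μ G x := by
  obtain ⟨ι, _, g, a, hg, e⟩ := hF
  obtain ⟨ι', _, g', a', hg', e'⟩ := hG
  have e2 : ∀ᶠ y in 𝓝 x, F y * G y =
      ∑ m : ι × ι', (g m.1 y * g' m.2 y) • (a m.1 * a' m.2) := by
    filter_upwards [e, e'] with y hy hy'
    simp only [hy, hy', Finset.sum_mul_sum, Fintype.sum_prod_type, smul_mul_smul_comm]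
  rw [pd_of_rep hc hx (fun m : ι × ι' => (hg m.1).mul (hg' m.2)) e2, pd_of_rep hc hx hg e,
    pd_of_rep hc hx hg' e', e.self_of_nhds, e'.self_of_nhds]
  simp only [Finset.sum_mul_sum, Fintype.sum_prod_type, smul_mul_smul_comm,
    ← Finset.sum_add_distrib, ← add_smul]
  exact Finset.sum_congr rfl fun m _ => Finset.sum_congr rfl fun m' _ => by
    rw [partialDeriv_mul hc hx (hg m) (hg' m')]

theorem pd_fun_smul {g : M → ℝ} (hg : SmoothNear n g x) (hF : SmoothGr F x) (μ : Fin n) :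
    pd c μ (fun y => g y • F y) x = partialDeriv c μ g x • F x + g x • pd c μ F x := by
  have := pd_mul hc hx (SmoothGr.smul_const hg 1) hF μ
  simpa [pd_smul_const hc hx hg] using this

/-- Otherwise some functional kills `W` but not the derivative, although its composite with `F`
vanishes near `x`. The lemma is used for homogeneous elements, base functions and linear functions
alike. -/
theorem pd_mem {W : Submodule ℝ (GAlg n r k)} (hF : SmoothGr F x)
    (h : ∀ᶠ y in 𝓝 x, F y ∈ W) (μ : Fin n) : pd c μ F x ∈ W := by
  by_contra hW
  obtain ⟨ℓ, hℓ, hℓ'⟩ := Submodule.exists_dual_map_eq_bot_of_notMem hW inferInstance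
  apply hℓ
  rw [functional_pd hc hx hF]
  have e : (fun y => ℓ (F y)) =ᶠ[𝓝 x] fun _ => 0 := by
    filter_upwards [h] with y hy
    have : ℓ (F y) ∈ W.map ℓ := Submodule.mem_map_of_mem hy
    rwa [hℓ', Submodule.mem_bot] at this
  rw [partialDeriv_congr hx e, partialDeriv_const]

theorem SmoothGr.pd (hF : SmoothGr F x) (μ : Fin n) : SmoothGr (pd c μ F) x := by
  obtain ⟨ι, _, g, a, hg, e⟩ := hF
  refine ⟨ι, inferInstance, fun m => partialDeriv c μ (g m), a, fun m => (hg m).partialDeriv hc hx μ, ?_⟩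
  filter_upwards [Filter.eventually_all.2 fun m => (hg m).eventually,
    eventually_eventually_nhds.2 e, c.open_source.mem_nhds hx] with y hy hy' hy''
  exact pd_of_rep hc hy'' hy hy' μ

end

end GradedCalculus

/-! ### Local vector fields `ψ^μ ∂/∂x^μ + v_g ∂/∂g` of degree `1` -/

section Fields

variable {n r : ℕ} {k : ℤ} {M : Type*} [TopologicalSpace M]
  [ChartedSpace (EuclideanSpace ℝ (Fin n)) M] [IsManifold (𝓡 n) ∞ M]

variable (n r k M) in
/-- The coefficients, for each point of `M`, of a vector field of degree `1` in the directions of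
the graded coordinates. -/
structure FieldCoeff where
  toFun : M → Gen n r → GAlg n r k
  mem : ∀ x g, toFun x g ∈ homog n r k (g.deg k + 1)

namespace FieldCoeff

variable (v : FieldCoeff n r k M) (c : OpenPartialHomeomorph M (EuclideanSpace ℝ (Fin n)))

/-- The part of the field without `∂/∂x^μ`. -/
def at' (x : M) : GAlg n r k →ₗ[ℝ] GAlg n r k := der 1 (v.toFun x) (v.mem x)

/-- The vector field `ψ^μ ∂/∂x^μ + v_g ∂/∂g`. -/
def app (F : M → GAlg n r k) (x : M) : GAlg n r k :=
  ∑ μ, gen k (.psi μ) * pd c μ F x + v.at' x (F x)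

variable {v c} {F G : M → GAlg n r k} {x : M}

theorem smoothGr_at' (hv : ∀ g, SmoothGr (fun y => v.toFun y g) x) (hF : SmoothGr F x) :
    SmoothGr (fun y => v.at' y (F y)) x := by
  refine hF.apply fun a => ?_
  induction a using GAlg.induction with
  | one => simpa [at', der_one] using SmoothGr.const 0
  | gen_mul g a ih =>
    simp only [at', der_gen_mul]
    exact ((hv g).mul (SmoothGr.const a)).add (((SmoothGr.const _).mul ih).const_smul _)
  | add a b ha hb => simpa only [map_add] using ha.add hb
  | smul t a ha => simpa only [map_smul] using ha.const_smul t

theorem app_congr (hx : x ∈ c.source) (h : F =ᶠ[𝓝 x] G) : v.app c F x = v.app c G x := by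
  simp only [app, pd_congr hx h, h.self_of_nhds]

variable (hc : c ∈ atlas (EuclideanSpace ℝ (Fin n)) M) (hx : x ∈ c.source)
include hc hx

theorem smoothGr_app (hv : ∀ g, SmoothGr (fun y => v.toFun y g) x) (hF : SmoothGr F x) :
    SmoothGr (v.app c F) x :=
  (SmoothGr.sum fun μ _ => (SmoothGr.const _).mul (hF.pd hc hx μ)).add (smoothGr_at' hv hF)

theorem app_add (hF : SmoothGr F x) (hG : SmoothGr G x) :
    v.app c (fun y => F y + G y) x = v.app c F x + v.app c G x := by
  simp only [app, pd_add hc hx hF hG, map_add, mul_add, Finset.sum_add_distrib]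
  abel

theorem app_sum {ι : Type*} {s : Finset ι} {F : ι → M → GAlg n r k}
    (hF : ∀ m ∈ s, SmoothGr (F m) x) :
    v.app c (fun y => ∑ m ∈ s, F m y) x = ∑ m ∈ s, v.app c (F m) x := by
  simp only [app, pd_sum hc hx hF, map_sum, Finset.mul_sum, Finset.sum_add_distrib]
  rw [Finset.sum_comm]

theorem app_const (a : GAlg n r k) : v.app c (fun _ => a) x = v.at' x a := by
  simp [app, pd_const hc hx]

theorem app_const_gen (g : Gen n r) : v.app c (fun _ => gen k g) x = v.toFun x g := by
  rw [app_const hc hx, at', der_gen]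

/-- Moving the odd `ψ^μ` past `F` gives the same sign `(-1)^j` as the derivation part. -/
theorem app_mul {j : ℤ} (hF : SmoothGr F x) (hG : SmoothGr G x) (hj : F x ∈ homog n r k j) :
    v.app c (fun y => F y * G y) x =
      v.app c F x * G x + (-1 : ℝ) ^ j • (F x * v.app c G x) := by
  simp only [app, pd_mul hc hx hF hG, at', der_mul hj, one_mul, mul_add, add_mul, smul_add,
    Finset.sum_add_distrib, Finset.sum_mul, Finset.mul_sum, Finset.smul_sum]
  have : ∀ μ, gen k (.psi μ) * (F x * pd c μ G x) =
      (-1 : ℝ) ^ j • (F x * (gen k (.psi μ) * pd c μ G x)) := fun μ => by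
    rw [← mul_assoc, homog_comm (psi_mem_homog μ) hj, one_mul, smul_mul_assoc, mul_assoc]
  simp only [this, mul_assoc]
  abel

theorem app_fun {g : M → ℝ} (hg : SmoothNear n g x) (a : GAlg n r k) :
    v.app c (fun y => g y • a) x =
      (∑ μ, partialDeriv c μ g x • gen k (.psi μ)) * a + g x • v.at' x a := by
  simp only [app, pd_smul_const hc hx hg, map_smul, mul_smul_comm, Finset.sum_mul, smul_mul_assoc]

theorem app_fun_smul {g : M → ℝ} (hg : SmoothNear n g x) (hF : SmoothGr F x) :
    v.app c (fun y => g y • F y) x =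
      (∑ μ, partialDeriv c μ g x • gen k (.psi μ)) * F x + g x • v.app c F x := by
  simp only [app, pd_fun_smul hc hx hg hF, map_smul, mul_add, mul_smul_comm, Finset.sum_mul,
    smul_mul_assoc, Finset.sum_add_distrib, smul_add, Finset.smul_sum, add_assoc]

theorem app_const_smul (t : ℝ) (hF : SmoothGr F x) :
    v.app c (fun y => t • F y) x = t • v.app c F x := by
  rw [app_fun_smul hc hx (SmoothNear.const t) hF]
  simp

theorem app_mem_homog {j : ℤ} (hF : SmoothGr F x) (hj : ∀ᶠ y in 𝓝 x, F y ∈ homog n r k j) :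
    v.app c F x ∈ homog n r k (j + 1) :=
  add_mem (sum_mem fun μ _ => mul_mem_homog_of_eq (psi_mem_homog μ) (pd_mem hc hx hF hj μ)
    (add_comm _ _)) (der_mem_homog hj.self_of_nhds)

/-- The square of a vector field of degree `1` is a derivation of degree `2`. -/
theorem app_app_mul {j : ℤ} (hv : ∀ g, SmoothGr (fun y => v.toFun y g) x) (hF : SmoothGr F x)
    (hG : SmoothGr G x) (hj : ∀ᶠ y in 𝓝 x, F y ∈ homog n r k j) :
    v.app c (v.app c (fun y => F y * G y)) x =
      v.app c (v.app c F) x * G x + F x * v.app c (v.app c G) x := by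
  have e : v.app c (fun y => F y * G y) =ᶠ[𝓝 x]
      fun y => v.app c F y * G y + (-1 : ℝ) ^ j • (F y * v.app c G y) := by
    filter_upwards [hF.eventually, hG.eventually, hj, c.open_source.mem_nhds hx]
      with y h1 h2 h3 h4
    exact app_mul hc h4 h1 h2 h3
  have hXF := smoothGr_app hc hx hv hF
  have hXG := smoothGr_app hc hx hv hG
  -- The cross terms `(-1)^(j+1) v(F) v(G)` and `(-1)^j v(F) v(G)` cancel, and the sign `(-1)^j
  -- (-1)^j` in front of `F v(v(G))` is `1`.
  rw [app_congr hx e, app_add hc hx (hXF.mul hG) ((hF.mul hXG).const_smul _),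
    app_const_smul hc hx _ (hF.mul hXG), app_mul hc hx hXF hG (app_mem_homog hc hx hF hj),
    app_mul hc hx hF hXG hj.self_of_nhds, smul_add, smul_smul, zpow_neg_one_sq, one_smul,
    zpow_add_one₀ (by norm_num)]
  simp only [mul_neg, mul_one, neg_smul]
  abel

end FieldCoeff

end Fields

/-! ### Charts, frames, Jacobians and the graded coordinate changes -/

section Transitions

variable {n r : ℕ} {M : Type*} [TopologicalSpace M] [ChartedSpace (EuclideanSpace ℝ (Fin n)) M]
  {E : M → Type*} [TopologicalSpace (TotalSpace (EuclideanSpace ℝ (Fin r)) E)]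
  [∀ x, AddCommGroup (E x)] [∀ x, Module ℝ (E x)] [∀ x, TopologicalSpace (E x)]
  [FiberBundle (EuclideanSpace ℝ (Fin r)) E]

namespace LocalChart

theorem isOpen_dom (i : LocalChart n r E) : IsOpen i.dom :=
  i.chart.open_source.inter i.triv.open_baseSet

theorem dom_mem_nhds (i : LocalChart n r E) {x : M} (hx : x ∈ i.dom) : i.dom ∈ 𝓝 x :=
  i.isOpen_dom.mem_nhds hx

variable (n r E) in
/-- A chart and a trivialization around a point. -/
def around (x : M) : LocalChart n r E :=
  ⟨chartAt _ x, chart_mem_atlas _ x, trivializationAt _ E x, inferInstance⟩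

theorem mem_dom_around (x : M) : x ∈ (around n r E x).dom :=
  ⟨mem_chart_source _ x, FiberBundle.mem_baseSet_trivializationAt' x⟩

section Frames

variable [VectorBundle ℝ (EuclideanSpace ℝ (Fin r)) E] (i : LocalChart n r E) {x : M}

theorem coeff_eq_linearMapAt (hx : x ∈ i.dom) (α : Fin r) (u : E x) :
    have := i.triv_mem
    i.coeff α u = i.triv.linearMapAt ℝ x u α := by
  intro _
  rw [coeff, i.triv.coe_linearMapAt_of_mem hx.2]

variable (hx : x ∈ i.dom)
include hx

theorem coeff_add (α : Fin r) (u v : E x) : i.coeff α (u + v) = i.coeff α u + i.coeff α v := by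
  simp [coeff_eq_linearMapAt i hx]

theorem coeff_smul (α : Fin r) (t : ℝ) (u : E x) : i.coeff α (t • u) = t * i.coeff α u := by
  simp [coeff_eq_linearMapAt i hx]

/-- The component `u ↦ u^α` as a linear form. -/
def coeffₗ (α : Fin r) : E x →ₗ[ℝ] ℝ where
  toFun := i.coeff α
  map_add' := coeff_add i hx α
  map_smul' := coeff_smul i hx α

theorem coeffₗ_apply (α : Fin r) (u : E x) : i.coeffₗ hx α u = i.coeff α u := rfl

theorem coeff_zero (α : Fin r) : i.coeff α (0 : E x) = 0 := map_zero (i.coeffₗ hx α)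

theorem coeff_sum {ι : Type*} (s : Finset ι) (α : Fin r) (u : ι → E x) :
    i.coeff α (∑ m ∈ s, u m) = ∑ m ∈ s, i.coeff α (u m) := map_sum (i.coeffₗ hx α) u s

theorem coeff_frame (α β : Fin r) : i.coeff α (i.frame β x) = if α = β then 1 else 0 := by
  have := i.triv.apply_mk_symm hx.2 (EuclideanSpace.single β (1 : ℝ))
  rw [coeff, frame, this]
  simp

theorem coeff_ext {u v : E x} (h : ∀ α, i.coeff α u = i.coeff α v) : u = v := by
  rw [← i.triv.symm_apply_apply_mk hx.2 u, ← i.triv.symm_apply_apply_mk hx.2 v]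
  congr 1
  ext α
  exact h α

theorem sum_coeff_frame (u : E x) : ∑ α, i.coeff α u • i.frame α x = u := by
  refine i.coeff_ext hx fun α => ?_
  simp [coeff_sum i hx, coeff_smul i hx, coeff_frame i hx]

end Frames

variable [IsManifold (𝓡 n) ∞ M] (i j l : LocalChart n r E) {x : M}

theorem jac_eq (hi : x ∈ i.dom) (hj : x ∈ j.dom) (σ ρ : Fin n) :
    i.jac j x σ ρ = partialDeriv i.chart ρ (fun y => j.chart y σ) x :=
  fderiv_transition_apply i.chart_mem j.chart_mem hi.1 hj.1 σ ρ

theorem jac_eventuallyEq (hi : x ∈ i.dom) (hj : x ∈ j.dom) (σ ρ : Fin n) :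
    (fun y => i.jac j y σ ρ) =ᶠ[𝓝 x] partialDeriv i.chart ρ (fun y => j.chart y σ) := by
  filter_upwards [i.dom_mem_nhds hi, j.dom_mem_nhds hj] with y h h'
  exact jac_eq i j h h' σ ρ

theorem smoothNear_jac (hi : x ∈ i.dom) (hj : x ∈ j.dom) (σ ρ : Fin n) :
    SmoothNear n (fun y => i.jac j y σ ρ) x :=
  ((SmoothNear.coord j.chart_mem hj.1 σ).partialDeriv i.chart_mem hi.1 ρ).congr
    (jac_eventuallyEq i j hi hj σ ρ)

theorem partialDeriv_chain_jac (hi : x ∈ i.dom) (hj : x ∈ j.dom) {g : M → ℝ}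
    (hg : SmoothNear n g x) (μ : Fin n) :
    partialDeriv i.chart μ g x = ∑ σ, i.jac j x σ μ * partialDeriv j.chart σ g x := by
  rw [partialDeriv_chain i.chart_mem j.chart_mem hi.1 hj.1 hg]
  exact Finset.sum_congr rfl fun σ _ => by rw [jac_eq i j hi hj]

theorem jac_mul_jac (hi : x ∈ i.dom) (hj : x ∈ j.dom) (hl : x ∈ l.dom) (σ ρ : Fin n) :
    ∑ τ, j.jac l x σ τ * i.jac j x τ ρ = i.jac l x σ ρ := by
  rw [jac_eq i l hi hl, partialDeriv_chain_jac i j hi hj (SmoothNear.coord l.chart_mem hl.1 σ)]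
  exact Finset.sum_congr rfl fun τ _ => by rw [jac_eq j l hj hl, mul_comm]

theorem jac_self (hi : x ∈ i.dom) (σ ρ : Fin n) : i.jac i x σ ρ = if σ = ρ then 1 else 0 := by
  rw [jac_eq i i hi hi, partialDeriv_coord hi.1]

theorem jac_mul_jac_self (hi : x ∈ i.dom) (hj : x ∈ j.dom) (σ ρ : Fin n) :
    ∑ τ, j.jac i x σ τ * i.jac j x τ ρ = if σ = ρ then 1 else 0 := by
  rw [jac_mul_jac i j i hi hj hi, jac_self i hi]

theorem jacDeriv_eq (hi : x ∈ i.dom) (hj : x ∈ j.dom) (l σ ρ : Fin n) :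
    i.jacDeriv j x l σ ρ = partialDeriv i.chart l (fun y => i.jac j y σ ρ) x := by
  have e : ∀ σ, (fun y => fderiv ℝ (fun z => j.chart (i.chart.symm z)) y
      (EuclideanSpace.single ρ 1) σ) =ᶠ[𝓝 (i.chart x)]
      fun y => i.jac j (i.chart.symm y) σ ρ := by
    intro σ
    filter_upwards [i.chart.open_target.mem_nhds (i.chart.map_source hi.1)] with y hy
    rw [jac, i.chart.right_inv hy]
  have hd : DifferentiableAt ℝ (fun y => fderiv ℝ (fun z => j.chart (i.chart.symm z)) y
      (EuclideanSpace.single ρ 1)) (i.chart x) := by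
    rw [differentiableAt_euclidean]
    exact fun σ => ((smoothNear_jac i j hi hj σ ρ).differentiableAt i.chart_mem
      hi.1).congr_of_eventuallyEq (e σ)
  have h1 := (EuclideanSpace.proj σ : EuclideanSpace ℝ (Fin n) →L[ℝ] ℝ).hasFDerivAt.comp
    (i.chart x) hd.hasFDerivAt
  rw [partialDeriv, ← (e σ).fderiv_eq]
  have h2 : HasFDerivAt (fun y => fderiv ℝ (fun z => j.chart (i.chart.symm z)) y
      (EuclideanSpace.single ρ 1) σ) _ (i.chart x) := h1
  rw [h2.fderiv]
  rfl

/-- The derivative of the inverse Jacobian, `∂K = -K (∂J) K`. -/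
theorem partialDeriv_jac_inv (hi : x ∈ i.dom) (hj : x ∈ j.dom) (l ν μ : Fin n) :
    partialDeriv i.chart l (fun y => j.jac i y ν μ) x =
      -∑ ρ, ∑ σ, j.jac i x ρ μ * i.jacDeriv j x l σ ρ * j.jac i x ν σ := by
  have hK := fun σ => smoothNear_jac j i hj hi ν σ
  have hJ := fun σ ρ => smoothNear_jac i j hi hj σ ρ
  have h0 : ∀ ρ, ∑ σ, (partialDeriv i.chart l (fun y => j.jac i y ν σ) x * i.jac j x σ ρ +
      j.jac i x ν σ * i.jacDeriv j x l σ ρ) = 0 := by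
    intro ρ
    have e : (fun y => ∑ σ, j.jac i y ν σ * i.jac j y σ ρ) =ᶠ[𝓝 x]
        fun _ => if ν = ρ then (1 : ℝ) else 0 := by
      filter_upwards [i.dom_mem_nhds hi, j.dom_mem_nhds hj] with y h h'
      exact jac_mul_jac_self i j h h' ν ρ
    have h := partialDeriv_congr (c := i.chart) hi.1 e l
    rw [partialDeriv_const, partialDeriv_sum i.chart_mem hi.1
      (fun σ _ => (hK σ).mul (hJ σ ρ))] at h
    rw [← h]
    exact Finset.sum_congr rfl fun σ _ => by
      rw [partialDeriv_mul i.chart_mem hi.1 (hK σ) (hJ σ ρ), jacDeriv_eq i j hi hj]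
  have h1 : ∑ ρ, j.jac i x ρ μ * ∑ σ, (partialDeriv i.chart l (fun y => j.jac i y ν σ) x *
      i.jac j x σ ρ + j.jac i x ν σ * i.jacDeriv j x l σ ρ) = 0 := by simp [h0]
  have h2 : ∑ ρ, j.jac i x ρ μ * ∑ σ, partialDeriv i.chart l (fun y => j.jac i y ν σ) x *
      i.jac j x σ ρ = partialDeriv i.chart l (fun y => j.jac i y ν μ) x := by
    simp only [Finset.mul_sum]
    rw [Finset.sum_comm]
    have : ∀ σ, ∑ ρ, j.jac i x ρ μ * (partialDeriv i.chart l (fun y => j.jac i y ν σ) x *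
      i.jac j x σ ρ) = partialDeriv i.chart l (fun y => j.jac i y ν σ) x *
        if σ = μ then 1 else 0 := fun σ => by
      rw [← jac_mul_jac_self j i hj hi σ μ, Finset.mul_sum]
      exact Finset.sum_congr rfl fun ρ _ => by ring
    simp [this]
  simp only [Finset.sum_add_distrib, mul_add, h2] at h1
  rw [eq_neg_iff_add_eq_zero, ← h1]
  simp only [Finset.mul_sum, add_right_inj]
  exact Finset.sum_congr rfl fun ρ _ => Finset.sum_congr rfl fun σ _ => by ring

/-- The coordinates `p'` in terms of the derivative of the inverse Jacobian. -/
theorem transGen_p (k : ℤ) (hi : x ∈ i.dom) (hj : x ∈ j.dom) (μ : Fin n) :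
    i.transGen j k x (.p μ) = (∑ ν, j.jac i x ν μ • gen k (.p ν)) +
      ∑ l, ∑ ν, partialDeriv i.chart l (fun y => j.jac i y ν μ) x •
        (gen k (.psi l) * gen k (.b ν)) := by
  simp only [transGen, sub_eq_add_neg, partialDeriv_jac_inv i j hi hj, neg_smul,
    Finset.sum_neg_distrib, Finset.sum_smul]

theorem trans_gen (k : ℤ) (g : Gen n r) : i.trans j k x (gen k g) = i.transGen j k x g :=
  substHom_gen _ _ g

variable [VectorBundle ℝ (EuclideanSpace ℝ (Fin r)) E]

/-- For `p` the inhomogeneous terms match because the inverse Jacobian of a composite is the product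
of the inverse Jacobians, differentiated by the product and chain rules (`hK`). The other
coordinates transform linearly. This cocycle identity lets a coordinate of one chart be read
consistently in all the others. -/
theorem trans_transGen (k : ℤ) (hi : x ∈ i.dom) (hj : x ∈ j.dom) (hl : x ∈ l.dom) (g : Gen n r) :
    i.trans j k x (j.transGen l k x g) = i.transGen l k x g := by
  cases g with
  | psi σ =>
    simp only [transGen, map_sum, map_smul, trans_gen, Finset.smul_sum, smul_smul]
    rw [Finset.sum_comm]
    simp only [← Finset.sum_smul, jac_mul_jac i j l hi hj hl]
  | b μ =>
    simp only [transGen, map_sum, map_smul, trans_gen, Finset.smul_sum, smul_smul]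
    rw [Finset.sum_comm]
    simp only [← Finset.sum_smul]
    refine Finset.sum_congr rfl fun ν _ => ?_
    rw [← jac_mul_jac l j i hl hj hi ν μ]
    simp only [mul_comm]
  | s α =>
    simp only [transGen, map_sum, map_smul, trans_gen, Finset.smul_sum, smul_smul]
    rw [Finset.sum_comm]
    simp only [← Finset.sum_smul, ← coeff_eq_sum i j hi hj]
  | p μ =>
    have hK : ∀ κ, ∀ m, partialDeriv i.chart m (fun y => l.jac i y κ μ) x =
        ∑ ν, (partialDeriv i.chart m (fun y => j.jac i y κ ν) x * l.jac j x ν μ +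
          j.jac i x κ ν * ∑ τ, i.jac j x τ m * partialDeriv j.chart τ (fun y => l.jac j y ν μ) x) := by
      intro κ m
      have e : (fun y => l.jac i y κ μ) =ᶠ[𝓝 x]
          fun y => ∑ ν, j.jac i y κ ν * l.jac j y ν μ := by
        filter_upwards [i.dom_mem_nhds hi, j.dom_mem_nhds hj, l.dom_mem_nhds hl] with y h h' h''
        exact (jac_mul_jac l j i h'' h' h κ μ).symm
      rw [partialDeriv_congr hi.1 e, partialDeriv_sum i.chart_mem hi.1 fun ν _ =>
        (smoothNear_jac j i hj hi κ ν).mul (smoothNear_jac l j hl hj ν μ)]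
      refine Finset.sum_congr rfl fun ν _ => ?_
      rw [partialDeriv_mul i.chart_mem hi.1 (smoothNear_jac j i hj hi κ ν)
        (smoothNear_jac l j hl hj ν μ),
        partialDeriv_chain_jac i j hi hj (smoothNear_jac l j hl hj ν μ)]
    have hb : ∀ ν, i.transGen j k x (.b ν) = ∑ κ, j.jac i x κ ν • gen k (.b κ) := fun _ => rfl
    have hψ : ∀ ν, i.transGen j k x (.psi ν) = ∑ m, i.jac j x ν m • gen k (.psi m) := fun _ => rfl
    have hprod : ∀ τ ν, (∑ m, i.jac j x τ m • gen k (.psi m : Gen n r)) *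
        (∑ κ, j.jac i x κ ν • gen k (.b κ)) =
        ∑ m, ∑ κ, (i.jac j x τ m * j.jac i x κ ν) • (gen k (.psi m) * gen k (.b κ)) := by
      intro τ ν
      simp only [Finset.sum_mul_sum, smul_mul_smul_comm]
    rw [transGen_p j l k hj hl, transGen_p i l k hi hl]
    simp only [map_add, map_sum, map_smul, map_mul, trans_gen, transGen_p i j k hi hj, hb, hψ, hprod, hK]
    simp only [smul_add, Finset.sum_add_distrib]
    rw [add_assoc]
    congr 1
    · simp only [Finset.smul_sum, smul_smul]
      rw [Finset.sum_comm]
      simp only [← Finset.sum_smul]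
      refine Finset.sum_congr rfl fun ν _ => ?_
      rw [← jac_mul_jac l j i hl hj hi ν μ]
      simp only [mul_comm]
    · simp only [Finset.smul_sum, smul_smul,
        add_smul, Finset.sum_add_distrib, Finset.sum_smul, Finset.mul_sum]
      congr 1
      · rw [Finset.sum_comm]
        refine Finset.sum_congr rfl fun m _ => ?_
        rw [Finset.sum_comm]
        exact Finset.sum_congr rfl fun κ _ => Finset.sum_congr rfl fun ν _ => by rw [mul_comm]
      · have : ∀ f : Fin n → Fin n → Fin n → Fin n → GAlg n r k,
            ∑ τ, ∑ ν, ∑ m, ∑ κ, f τ ν m κ = ∑ m, ∑ κ, ∑ ν, ∑ τ, f τ ν m κ := by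
          intro f
          calc _ = ∑ τ, ∑ m, ∑ ν, ∑ κ, f τ ν m κ :=
                Finset.sum_congr rfl fun τ _ => Finset.sum_comm
            _ = ∑ m, ∑ τ, ∑ ν, ∑ κ, f τ ν m κ := Finset.sum_comm
            _ = ∑ m, ∑ τ, ∑ κ, ∑ ν, f τ ν m κ :=
                Finset.sum_congr rfl fun m _ => Finset.sum_congr rfl fun τ _ => Finset.sum_comm
            _ = ∑ m, ∑ κ, ∑ τ, ∑ ν, f τ ν m κ :=
                Finset.sum_congr rfl fun m _ => Finset.sum_comm
            _ = _ := Finset.sum_congr rfl fun m _ => Finset.sum_congr rfl fun κ _ =>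
                Finset.sum_comm
        rw [this]
        refine Finset.sum_congr rfl fun m _ => Finset.sum_congr rfl fun κ _ =>
          Finset.sum_congr rfl fun ν _ => Finset.sum_congr rfl fun τ _ => ?_
        congr 1
        ring

/-- The Jacobian from a chart to itself is the identity on a whole neighbourhood, so the derivative
in the inhomogeneous term of `p` vanishes. -/
theorem trans_self_gen (k : ℤ) (hi : x ∈ i.dom) (g : Gen n r) : i.transGen i k x g = gen k g := by
  cases g with
  | psi σ => simp [transGen, jac_self i hi]
  | b μ => simp [transGen, jac_self i hi]
  | s α => simp [transGen, coeff_frame i hi]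
  | p μ =>
    have e : ∀ ν l, partialDeriv i.chart l (fun y => i.jac i y ν μ) x = 0 := by
      intro ν l
      have : (fun y => i.jac i y ν μ) =ᶠ[𝓝 x] fun _ => if ν = μ then (1 : ℝ) else 0 := by
        filter_upwards [i.dom_mem_nhds hi] with y h
        exact jac_self i h ν μ
      rw [partialDeriv_congr hi.1 this, partialDeriv_const]
    simp [transGen_p i i k hi hi, jac_self i hi, e]

theorem transGen_mem_basePart (k : ℤ) {g : Gen n r} (hg : g.IsBase) :
    i.transGen j k x g ∈ basePart n r k := by
  have hψ : ∀ l : Fin n, gen k (.psi l : Gen n r) ∈ basePart n r k :=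
    fun l => gen_mem_basePart trivial
  have hb : ∀ l : Fin n, gen k (.b l : Gen n r) ∈ basePart n r k :=
    fun l => gen_mem_basePart trivial
  have hp : ∀ l : Fin n, gen k (.p l : Gen n r) ∈ basePart n r k :=
    fun l => gen_mem_basePart trivial
  cases g with
  | psi σ => exact sum_mem fun ρ _ => Subalgebra.smul_mem _ (hψ ρ) _
  | b μ => exact sum_mem fun ρ _ => Subalgebra.smul_mem _ (hb ρ) _
  | s α => exact hg.elim
  | p μ =>
    exact sub_mem (sum_mem fun ρ _ => Subalgebra.smul_mem _ (hp ρ) _)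
      (sum_mem fun l _ => sum_mem fun ν _ => sum_mem fun ρ _ => sum_mem fun σ _ =>
        Subalgebra.smul_mem _ (mul_mem (hψ l) (hb ν)) _)

variable [ContMDiffVectorBundle ∞ (EuclideanSpace ℝ (Fin r)) E (𝓡 n)]

theorem contMDiffOn_frame (α : Fin r) : ContMDiffOn (𝓡 n) ((𝓡 n).prod 𝓘(ℝ, EuclideanSpace ℝ (Fin r)))
    ∞ (fun x => TotalSpace.mk' (EuclideanSpace ℝ (Fin r)) x (i.frame α x)) i.dom := by
  have := i.triv_mem
  refine (i.triv.contMDiffOn_section_iff i.isOpen_dom inter_subset_right).2 ?_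
  refine (contMDiffOn_const (c := EuclideanSpace.single α (1 : ℝ))).congr fun x hx => ?_
  have := i.triv.apply_mk_symm hx.2 (EuclideanSpace.single α (1 : ℝ))
  rw [frame, this]

theorem smoothNear_coeff {s : ∀ x, E x} (hx : x ∈ i.dom) {U : Set M} (hU : U ∈ 𝓝 x)
    (hs : ContMDiffOn (𝓡 n) ((𝓡 n).prod 𝓘(ℝ, EuclideanSpace ℝ (Fin r))) ∞
      (fun x => TotalSpace.mk' (EuclideanSpace ℝ (Fin r)) x (s x)) U) (α : Fin r) :
    SmoothNear n (fun y => i.coeff α (s y)) x := by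
  have := i.triv_mem
  filter_upwards [i.dom_mem_nhds hx, eventually_mem_nhds_iff.2 hU] with y hy hyU
  have h := (i.triv.contMDiffAt_section_iff (n := ∞) (IB := 𝓡 n) hy.2).1 (hs.contMDiffAt hyU)
  exact (EuclideanSpace.proj α : EuclideanSpace ℝ (Fin r) →L[ℝ] ℝ).contMDiff.contMDiffAt.comp y h

theorem smoothNear_frame (hi : x ∈ i.dom) (hj : x ∈ j.dom) (α β : Fin r) :
    SmoothNear n (fun y => i.coeff β (j.frame α y)) x :=
  i.smoothNear_coeff hi (j.dom_mem_nhds hj) (j.contMDiffOn_frame α) β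

theorem smoothGr_transGen (k : ℤ) (hi : x ∈ i.dom) (hj : x ∈ j.dom) (g : Gen n r) :
    SmoothGr (fun y => i.transGen j k y g) x := by
  cases g with
  | psi σ => exact SmoothGr.sum fun ρ _ => SmoothGr.smul_const (smoothNear_jac i j hi hj σ ρ) _
  | b μ => exact SmoothGr.sum fun ν _ => SmoothGr.smul_const (smoothNear_jac j i hj hi ν μ) _
  | p μ =>
    have h : SmoothGr (fun x => (∑ ν, j.jac i x ν μ • gen k (.p ν : Gen n r)) +
      ∑ l, ∑ ν, partialDeriv i.chart l (fun y => j.jac i y ν μ) x •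
        (gen k (.psi l) * gen k (.b ν))) x :=
      (SmoothGr.sum fun ν _ => SmoothGr.smul_const (smoothNear_jac j i hj hi ν μ) _).add
        (SmoothGr.sum fun l _ => SmoothGr.sum fun ν _ => SmoothGr.smul_const
          ((smoothNear_jac j i hj hi ν μ).partialDeriv i.chart_mem hi.1 l) _)
    refine h.congr ?_
    filter_upwards [i.dom_mem_nhds hi, j.dom_mem_nhds hj] with y h h'
    exact transGen_p i j k h h' μ
  | s α => exact SmoothGr.sum fun β _ => SmoothGr.smul_const (smoothNear_frame i j hi hj α β) _

theorem smoothGr_trans (k : ℤ) (hi : x ∈ i.dom) (hj : x ∈ j.dom) (a : GAlg n r k) :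
    SmoothGr (fun y => i.trans j k y a) x := by
  induction a using GAlg.induction with
  | one => simpa using SmoothGr.const 1
  | gen_mul g a ih =>
    simp only [map_mul, trans_gen]
    exact (smoothGr_transGen i j k hi hj g).mul ih
  | add a b ha hb => simpa only [map_add] using ha.add hb
  | smul t a ha => simpa only [map_smul] using ha.const_smul t

end LocalChart

end Transitions

/-! ### Coordinate vectors and covectors, and the components of `H` -/

section CoordinateVectors

variable {n : ℕ} {M : Type*} [TopologicalSpace M] [ChartedSpace (EuclideanSpace ℝ (Fin n)) M]
  [IsManifold (𝓡 n) ∞ M] {c c' : OpenPartialHomeomorph M (EuclideanSpace ℝ (Fin n))} {x : M}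

theorem mdifferentiableAt_chart (hc : c ∈ atlas (EuclideanSpace ℝ (Fin n)) M) (hx : x ∈ c.source) :
    MDifferentiableAt (𝓡 n) (𝓡 n) c x :=
  ((contMDiffOn_chart_of_mem hc).contMDiffAt (c.open_source.mem_nhds hx)).mdifferentiableAt
    (by simp)

theorem mdifferentiableAt_chart_symm (hc : c ∈ atlas (EuclideanSpace ℝ (Fin n)) M)
    {y : EuclideanSpace ℝ (Fin n)} (hy : y ∈ c.target) :
    MDifferentiableAt (𝓡 n) (𝓡 n) c.symm y :=
  ((contMDiffOn_chart_symm_of_mem hc).contMDiffAt (c.open_target.mem_nhds hy)).mdifferentiableAt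
    (by simp)

theorem coordCovec_coordVec (hc : c ∈ atlas (EuclideanSpace ℝ (Fin n)) M)
    (hc' : c' ∈ atlas (EuclideanSpace ℝ (Fin n)) M) (hx : x ∈ c.source) (hx' : x ∈ c'.source)
    (σ ρ : Fin n) :
    coordCovec c' σ x (coordVec c ρ x) = partialDeriv c ρ (fun y => c' y σ) x := by
  rw [← fderiv_transition_apply hc hc' hx hx', ← mfderiv_eq_fderiv]
  have h1 : MDifferentiableAt (𝓡 n) (𝓡 n) c' (c.symm (c x)) := by
    rw [c.left_inv hx]; exact mdifferentiableAt_chart hc' hx'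
  have h := mfderiv_comp (c x) h1 (mdifferentiableAt_chart_symm hc (c.map_source hx))
  have e : (fun y => c' (c.symm y)) = c' ∘ c.symm := rfl
  rw [e, h]
  simp only [coordCovec, coordVec, LinearMap.coe_mk, AddHom.coe_mk]
  -- The points `c.symm (c x)` and `x` are only propositionally equal, so the two derivatives are
  -- compared as maps of the model space.
  have h2 : (mfderiv (𝓡 n) (𝓡 n) c' (c.symm (c x)) :
      EuclideanSpace ℝ (Fin n) →L[ℝ] EuclideanSpace ℝ (Fin n)) = mfderiv (𝓡 n) (𝓡 n) c' x := by
    rw [c.left_inv hx]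
  exact (congrArg (fun L : EuclideanSpace ℝ (Fin n) →L[ℝ] EuclideanSpace ℝ (Fin n) =>
    L (mfderiv (𝓡 n) (𝓡 n) c.symm (c x) (EuclideanSpace.single ρ 1)) σ) h2).symm

/-- The expansion of a tangent vector in the coordinate vectors. -/
theorem sum_coordCovec_smul_coordVec (hc : c ∈ atlas (EuclideanSpace ℝ (Fin n)) M)
    (hx : x ∈ c.source) (v : TangentSpace (𝓡 n) x) :
    ∑ μ, coordCovec c μ x v • coordVec c μ x = v := by
  have h := mfderiv_comp x (mdifferentiableAt_chart_symm hc (c.map_source hx))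
    (mdifferentiableAt_chart hc hx)
  have e : c.symm ∘ c =ᶠ[𝓝 x] id := by
    filter_upwards [c.open_source.mem_nhds hx] with y hy
    simp [c.left_inv hy]
  rw [e.mfderiv_eq, mfderiv_id] at h
  have h' := congrArg (fun L : EuclideanSpace ℝ (Fin n) →L[ℝ] EuclideanSpace ℝ (Fin n) => L v) h
  let w : EuclideanSpace ℝ (Fin n) := mfderiv (𝓡 n) (𝓡 n) c x v
  let L : EuclideanSpace ℝ (Fin n) →L[ℝ] EuclideanSpace ℝ (Fin n) := mfderiv (𝓡 n) (𝓡 n) c.symm (c x)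
  have hL : L w = v := h'.symm
  have hs : w = ∑ σ, w σ • EuclideanSpace.single σ (1 : ℝ) := by
    ext τ; simp [Pi.single_apply]
  rw [hs, map_sum] at hL
  simp only [map_smul] at hL
  exact hL

theorem differential_coordVec (hc : c ∈ atlas (EuclideanSpace ℝ (Fin n)) M) (hx : x ∈ c.source)
    (f : C^∞⟮𝓡 n, M; ℝ⟯) (μ : Fin n) :
    differential f x (coordVec c μ x) = partialDeriv c μ f x := by
  rw [partialDeriv, ← mfderiv_eq_fderiv]
  have h1 : MDifferentiableAt (𝓡 n) 𝓘(ℝ, ℝ) f (c.symm (c x)) :=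
    f.contMDiff.contMDiffAt.mdifferentiableAt (by simp)
  have h := mfderiv_comp (c x) h1 (mdifferentiableAt_chart_symm hc (c.map_source hx))
  have e : (fun y => f (c.symm y)) = f ∘ c.symm := rfl
  rw [e, h]
  have h2 : (mfderiv (𝓡 n) 𝓘(ℝ, ℝ) f (c.symm (c x)) : EuclideanSpace ℝ (Fin n) →L[ℝ] ℝ) =
      mfderiv (𝓡 n) 𝓘(ℝ, ℝ) f x := by
    rw [c.left_inv hx]
  exact (congrArg (fun L : EuclideanSpace ℝ (Fin n) →L[ℝ] ℝ =>
    L (mfderiv (𝓡 n) (𝓡 n) c.symm (c x) (EuclideanSpace.single μ 1))) h2).symm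

theorem coordCovec_coordVec_self (hc : c ∈ atlas (EuclideanSpace ℝ (Fin n)) M)
    (hx : x ∈ c.source) (σ ρ : Fin n) :
    coordCovec c σ x (coordVec c ρ x) = if σ = ρ then 1 else 0 := by
  rw [coordCovec_coordVec hc hc hx hx, partialDeriv_coord hx]

/-- The expansion of a covector in the coordinate covectors. -/
theorem sum_apply_coordVec_smul_coordCovec (hc : c ∈ atlas (EuclideanSpace ℝ (Fin n)) M)
    (hx : x ∈ c.source) (ξ : CoTan n x) :
    ∑ μ, ξ (coordVec c μ x) • coordCovec c μ x = ξ := by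
  ext v
  conv_rhs => rw [← sum_coordCovec_smul_coordVec hc hx v, map_sum]
  simp [mul_comm]

section ThreeForm

variable (H : ClosedThreeForm n M)

theorem comp_chart_symm (c : OpenPartialHomeomorph M (EuclideanSpace ℝ (Fin n)))
    {y : EuclideanSpace ℝ (Fin n)} (hy : y ∈ c.target) (μ ν ρ : Fin n) :
    H.comp c μ ν ρ (c.symm y) = formInChart c H.toFun y
      ![EuclideanSpace.single μ 1, EuclideanSpace.single ν 1, EuclideanSpace.single ρ 1] := by
  have h : ∀ μ, coordVec c μ (c.symm y) =
      (mfderiv (𝓡 n) (𝓡 n) c.symm y (EuclideanSpace.single μ (1 : ℝ)) : EuclideanSpace ℝ (Fin n)) := by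
    intro μ
    have : (mfderiv (𝓡 n) (𝓡 n) c.symm (c (c.symm y)) :
      EuclideanSpace ℝ (Fin n) →L[ℝ] EuclideanSpace ℝ (Fin n)) = mfderiv (𝓡 n) (𝓡 n) c.symm y := by
      rw [c.right_inv hy]
    exact congrArg (fun L : EuclideanSpace ℝ (Fin n) →L[ℝ] EuclideanSpace ℝ (Fin n) =>
      L (EuclideanSpace.single μ 1)) this
  rw [ClosedThreeForm.comp, h, h, h]
  refine congrArg (H.toFun (c.symm y)) (funext fun m => ?_)
  fin_cases m <;> rfl

variable (hc : c ∈ atlas (EuclideanSpace ℝ (Fin n)) M) (hx : x ∈ c.source)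
include hc hx

theorem smoothNear_comp (μ ν ρ : Fin n) : SmoothNear n (H.comp c μ ν ρ) x := by
  refine SmoothNear.congr (SmoothNear.of_contDiffAt (G := fun y => formInChart c H.toFun y
      ![EuclideanSpace.single μ 1, EuclideanSpace.single ν 1, EuclideanSpace.single ρ 1])
      hc hx ?_) ?_
  · filter_upwards [c.open_target.mem_nhds (c.map_source hx)] with y hy
    have h := (H.smooth c hc).contDiffAt (c.open_target.mem_nhds hy)
    exact ((ContinuousAlternatingMap.apply ℝ (EuclideanSpace ℝ (Fin n)) ℝ
      ![EuclideanSpace.single μ 1, EuclideanSpace.single ν 1,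
        EuclideanSpace.single ρ 1]).contDiff.contDiffAt).comp y h
  · filter_upwards [c.open_source.mem_nhds hx] with y hy
    rw [← comp_chart_symm H c (c.map_source hy), c.left_inv hy]

theorem partialDeriv_comp (κ μ ν ρ : Fin n) :
    partialDeriv c κ (H.comp c μ ν ρ) x = fderiv ℝ (fun y => formInChart c H.toFun y
      ![EuclideanSpace.single μ 1, EuclideanSpace.single ν 1, EuclideanSpace.single ρ 1]) (c x)
      (EuclideanSpace.single κ 1) := by
  have e : (fun y => H.comp c μ ν ρ (c.symm y)) =ᶠ[𝓝 (c x)] fun y => formInChart c H.toFun y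
      ![EuclideanSpace.single μ 1, EuclideanSpace.single ν 1, EuclideanSpace.single ρ 1] := by
    filter_upwards [c.open_target.mem_nhds (c.map_source hx)] with y hy
    exact comp_chart_symm H c hy μ ν ρ
  rw [partialDeriv, e.fderiv_eq]

/-- The exterior derivative on four coordinate vectors is an alternating sum of four partial
derivatives. It is solved here for the first of them, the form that `sum_closed_psi` consumes. -/
theorem closed_comp (κ μ ν ρ : Fin n) :
    partialDeriv c κ (H.comp c μ ν ρ) x = partialDeriv c μ (H.comp c κ ν ρ) x -
      partialDeriv c ν (H.comp c κ μ ρ) x + partialDeriv c ρ (H.comp c κ μ ν) x := by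
  have h := ((H.smooth c hc).contDiffAt (c.open_target.mem_nhds (c.map_source hx))).differentiableAt
    (by simp)
  have h0 : extDeriv (formInChart c H.toFun) (c x) ![EuclideanSpace.single κ 1,
      EuclideanSpace.single μ 1, EuclideanSpace.single ν 1, EuclideanSpace.single ρ 1] = 0 := by
    rw [H.closed c hc (c x) (c.map_source hx)]; rfl
  rw [extDeriv_apply h] at h0
  erw [Fin.sum_univ_four] at h0
  have r0 : ∀ a b c d : EuclideanSpace ℝ (Fin n), Fin.removeNth 0 ![a, b, c, d] = ![b, c, d] := by
    intro a b c d; ext m : 1; fin_cases m <;> rfl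
  have r1 : ∀ a b c d : EuclideanSpace ℝ (Fin n), Fin.removeNth 1 ![a, b, c, d] = ![a, c, d] := by
    intro a b c d; ext m : 1; fin_cases m <;> rfl
  have r2 : ∀ a b c d : EuclideanSpace ℝ (Fin n), Fin.removeNth 2 ![a, b, c, d] = ![a, b, d] := by
    intro a b c d; ext m : 1; fin_cases m <;> rfl
  have r3 : ∀ a b c d : EuclideanSpace ℝ (Fin n), Fin.removeNth 3 ![a, b, c, d] = ![a, b, c] := by
    intro a b c d; ext m : 1; fin_cases m <;> rfl
  simp only [r0, r1, r2, r3, Matrix.cons_val] at h0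
  simp only [partialDeriv_comp H hc hx]
  norm_num at h0
  linarith

end ThreeForm

end CoordinateVectors

/-! ### Change of chart for coordinate vectors, covectors and `H` -/

section Pi

variable {n r : ℕ} {M : Type*} [TopologicalSpace M] [ChartedSpace (EuclideanSpace ℝ (Fin n)) M]
  {E : M → Type*} [TopologicalSpace (TotalSpace (EuclideanSpace ℝ (Fin r)) E)]
  [∀ x, AddCommGroup (E x)] [∀ x, Module ℝ (E x)] [∀ x, TopologicalSpace (E x)]
  [FiberBundle (EuclideanSpace ℝ (Fin r)) E] [IsManifold (𝓡 n) ∞ M] (i j : LocalChart n r E) {x : M}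
  (hi : x ∈ i.dom) (hj : x ∈ j.dom)
include hi hj

theorem coordCovec_coordVec_jac (σ ρ : Fin n) :
    coordCovec j.chart σ x (coordVec i.chart ρ x) = i.jac j x σ ρ := by
  rw [coordCovec_coordVec i.chart_mem j.chart_mem hi.1 hj.1, LocalChart.jac_eq i j hi hj]

theorem coordVec_eq_sum (ρ : Fin n) :
    coordVec i.chart ρ x = ∑ σ, i.jac j x σ ρ • coordVec j.chart σ x := by
  conv_lhs => rw [← sum_coordCovec_smul_coordVec j.chart_mem hj.1 (coordVec i.chart ρ x)]
  simp only [coordCovec_coordVec_jac i j hi hj]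

theorem coordCovec_eq_sum (σ : Fin n) :
    coordCovec j.chart σ x = ∑ ρ, i.jac j x σ ρ • coordCovec i.chart ρ x := by
  conv_lhs => rw [← sum_apply_coordVec_smul_coordCovec i.chart_mem hi.1 (coordCovec j.chart σ x)]
  simp only [coordCovec_coordVec_jac i j hi hj]

theorem comp_eq_sum (H : ClosedThreeForm n M) (μ ν ρ : Fin n) :
    H.comp i.chart μ ν ρ x = ∑ a, ∑ b, ∑ c, (i.jac j x a μ * i.jac j x b ν * i.jac j x c ρ) *
      H.comp j.chart a b c x := by
  have h : ∀ (f : TangentSpace (𝓡 n) x [⋀^Fin 3]→L[ℝ] ℝ) (A : Fin n → Fin n → ℝ)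
      (e : Fin n → TangentSpace (𝓡 n) x),
      f ![∑ a, A a μ • e a, ∑ a, A a ν • e a, ∑ a, A a ρ • e a] =
        ∑ a, ∑ b, ∑ c, (A a μ * A b ν * A c ρ) * f ![e a, e b, e c] := by
    intro f A e
    -- Freezing two of the three slots gives a linear map, by additivity and homogeneity under
    -- updating the remaining slot; the other two slots are treated the same way.
    have s0 : ∀ (a : Fin n → ℝ) u v, f ![∑ m, a m • e m, u, v] = ∑ m, a m * f ![e m, u, v] := by
      intro a u v
      have hu : ∀ w, ![w, u, v] = Function.update ![0, u, v] 0 w := by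
        intro w; funext m; fin_cases m <;> rfl
      let L : TangentSpace (𝓡 n) x →ₗ[ℝ] ℝ :=
        { toFun := fun w => f ![w, u, v]
          map_add' := fun w w' => by
            rw [hu (_ + _), hu w, hu w']; exact f.map_update_add _ _ _ _
          map_smul' := fun t w => by
            rw [hu (_ • _), hu w]; exact f.map_update_smul _ _ _ _ }
      have : L (∑ m, a m • e m) = ∑ m, a m * L (e m) := by simp
      exact this
    have s1 : ∀ (a : Fin n → ℝ) u v, f ![u, ∑ m, a m • e m, v] = ∑ m, a m * f ![u, e m, v] := by
      intro a u v
      have hu : ∀ w, ![u, w, v] = Function.update ![u, 0, v] 1 w := by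
        intro w; funext m; fin_cases m <;> rfl
      let L : TangentSpace (𝓡 n) x →ₗ[ℝ] ℝ :=
        { toFun := fun w => f ![u, w, v]
          map_add' := fun w w' => by
            rw [hu (_ + _), hu w, hu w']; exact f.map_update_add _ _ _ _
          map_smul' := fun t w => by
            rw [hu (_ • _), hu w]; exact f.map_update_smul _ _ _ _ }
      have : L (∑ m, a m • e m) = ∑ m, a m * L (e m) := by simp
      exact this
    have s2 : ∀ (a : Fin n → ℝ) u v, f ![u, v, ∑ m, a m • e m] = ∑ m, a m * f ![u, v, e m] := by
      intro a u v
      have hu : ∀ w, ![u, v, w] = Function.update ![u, v, 0] 2 w := by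
        intro w; funext m; fin_cases m <;> rfl
      let L : TangentSpace (𝓡 n) x →ₗ[ℝ] ℝ :=
        { toFun := fun w => f ![u, v, w]
          map_add' := fun w w' => by
            rw [hu (_ + _), hu w, hu w']; exact f.map_update_add _ _ _ _
          map_smul' := fun t w => by
            rw [hu (_ • _), hu w]; exact f.map_update_smul _ _ _ _ }
      have : L (∑ m, a m • e m) = ∑ m, a m * L (e m) := by simp
      exact this
    simp only [s0, s1, s2, Finset.mul_sum, mul_assoc]
  simp only [ClosedThreeForm.comp, coordVec_eq_sum i j hi hj, h]

end Pi

/-! ### Tensors recovered from their contractions -/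

section Contractions

variable {V W : Type*} [AddCommGroup V] [Module ℝ V] [AddCommGroup W] [Module ℝ W]

theorem contract_tmul (φ : V →ₗ[ℝ] ℝ) (v : V) (w : W) : contract φ (v ⊗ₜ[ℝ] w) = φ v • w := by
  simp [contract]

theorem contract_add_left (φ φ' : V →ₗ[ℝ] ℝ) (t : V ⊗[ℝ] W) :
    contract (φ + φ') t = contract φ t + contract φ' t := by
  simp [contract, LinearMap.rTensor_add]

theorem contract_smul_left (a : ℝ) (φ : V →ₗ[ℝ] ℝ) (t : V ⊗[ℝ] W) :
    contract (a • φ) t = a • contract φ t := by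
  simp [contract, LinearMap.rTensor_smul]

theorem contract_sum_left {ι : Type*} (s : Finset ι) (a : ι → ℝ) (φ : ι → V →ₗ[ℝ] ℝ)
    (t : V ⊗[ℝ] W) : contract (∑ m ∈ s, a m • φ m) t = ∑ m ∈ s, a m • contract (φ m) t := by
  classical
  induction s using Finset.induction_on with
  | empty => simp [contract]
  | insert a s ha ih =>
    rw [Finset.sum_insert ha, Finset.sum_insert ha, contract_add_left, contract_smul_left, ih]

theorem contract_map {V' W' : Type*} [AddCommGroup V'] [Module ℝ V'] [AddCommGroup W']
    [Module ℝ W'] (f : V →ₗ[ℝ] V') (g : W →ₗ[ℝ] W') (φ : V' →ₗ[ℝ] ℝ) (t : V ⊗[ℝ] W) :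
    contract φ (TensorProduct.map f g t) = g (contract (φ ∘ₗ f) t) := by
  induction t with
  | zero => simp
  | tmul v w => simp [contract_tmul]
  | add a b ha hb => simp only [map_add, ha, hb]

/-- Only a resolution of the identity of `V` is used, no linear independence. It reduces equality of
tensors in `𝕋M ⊗ E`, `T*M ⊗ E` and `TM ⊗ End E` to equality of contractions. -/
theorem sum_tmul_contract {ι : Type*} [Fintype ι] {e : ι → V} {φ : ι → V →ₗ[ℝ] ℝ}
    (h : ∀ v, ∑ m, φ m v • e m = v) (t : V ⊗[ℝ] W) : ∑ m, e m ⊗ₜ[ℝ] contract (φ m) t = t := by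
  induction t with
  | zero => simp
  | tmul v w =>
    simp only [contract_tmul, ← TensorProduct.smul_tmul, ← TensorProduct.sum_tmul, h]
  | add a b ha hb => simp only [map_add, TensorProduct.tmul_add, Finset.sum_add_distrib, ha, hb]

theorem ext_of_contract {ι : Type*} [Fintype ι] {e : ι → V} {φ : ι → V →ₗ[ℝ] ℝ}
    (h : ∀ v, ∑ m, φ m v • e m = v) {t t' : V ⊗[ℝ] W}
    (ht : ∀ m, contract (φ m) t = contract (φ m) t') : t = t' := by
  rw [← sum_tmul_contract h t, ← sum_tmul_contract h t']
  simp only [ht]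

end Contractions

/-! ### Components of tensors and their change under coordinates -/

section TensorComponents

variable {n r : ℕ} {M : Type*} [TopologicalSpace M] [ChartedSpace (EuclideanSpace ℝ (Fin n)) M]
  {E : M → Type*} [TopologicalSpace (TotalSpace (EuclideanSpace ℝ (Fin r)) E)]
  [∀ x, AddCommGroup (E x)] [∀ x, Module ℝ (E x)] [∀ x, TopologicalSpace (E x)]
  [FiberBundle (EuclideanSpace ℝ (Fin r)) E]
  (i j : LocalChart n r E) {x : M}

theorem pairing_apply (a b : GTan n x) : pairing x a b = b.2 a.1 + a.2 b.1 := rfl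

theorem tensorToFun_eq_linPoly (k : ℤ) (t : GTan n x ⊗[ℝ] E x) :
    tensorToFun i k t =
      linPoly k (fun μ α => compForm i μ α t) (fun μ α => compVec i μ α t) := rfl

variable [IsManifold (𝓡 n) ∞ M] [VectorBundle ℝ (EuclideanSpace ℝ (Fin r)) E]

/-- The pairing crosses the summands: pairing with `dx^μ` reads off the coefficient of `∂_μ`, and
pairing with `∂_μ` that of `dx^μ`. -/
theorem sum_gtan {c : OpenPartialHomeomorph M (EuclideanSpace ℝ (Fin n))}
    (hc : c ∈ atlas (EuclideanSpace ℝ (Fin n)) M) (hx : x ∈ c.source) (v : GTan n x) :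
    ∑ m : Fin n ⊕ Fin n, (Sum.elim (fun μ => pairing x (0, coordCovec c μ x))
      (fun μ => pairing x (coordVec c μ x, 0)) m : GTan n x →ₗ[ℝ] ℝ) v •
        (Sum.elim (fun μ => ((coordVec c μ x, 0) : GTan n x))
          (fun μ => ((0, coordCovec c μ x) : GTan n x)) m) = v := by
  have h1 := sum_coordCovec_smul_coordVec hc hx v.1
  have h2 := sum_apply_coordVec_smul_coordCovec hc hx v.2
  rw [Fintype.sum_sum_type]
  simp only [Sum.elim_inl, Sum.elim_inr, pairing_apply, map_zero, zero_add, LinearMap.zero_apply,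
    add_zero, Prod.smul_mk, smul_zero]
  refine Prod.ext ?_ ?_
  · simp only [Prod.fst_add, Prod.fst_sum, Finset.sum_const_zero, add_zero, h1]
  · simp only [Prod.snd_add, Prod.snd_sum, Finset.sum_const_zero, zero_add, h2]

variable (hi : x ∈ i.dom)
include hi

theorem gtan_ext {t t' : GTan n x ⊗[ℝ] E x} (h1 : ∀ μ α, compForm i μ α t = compForm i μ α t')
    (h2 : ∀ μ α, compVec i μ α t = compVec i μ α t') : t = t' := by
  refine ext_of_contract (sum_gtan i.chart_mem hi.1) ?_
  rintro (μ | μ)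
  · exact i.coeff_ext hi fun α => h2 μ α
  · exact i.coeff_ext hi fun α => h1 μ α

theorem exists_gtan (A B : Fin n → Fin r → ℝ) : ∃ t : GTan n x ⊗[ℝ] E x,
    (∀ μ α, compForm i μ α t = A μ α) ∧ ∀ μ α, compVec i μ α t = B μ α := by
  have hd := coordCovec_coordVec_self i.chart_mem hi.1
  refine ⟨∑ μ, (((0, coordCovec i.chart μ x) : GTan n x) ⊗ₜ[ℝ] (∑ α, A μ α • i.frame α x) +
    ((coordVec i.chart μ x, 0) : GTan n x) ⊗ₜ[ℝ] (∑ α, B μ α • i.frame α x)),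
    fun μ α => ?_, fun μ α => ?_⟩
  · simp [compForm, contract_tmul, pairing_apply, hd, i.coeff_sum hi, i.coeff_smul hi,
      i.coeff_frame hi]
  · simp [compVec, contract_tmul, pairing_apply, hd, i.coeff_sum hi, i.coeff_smul hi,
      i.coeff_frame hi]

theorem coTan_ext {t t' : CoTan n x ⊗[ℝ] E x}
    (h : ∀ μ α, compCoTan i μ α t = compCoTan i μ α t') : t = t' :=
  ext_of_contract (φ := fun μ => Module.Dual.eval ℝ _ (coordVec i.chart μ x))
    (sum_apply_coordVec_smul_coordCovec i.chart_mem hi.1)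
    fun μ => i.coeff_ext hi fun α => h μ α

theorem contract_end_apply (μ : Fin n) (α : Fin r)
    (V : TangentSpace (𝓡 n) x ⊗[ℝ] Module.End ℝ (E x)) (u : E x) :
    i.coeff α (contract (coordCovec i.chart μ x) V u) =
      ∑ β, compEnd i μ α β V * i.coeff β u := by
  conv_lhs => rw [← i.sum_coeff_frame hi u]
  simp only [map_sum, map_smul, i.coeff_sum hi, i.coeff_smul hi]
  exact Finset.sum_congr rfl fun β _ => mul_comm _ _

theorem end_ext {V V' : TangentSpace (𝓡 n) x ⊗[ℝ] Module.End ℝ (E x)}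
    (h : ∀ μ α β, compEnd i μ α β V = compEnd i μ α β V') : V = V' := by
  refine ext_of_contract (sum_coordCovec_smul_coordVec i.chart_mem hi.1) fun μ => ?_
  ext u
  refine i.coeff_ext hi fun α => ?_
  simp only [contract_end_apply i hi, h]

theorem exists_end (A : Fin n → Fin r → Fin r → ℝ) :
    ∃ V : TangentSpace (𝓡 n) x ⊗[ℝ] Module.End ℝ (E x), ∀ μ α β, compEnd i μ α β V = A μ α β := by
  have hd := coordCovec_coordVec_self i.chart_mem hi.1
  refine ⟨∑ μ, (coordVec i.chart μ x) ⊗ₜ[ℝ]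
    (∑ α, ∑ β, A μ α β • (i.coeffₗ hi β).smulRight (i.frame α x)), fun μ α β => ?_⟩
  simp [compEnd, contract_tmul, hd, i.coeff_sum hi, i.coeff_smul hi,
      i.coeff_frame hi, LocalChart.coeffₗ_apply]

theorem compForm_add (μ : Fin n) (α : Fin r) (t t' : GTan n x ⊗[ℝ] E x) :
    compForm i μ α (t + t') = compForm i μ α t + compForm i μ α t' := by
  simp [compForm, i.coeff_add hi]

theorem compVec_add (μ : Fin n) (α : Fin r) (t t' : GTan n x ⊗[ℝ] E x) :
    compVec i μ α (t + t') = compVec i μ α t + compVec i μ α t' := by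
  simp [compVec, i.coeff_add hi]

theorem compForm_smul (μ : Fin n) (α : Fin r) (a : ℝ) (t : GTan n x ⊗[ℝ] E x) :
    compForm i μ α (a • t) = a * compForm i μ α t := by
  simp [compForm, i.coeff_smul hi]

theorem compVec_smul (μ : Fin n) (α : Fin r) (a : ℝ) (t : GTan n x ⊗[ℝ] E x) :
    compVec i μ α (a • t) = a * compVec i μ α t := by
  simp [compVec, i.coeff_smul hi]

variable (hj : x ∈ j.dom)
include hj

/-- Contraction with `∂_μ` transforms by the Jacobian, which is what the coefficient of `ψ^μ` must
do for `trans_tensorToFun`; `compVec_change` is the counterpart for `b_μ`. -/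
theorem compForm_change (μ : Fin n) (α : Fin r) (t : GTan n x ⊗[ℝ] E x) :
    compForm i μ α t =
      ∑ σ, i.jac j x σ μ * ∑ β, compForm j σ β t * i.coeff α (j.frame β x) := by
  have h : pairing x (coordVec i.chart μ x, 0) =
      ∑ σ, i.jac j x σ μ • pairing x (coordVec j.chart σ x, 0) := by
    ext v
    · simp [pairing_apply]
    · simp [pairing_apply, coordVec_eq_sum i j hi hj]
  rw [compForm, h, contract_sum_left, i.coeff_sum hi]
  refine Finset.sum_congr rfl fun σ _ => ?_
  rw [i.coeff_smul hi, coeff_eq_sum i j hi hj]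
  rfl

theorem compVec_change (μ : Fin n) (α : Fin r) (t : GTan n x ⊗[ℝ] E x) :
    compVec i μ α t =
      ∑ σ, j.jac i x μ σ * ∑ β, compVec j σ β t * i.coeff α (j.frame β x) := by
  have h : pairing x (0, coordCovec i.chart μ x) =
      ∑ σ, j.jac i x μ σ • pairing x (0, coordCovec j.chart σ x) := by
    ext v
    · simp [pairing_apply, coordCovec_eq_sum j i hj hi]
    · simp [pairing_apply]
  rw [compVec, h, contract_sum_left, i.coeff_sum hi]
  refine Finset.sum_congr rfl fun σ _ => ?_
  rw [i.coeff_smul hi, coeff_eq_sum i j hi hj]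
  rfl

/-- The identification of tensors with functions is independent of the coordinates. -/
theorem trans_tensorToFun (k : ℤ) (t : GTan n x ⊗[ℝ] E x) :
    i.trans j k x (tensorToFun j k t) = tensorToFun i k t := by
  have hψ : ∀ ν, i.transGen j k x (.psi ν) = ∑ m, i.jac j x ν m • gen k (.psi m) := fun _ => rfl
  have hb : ∀ ν, i.transGen j k x (.b ν) = ∑ m, j.jac i x m ν • gen k (.b m) := fun _ => rfl
  have hs : ∀ α, i.transGen j k x (.s α) = ∑ β, i.coeff β (j.frame α x) • gen k (.s β) :=
    fun _ => rfl
  -- One rearrangement of sums serves both halves, with `J` the Jacobian for `ψ` and its transposed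
  -- inverse for `b`.
  have key : ∀ (A : Fin n → Fin r → ℝ) (J : Fin n → Fin n → ℝ) (e : Fin r → Fin r → ℝ)
      (g : Fin n → GAlg n r k) (s : Fin r → GAlg n r k),
      ∑ σ, ∑ β, A σ β • ((∑ m, J σ m • g m) * ∑ α, e β α • s α) =
        ∑ m, ∑ α, (∑ σ, J σ m * ∑ β, A σ β * e β α) • (g m * s α) := by
    intro A J e g s
    simp only [Finset.sum_mul_sum, Finset.smul_sum, smul_mul_smul_comm, smul_smul]
    simp only [Finset.mul_sum, Finset.sum_smul]
    have : ∀ f : Fin n → Fin r → Fin n → Fin r → GAlg n r k,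
        ∑ σ, ∑ β, ∑ m, ∑ α, f σ β m α = ∑ m, ∑ α, ∑ σ, ∑ β, f σ β m α := by
      intro f
      calc _ = ∑ σ, ∑ m, ∑ β, ∑ α, f σ β m α :=
            Finset.sum_congr rfl fun _ _ => Finset.sum_comm
        _ = ∑ m, ∑ σ, ∑ β, ∑ α, f σ β m α := Finset.sum_comm
        _ = ∑ m, ∑ σ, ∑ α, ∑ β, f σ β m α := Finset.sum_congr rfl fun _ _ =>
            Finset.sum_congr rfl fun _ _ => Finset.sum_comm
        _ = _ := Finset.sum_congr rfl fun _ _ => Finset.sum_comm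
    rw [this]
    refine Finset.sum_congr rfl fun m _ => Finset.sum_congr rfl fun α _ =>
      Finset.sum_congr rfl fun σ _ => Finset.sum_congr rfl fun β _ => ?_
    congr 1
    ring
  simp only [tensorToFun, map_sum, map_add, map_smul, map_mul, LocalChart.trans_gen, hψ, hb, hs,
    Finset.sum_add_distrib, key, compForm_change i j hi hj, compVec_change i j hi hj]

end TensorComponents

/-! ### Bump functions and cut off functions -/

section Bumps

variable {n : ℕ} {M : Type*} [TopologicalSpace M] [ChartedSpace (EuclideanSpace ℝ (Fin n)) M]
  [IsManifold (𝓡 n) ∞ M]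

theorem SmoothNear.of_contMDiff (f : C^∞⟮𝓡 n, M; ℝ⟯) (x : M) : SmoothNear n f x :=
  Filter.Eventually.of_forall fun _ => f.contMDiff.contMDiffAt

theorem contMDiffOn_of_smoothNear {g : M → ℝ} {U : Set M} (h : ∀ x ∈ U, SmoothNear n g x) :
    ContMDiffOn (𝓡 n) 𝓘(ℝ, ℝ) ∞ g U :=
  fun x hx => (h x hx).contMDiffAt.contMDiffWithinAt

theorem partialDeriv_eventually_const {c : OpenPartialHomeomorph M (EuclideanSpace ℝ (Fin n))}
    {x : M} (hx : x ∈ c.source) {g : M → ℝ} {t : ℝ} (h : ∀ᶠ y in 𝓝 x, g y = t) (μ : Fin n) :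
    partialDeriv c μ g x = 0 := by
  rw [partialDeriv_congr hx (h : g =ᶠ[𝓝 x] fun _ => t), partialDeriv_const]

/-- All the locality arguments rest on these functions; the Hausdorff property is what makes a bump
supported in a chart smooth on all of `M`. -/
theorem exists_bump [T2Space M] {x : M} {U : Set M} (hU : U ∈ 𝓝 x) :
    ∃ χ : C^∞⟮𝓡 n, M; ℝ⟯, (∀ᶠ y in 𝓝 x, χ y = 1) ∧ tsupport χ ⊆ U := by
  obtain ⟨f, -, hf⟩ := (SmoothBumpFunction.nhds_basis_tsupport (I := 𝓡 n) x).mem_iff.1 hU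
  exact ⟨⟨f, f.contMDiff⟩, f.eventuallyEq_one, hf⟩

/-- The extension by zero of a locally defined function, cut off by `χ`. -/
def cutoff (χ : C^∞⟮𝓡 n, M; ℝ⟯) (g : M → ℝ) (h : ∀ x ∈ tsupport χ, SmoothNear n g x) :
    C^∞⟮𝓡 n, M; ℝ⟯ :=
  ⟨fun y => χ y * g y, fun x => by
    by_cases hx : x ∈ tsupport χ
    · exact χ.contMDiff.contMDiffAt.mul (h x hx).contMDiffAt
    · have : (fun y => χ y * g y) =ᶠ[𝓝 x] fun _ => 0 := by
        filter_upwards [(isClosed_tsupport χ).isOpen_compl.mem_nhds hx] with y hy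
        rw [image_eq_zero_of_notMem_tsupport hy, zero_mul]
      exact contMDiffAt_const.congr_of_eventuallyEq this⟩

theorem cutoff_apply (χ : C^∞⟮𝓡 n, M; ℝ⟯) (g : M → ℝ) (h : ∀ x ∈ tsupport χ, SmoothNear n g x)
    (y : M) : cutoff χ g h y = χ y * g y := rfl

end Bumps

/-! ### Cut off frames, and operators on sections with a Leibniz rule -/

section Sections

variable {n r : ℕ} {M : Type*} [TopologicalSpace M] [ChartedSpace (EuclideanSpace ℝ (Fin n)) M]
  [IsManifold (𝓡 n) ∞ M]
  {E : M → Type*} [TopologicalSpace (TotalSpace (EuclideanSpace ℝ (Fin r)) E)]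
  [∀ x, AddCommGroup (E x)] [∀ x, Module ℝ (E x)] [∀ x, TopologicalSpace (E x)]
  [FiberBundle (EuclideanSpace ℝ (Fin r)) E] [VectorBundle ℝ (EuclideanSpace ℝ (Fin r)) E]
  [ContMDiffVectorBundle ∞ (EuclideanSpace ℝ (Fin r)) E (𝓡 n)]

theorem LocalChart.smoothNear_section (i : LocalChart n r E)
    (σ : Cₛ^∞⟮𝓡 n; EuclideanSpace ℝ (Fin r), E⟯) {x : M} (hx : x ∈ i.dom) (α : Fin r) :
    SmoothNear n (fun y => i.coeff α (σ y)) x :=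
  i.smoothNear_coeff hx Filter.univ_mem σ.contMDiff.contMDiffOn α

/-- The section `χ e_α`. -/
def frameSection (i : LocalChart n r E) (χ : C^∞⟮𝓡 n, M; ℝ⟯) (hχ : tsupport χ ⊆ i.dom)
    (α : Fin r) : Cₛ^∞⟮𝓡 n; EuclideanSpace ℝ (Fin r), E⟯ :=
  ⟨fun x => χ x • i.frame α x,
    ContMDiffOn.smul_section_of_tsupport χ.contMDiff.contMDiffOn i.isOpen_dom hχ
      (i.contMDiffOn_frame α)⟩

theorem frameSection_apply (i : LocalChart n r E) (χ : C^∞⟮𝓡 n, M; ℝ⟯) (hχ : tsupport χ ⊆ i.dom)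
    (α : Fin r) (x : M) : frameSection i χ hχ α x = χ x • i.frame α x := rfl

theorem coeff_frameSection (i : LocalChart n r E) (χ : C^∞⟮𝓡 n, M; ℝ⟯) (hχ : tsupport χ ⊆ i.dom)
    (α β : Fin r) {x : M} (hx : x ∈ i.dom) :
    i.coeff β (frameSection i χ hχ α x) = if β = α then χ x else 0 := by
  rw [frameSection_apply, i.coeff_smul hx, i.coeff_frame hx]
  simp

/-- The components of a section, cut off. -/
def cutCoeff (i : LocalChart n r E) (χ : C^∞⟮𝓡 n, M; ℝ⟯) (hχ : tsupport χ ⊆ i.dom)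
    (σ : Cₛ^∞⟮𝓡 n; EuclideanSpace ℝ (Fin r), E⟯) (α : Fin r) : C^∞⟮𝓡 n, M; ℝ⟯ :=
  cutoff χ (fun y => i.coeff α (σ y)) fun _ hx => i.smoothNear_section σ (hχ hx) α

theorem smulSection_apply (f : C^∞⟮𝓡 n, M; ℝ⟯) (σ : Cₛ^∞⟮𝓡 n; EuclideanSpace ℝ (Fin r), E⟯)
    (x : M) : smulSection f σ x = f x • σ x := rfl

/-- One factor `χ` makes the components `χ σ^α` global functions, the other makes the frame vectors
`χ e_α` global sections. Off the support of `χ` both sides vanish. -/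
theorem smulSection_cutoff (i : LocalChart n r E) (χ : C^∞⟮𝓡 n, M; ℝ⟯) (hχ : tsupport χ ⊆ i.dom)
    (σ : Cₛ^∞⟮𝓡 n; EuclideanSpace ℝ (Fin r), E⟯) :
    smulSection χ (smulSection χ σ) =
      ∑ α, smulSection (cutCoeff i χ hχ σ α) (frameSection i χ hχ α) := by
  ext x
  have hs : ∀ s : Finset (Fin r), (∑ α ∈ s, smulSection (cutCoeff i χ hχ σ α)
      (frameSection i χ hχ α)) x =
        ∑ α ∈ s, smulSection (cutCoeff i χ hχ σ α) (frameSection i χ hχ α) x := by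
    intro s
    exact map_sum (ContMDiffSection.coeAddHom (𝓡 n) (EuclideanSpace ℝ (Fin r)) ∞ E) _ s |>
      fun h => (congrFun h x).trans (Finset.sum_apply _ _ _)
  rw [hs]
  simp only [smulSection_apply, frameSection_apply, cutCoeff, cutoff_apply]
  by_cases hx : x ∈ tsupport χ
  · conv_lhs => rw [← i.sum_coeff_frame (hχ hx) (σ x)]
    simp only [Finset.smul_sum, smul_smul]
    exact Finset.sum_congr rfl fun α _ => by congr 1; ring
  · simp [image_eq_zero_of_notMem_tsupport hx]

/-- An operator on sections at a point satisfying a Leibniz rule is determined by its values on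
the frame. -/
theorem apply_eq_of_leibniz (i : LocalChart n r E) {x : M}
    (A : Cₛ^∞⟮𝓡 n; EuclideanSpace ℝ (Fin r), E⟯ →ₗ[ℝ] ℝ) (δ : (M → ℝ) → ℝ) (w : E x →ₗ[ℝ] ℝ)
    (hδ : ∀ (f : M → ℝ), (∀ᶠ y in 𝓝 x, f y = 1) → δ f = 0)
    (hδ' : ∀ f g : M → ℝ, f =ᶠ[𝓝 x] g → δ f = δ g)
    (hA : ∀ f σ, A (smulSection f σ) = f x * A σ + δ f * w (σ x))
    (χ : C^∞⟮𝓡 n, M; ℝ⟯) (hχ : tsupport χ ⊆ i.dom) (h1 : ∀ᶠ y in 𝓝 x, χ y = 1)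
    (σ : Cₛ^∞⟮𝓡 n; EuclideanSpace ℝ (Fin r), E⟯) :
    A σ = ∑ β, (i.coeff β (σ x) * A (frameSection i χ hχ β) +
      δ (fun y => i.coeff β (σ y)) * w (i.frame β x)) := by
  have h := congrArg A (smulSection_cutoff i χ hχ σ)
  -- Since `χ = 1` near `x`, both factors `χ` drop out of the left side, leaving `A σ`.
  rw [hA, hA, hδ χ h1, map_sum, h1.self_of_nhds] at h
  simp only [hA, cutCoeff, cutoff_apply, frameSection_apply, h1.self_of_nhds, one_mul, zero_mul,
    add_zero, one_smul] at h
  rw [h]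
  refine Finset.sum_congr rfl fun β _ => ?_
  congr 2
  refine hδ' _ _ ?_
  filter_upwards [h1] with y hy
  rw [cutoff_apply, hy, one_mul]

end Sections

/-! ### Generalized connections as sums `∇ + V` -/

section ConnectionBijection

variable {n r : ℕ} {M : Type*} [TopologicalSpace M] [T2Space M]
  [ChartedSpace (EuclideanSpace ℝ (Fin n)) M] [IsManifold (𝓡 n) ∞ M]
  {E : M → Type*} [TopologicalSpace (TotalSpace (EuclideanSpace ℝ (Fin r)) E)]
  [∀ x, AddCommGroup (E x)] [∀ x, Module ℝ (E x)] [∀ x, TopologicalSpace (E x)]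
  [FiberBundle (EuclideanSpace ℝ (Fin r)) E] [VectorBundle ℝ (EuclideanSpace ℝ (Fin r)) E]
  [ContMDiffVectorBundle ∞ (EuclideanSpace ℝ (Fin r)) E (𝓡 n)]

/-- This is `apply_eq_of_leibniz` with `δ = ∂_μ`: the connection coefficients are the components of
`∇ (χ e_β)`, for any bump `χ` equal to `1` near the point. -/
theorem compCoTan_leibniz (N : Connection n r M E) (i : LocalChart n r E) {x : M} (hx : x ∈ i.dom)
    (μ : Fin n) (α : Fin r) (χ : C^∞⟮𝓡 n, M; ℝ⟯) (hχ : tsupport χ ⊆ i.dom)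
    (h1 : ∀ᶠ y in 𝓝 x, χ y = 1) (σ : Cₛ^∞⟮𝓡 n; EuclideanSpace ℝ (Fin r), E⟯) :
    compCoTan i μ α (N.toFun σ x) = partialDeriv i.chart μ (fun y => i.coeff α (σ y)) x +
      ∑ β, compCoTan i μ α (N.toFun (frameSection i χ hχ β) x) * i.coeff β (σ x) := by
  let A : Cₛ^∞⟮𝓡 n; EuclideanSpace ℝ (Fin r), E⟯ →ₗ[ℝ] ℝ :=
    (i.coeffₗ hx α) ∘ₗ (contract (Module.Dual.eval ℝ _ (coordVec i.chart μ x))) ∘ₗ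
      (LinearMap.proj x) ∘ₗ N.toFun
  have hA : ∀ σ, A σ = compCoTan i μ α (N.toFun σ x) := fun _ => rfl
  have h := apply_eq_of_leibniz i A (fun f => partialDeriv i.chart μ f x) (i.coeffₗ hx α)
    (fun f hf => partialDeriv_eventually_const hx.1 hf μ)
    (fun f g hfg => partialDeriv_congr hx.1 hfg μ) (fun f σ => by
      rw [hA, N.leibniz, hA, compCoTan, map_add, map_smul, contract_tmul, i.coeff_add hx,
        i.coeff_smul hx, i.coeff_smul hx, Module.Dual.eval_apply,
        differential_coordVec i.chart_mem hx.1]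
      rfl) χ hχ h1 σ
  rw [← hA, h, Finset.sum_add_distrib, add_comm]
  congr 1
  · simp [LocalChart.coeffₗ_apply, i.coeff_frame hx]
  · exact Finset.sum_congr rfl fun β _ => by rw [mul_comm]; rfl

/-- Here `δ = 0`, because the inhomogeneous term `ρ* df` lies in `T*M`. So the `TM` part of `D σ`
depends only on the value of `σ` at the point. -/
theorem compVec_leibniz (D : GenConnection n r M E) (i : LocalChart n r E) {x : M} (hx : x ∈ i.dom)
    (μ : Fin n) (α : Fin r) (χ : C^∞⟮𝓡 n, M; ℝ⟯) (hχ : tsupport χ ⊆ i.dom)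
    (h1 : ∀ᶠ y in 𝓝 x, χ y = 1) (σ : Cₛ^∞⟮𝓡 n; EuclideanSpace ℝ (Fin r), E⟯) :
    compVec i μ α (D.toFun σ x) =
      ∑ β, compVec i μ α (D.toFun (frameSection i χ hχ β) x) * i.coeff β (σ x) := by
  let A : Cₛ^∞⟮𝓡 n; EuclideanSpace ℝ (Fin r), E⟯ →ₗ[ℝ] ℝ :=
    (i.coeffₗ hx α) ∘ₗ (contract (pairing x (0, coordCovec i.chart μ x))) ∘ₗ
      (LinearMap.proj x) ∘ₗ D.toFun
  have hA : ∀ σ, A σ = compVec i μ α (D.toFun σ x) := fun _ => rfl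
  have h := apply_eq_of_leibniz i A (fun f => 0) 0 (fun f hf => rfl) (fun f g hfg => rfl)
    (fun f σ => by
      rw [hA, D.leibniz, hA, compVec, map_add, map_smul, contract_tmul, i.coeff_add hx,
        i.coeff_smul hx, i.coeff_smul hx, pairing_apply]
      simp [compVec]) χ hχ h1 σ
  rw [← hA, h]
  simp only [zero_mul, add_zero]
  exact Finset.sum_congr rfl fun β _ => by rw [mul_comm]; rfl

theorem exists_isConnCoeff (N : Connection n r M E) (i : LocalChart n r E) :
    ∃ Γ : Fin n → Fin r → Fin r → M → ℝ, IsConnCoeff N i Γ := by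
  classical
  have hb : ∀ x ∈ i.dom, ∃ χ : C^∞⟮𝓡 n, M; ℝ⟯, (∀ᶠ y in 𝓝 x, χ y = 1) ∧ tsupport χ ⊆ i.dom :=
    fun x hx => exists_bump (i.dom_mem_nhds hx)
  choose! χ h1 hχ using hb
  let Γ : Fin n → Fin r → Fin r → M → ℝ := fun μ α β x =>
    if hx : x ∈ i.dom then compCoTan i μ α (N.toFun (frameSection i (χ x) (hχ x hx) β) x) else 0
  have hΓ : ∀ (σ : Cₛ^∞⟮𝓡 n; EuclideanSpace ℝ (Fin r), E⟯), ∀ x ∈ i.dom, ∀ μ α,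
      compCoTan i μ α (N.toFun σ x) = partialDeriv i.chart μ (fun y => i.coeff α (σ y)) x +
        ∑ β, Γ μ α β x * i.coeff β (σ x) := by
    intro σ x hx μ α
    rw [compCoTan_leibniz N i hx μ α (χ x) (hχ x hx) (h1 x hx)]
    simp only [Γ, dif_pos hx]
  refine ⟨Γ, fun μ α β => contMDiffOn_of_smoothNear fun x hx => ?_, hΓ⟩
  -- The bump in `Γ` varies with the point, so smoothness is not visible from the definition. Near
  -- `x` the same `Γ` is computed by the single section `χ_x e_β`: its components are locally
  -- constant there, so the derivative term drops out.
  refine SmoothNear.congr (SmoothNear.of_contMDiffOn i.isOpen_dom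
    (N.smooth (frameSection i (χ x) (hχ x hx) β) i μ α) hx) ?_
  filter_upwards [eventually_eventually_nhds.2 (h1 x hx), i.dom_mem_nhds hx] with y hy hyi
  rw [hΓ _ y hyi, partialDeriv_eventually_const (t := if α = β then 1 else 0) hyi.1]
  · simp only [coeff_frameSection i _ _ _ _ hyi, hy.self_of_nhds]
    simp
  · filter_upwards [hy, i.dom_mem_nhds hyi] with z hz hzi
    rw [coeff_frameSection i _ _ _ _ hzi, hz]

theorem compForm_sumAt (N : Connection n r M E) (V : EndSection n r M E) (i : LocalChart n r E)
    {x : M} (hx : x ∈ i.dom) (μ : Fin n) (α : Fin r)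
    (σ : Cₛ^∞⟮𝓡 n; EuclideanSpace ℝ (Fin r), E⟯) :
    compForm i μ α (sumAt N V σ x) = compCoTan i μ α (N.toFun σ x) := by
  have h1 : pairing x (coordVec i.chart μ x, 0) ∘ₗ
      LinearMap.inr ℝ (TangentSpace (𝓡 n) x) (CoTan n x) =
      Module.Dual.eval ℝ _ (coordVec i.chart μ x) := by
    ext v; simp [pairing_apply]
  have h2 : pairing x (coordVec i.chart μ x, 0) ∘ₗ
      LinearMap.inl ℝ (TangentSpace (𝓡 n) x) (CoTan n x) = 0 := by
    ext v; simp [pairing_apply]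
  have h3 : ∀ t : TangentSpace (𝓡 n) x ⊗[ℝ] Module.End ℝ (E x), contract 0 t = 0 := by
    simp [contract]
  rw [sumAt, compForm_add i hx, compForm, compForm, contract_map, contract_map, h1, h2, h3,
    map_zero, i.coeff_zero hx, add_zero]
  rfl

theorem compVec_sumAt (N : Connection n r M E) (V : EndSection n r M E) (i : LocalChart n r E)
    {x : M} (hx : x ∈ i.dom) (μ : Fin n) (α : Fin r)
    (σ : Cₛ^∞⟮𝓡 n; EuclideanSpace ℝ (Fin r), E⟯) :
    compVec i μ α (sumAt N V σ x) = ∑ β, compEnd i μ α β (V.toFun x) * i.coeff β (σ x) := by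
  have h1 : pairing x (0, coordCovec i.chart μ x) ∘ₗ
      LinearMap.inl ℝ (TangentSpace (𝓡 n) x) (CoTan n x) = coordCovec i.chart μ x := by
    ext v; simp [pairing_apply]
  have h2 : pairing x (0, coordCovec i.chart μ x) ∘ₗ
      LinearMap.inr ℝ (TangentSpace (𝓡 n) x) (CoTan n x) = 0 := by
    ext v; simp [pairing_apply]
  have h3 : ∀ t : CoTan n x ⊗[ℝ] E x, contract 0 t = 0 := by
    simp [contract]
  rw [sumAt, compVec_add i hx, compVec, compVec, contract_map, contract_map, h1, h2, h3,
    map_zero, i.coeff_zero hx, zero_add, ← contract_end_apply i hx]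
  rfl

/-- The generalized connection `∇ + V`. -/
def sumConnection (N : Connection n r M E) (V : EndSection n r M E) : GenConnection n r M E where
  toFun :=
    { toFun := fun σ x => sumAt N V σ x
      map_add' := fun σ τ => by
        funext x
        simp only [sumAt, map_add, Pi.add_apply, ContMDiffSection.coe_add,
          TensorProduct.map_add_right, LinearMap.add_apply]
        abel
      map_smul' := fun t σ => by
        funext x
        simp only [sumAt, map_smul, Pi.smul_apply, ContMDiffSection.coe_smul, smul_add,
          TensorProduct.map_smul_right, LinearMap.smul_apply, RingHom.id_apply] }
  smooth σ i μ α := by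
    refine ⟨(N.smooth σ i μ α).congr fun x hx => compForm_sumAt N V i hx μ α σ,
      contMDiffOn_of_smoothNear fun x hx => ?_⟩
    refine SmoothNear.congr (SmoothNear.sum (s := Finset.univ)
      (g := fun β x => compEnd i μ α β (V.toFun x) * i.coeff β (σ x)) fun β _ =>
      (SmoothNear.of_contMDiffOn i.isOpen_dom (V.smooth i μ α β) hx).mul
        (i.smoothNear_section σ hx β)) ?_
    filter_upwards [i.dom_mem_nhds hx] with y hy
    exact compVec_sumAt N V i hy μ α σ
  leibniz f σ x := by
    change sumAt N V _ x = _ • sumAt N V _ x + _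
    simp only [sumAt, N.leibniz, map_add, map_smul, TensorProduct.map_tmul, smulSection_apply,
      TensorProduct.map_smul_right, LinearMap.smul_apply, smul_add, LinearMap.id_apply]
    rw [add_right_comm]
    rfl

theorem sumConnection_injective (N N' : Connection n r M E) (V V' : EndSection n r M E)
    (h : sumConnection N V = sumConnection N' V') : N = N' ∧ V = V' := by
  have h' : ∀ σ x, sumAt N V σ x = sumAt N' V' σ x := fun σ x =>
    congrFun (congrFun (congrArg (fun D : GenConnection n r M E => (D.toFun : _ → _)) h) σ) x
  constructor
  · have : N.toFun = N'.toFun := by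
      ext σ x
      refine coTan_ext (LocalChart.around n r E x) (LocalChart.mem_dom_around x) fun μ α => ?_
      rw [← compForm_sumAt N V _ (LocalChart.mem_dom_around x),
        ← compForm_sumAt N' V' _ (LocalChart.mem_dom_around x), h']
    cases N; cases N'; congr
  · have : V.toFun = V'.toFun := by
      ext x
      have hx := LocalChart.mem_dom_around (r := r) (E := E) (n := n) x
      refine end_ext (LocalChart.around n r E x) hx fun μ α β => ?_
      -- A section with value `e_β` at `x` isolates the component `V^{μα}_β`.
      obtain ⟨χ, h1, hχ⟩ := exists_bump (n := n) ((LocalChart.around n r E x).dom_mem_nhds hx)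
      have e := compVec_sumAt N V _ hx μ α (frameSection _ χ hχ β)
      rw [h', compVec_sumAt N' V' _ hx] at e
      simp only [coeff_frameSection _ χ hχ β _ hx, h1.self_of_nhds] at e
      simpa using e.symm
    cases V; cases V'; congr

theorem sumConnection_surjective (D : GenConnection n r M E) :
    ∃ (N : Connection n r M E) (V : EndSection n r M E), sumConnection N V = D := by
  classical
  have hsnd : ∀ (i : LocalChart n r E) {x : M} (μ : Fin n) (α : Fin r)
      (t : GTan n x ⊗[ℝ] E x), compCoTan i μ α (TensorProduct.map
        (LinearMap.snd ℝ (TangentSpace (𝓡 n) x) (CoTan n x)) LinearMap.id t) =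
        compForm i μ α t := by
    intro i x μ α t
    have h1 : pairing x (coordVec i.chart μ x, 0) =
        Module.Dual.eval ℝ _ (coordVec i.chart μ x) ∘ₗ
          LinearMap.snd ℝ (TangentSpace (𝓡 n) x) (CoTan n x) := by
      ext v <;> simp [pairing_apply]
    rw [compCoTan, contract_map, compForm, h1]
    rfl
  let N : Connection n r M E :=
    { toFun :=
        { toFun := fun σ x => TensorProduct.map
            (LinearMap.snd ℝ (TangentSpace (𝓡 n) x) (CoTan n x)) LinearMap.id (D.toFun σ x)
          map_add' := fun σ τ => by funext x; simp
          map_smul' := fun t σ => by funext x; simp }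
      smooth := fun σ i μ α => ((D.smooth σ i μ α).1).congr fun x hx => hsnd i μ α _
      leibniz := fun f σ x => by
        change TensorProduct.map _ _ (D.toFun _ x) = _ • TensorProduct.map _ _ (D.toFun _ x) + _
        rw [D.leibniz, map_add, map_smul, TensorProduct.map_tmul]
        rfl }
  have hb : ∀ x, ∃ χ : C^∞⟮𝓡 n, M; ℝ⟯, (∀ᶠ y in 𝓝 x, χ y = 1) ∧
      tsupport χ ⊆ (LocalChart.around n r E x).dom :=
    fun x => exists_bump (LocalChart.dom_mem_nhds _ (LocalChart.mem_dom_around x))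
  choose χ h1 hχ using hb
  -- At each point the tensor is prescribed in one preferred chart; independence of that choice, and
  -- with it smoothness, comes from `hproj`.
  choose W hW using fun x => exists_end (LocalChart.around n r E x) (LocalChart.mem_dom_around x)
    fun μ α β => compVec (LocalChart.around n r E x) μ α
      (D.toFun (frameSection (LocalChart.around n r E x) (χ x) (hχ x) β) x)
  have hproj : ∀ (i : LocalChart n r E) {x : M} (hx : x ∈ i.dom) (μ : Fin n) (α : Fin r) σ,
      i.coeff α (contract (coordCovec i.chart μ x) (W x) (σ x)) =
        compVec i μ α (D.toFun σ x) := by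
    intro i x hx μ α σ
    have hfst : ∀ (i : LocalChart n r E) (μ : Fin n) (t : GTan n x ⊗[ℝ] E x),
        contract (coordCovec i.chart μ x) (TensorProduct.map
        (LinearMap.fst ℝ (TangentSpace (𝓡 n) x) (CoTan n x)) LinearMap.id t) =
        contract (pairing x (0, coordCovec i.chart μ x)) t := by
      intro i μ t
      have h1 : pairing x (0, coordCovec i.chart μ x) = coordCovec i.chart μ x ∘ₗ
            LinearMap.fst ℝ (TangentSpace (𝓡 n) x) (CoTan n x) := by
        ext v <;> simp [pairing_apply]
      rw [contract_map, h1]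
      rfl
    -- Two tensors in `TM ⊗ E` with equal contractions in the preferred chart are equal, and may
    -- afterwards be contracted in any other chart.
    have key : TensorProduct.map LinearMap.id (LinearMap.applyₗ (σ x)) (W x) =
        TensorProduct.map (LinearMap.fst ℝ (TangentSpace (𝓡 n) x) (CoTan n x)) LinearMap.id
          (D.toFun σ x) := by
      have ha := LocalChart.mem_dom_around (r := r) (E := E) (n := n) x
      refine ext_of_contract (sum_coordCovec_smul_coordVec
        (LocalChart.around n r E x).chart_mem ha.1) fun ν => ?_
      refine LocalChart.coeff_ext _ ha fun β => ?_
      rw [hfst, contract_map, LinearMap.comp_id, LinearMap.applyₗ_apply_apply,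
        contract_end_apply _ ha]
      simp only [hW]
      exact (compVec_leibniz D _ ha ν β (χ x) (hχ x) (h1 x) σ).symm
    have := congrArg (fun t => i.coeff α (contract (coordCovec i.chart μ x) t)) key
    simp only [contract_map, hfst, LinearMap.comp_id] at this
    exact this
  let V : EndSection n r M E :=
    { toFun := W
      smooth := fun i μ α β => contMDiffOn_of_smoothNear fun x hx => by
        obtain ⟨χ', h1', hχ'⟩ := exists_bump (n := n) (i.dom_mem_nhds hx)
        refine SmoothNear.congr (SmoothNear.of_contMDiffOn i.isOpen_dom
          (D.smooth (frameSection i χ' hχ' β) i μ α).2 hx) ?_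
        filter_upwards [h1', i.dom_mem_nhds hx] with y hy hyi
        rw [← hproj i hyi, frameSection_apply, hy, one_smul]
        rfl }
  refine ⟨N, V, ?_⟩
  have : (sumConnection N V).toFun = D.toFun := by
    ext σ x
    have ha := LocalChart.mem_dom_around (r := r) (E := E) (n := n) x
    change sumAt N V σ x = _
    refine gtan_ext (LocalChart.around n r E x) ha (fun μ α => ?_) fun μ α => ?_
    · rw [compForm_sumAt N V _ ha]
      exact hsnd _ μ α _
    · rw [compVec_sumAt N V _ ha, ← contract_end_apply _ ha]
      exact hproj _ ha μ α σ
  cases D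
  simp only [sumConnection] at this ⊢
  congr

variable (n r M E) in
/-- Generalized connections are sums of a connection and a section of `TM ⊗ End E`. -/
def sumEquiv : Connection n r M E × EndSection n r M E ≃ GenConnection n r M E :=
  Equiv.ofBijective (fun P => sumConnection P.1 P.2)
    ⟨fun P P' h => Prod.ext (sumConnection_injective _ _ _ _ h).1
      (sumConnection_injective _ _ _ _ h).2, fun D => by
      obtain ⟨N, V, h⟩ := sumConnection_surjective D
      exact ⟨(N, V), h⟩⟩

end ConnectionBijection

/-! ### Global functions, cut off coordinates and locality of vector fields -/

section GlobalFunctions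

variable {n r : ℕ} {k : ℤ} {M : Type*} [TopologicalSpace M]
  [ChartedSpace (EuclideanSpace ℝ (Fin n)) M] [IsManifold (𝓡 n) ∞ M]
  {E : M → Type*} [TopologicalSpace (TotalSpace (EuclideanSpace ℝ (Fin r)) E)]
  [∀ x, AddCommGroup (E x)] [∀ x, Module ℝ (E x)] [∀ x, TopologicalSpace (E x)]
  [FiberBundle (EuclideanSpace ℝ (Fin r)) E] [VectorBundle ℝ (EuclideanSpace ℝ (Fin r)) E]
  [ContMDiffVectorBundle ∞ (EuclideanSpace ℝ (Fin r)) E (𝓡 n)]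

open Classical in
/-- The extension by zero of a local function. -/
def extZero (i : LocalChart n r E) (f : i.dom → GAlg n r k) (y : M) : GAlg n r k :=
  if h : y ∈ i.dom then f ⟨y, h⟩ else 0

theorem extZero_of_mem (i : LocalChart n r E) (f : i.dom → GAlg n r k) {y : M} (h : y ∈ i.dom) :
    extZero i f y = f ⟨y, h⟩ := dif_pos h

theorem extZero_eventuallyEq {i : LocalChart n r E} {f : i.dom → GAlg n r k} {F : M → GAlg n r k}
    {x : M} (hx : x ∈ i.dom) (h : ∀ᶠ y in 𝓝 x, ∀ hy : y ∈ i.dom, f ⟨y, hy⟩ = F y) :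
    extZero i f =ᶠ[𝓝 x] F := by
  filter_upwards [h, i.dom_mem_nhds hx] with y h hy
  rw [extZero_of_mem i f hy, h hy]

theorem smoothGr_of_isSmooth {i : LocalChart n r E} {f : i.dom → GAlg n r k} (hf : i.IsSmooth f)
    {x : M} (hx : x ∈ i.dom) : SmoothGr (extZero i f) x := by
  obtain ⟨U, hU, hxU, ι, _, g, a, hg, e⟩ := hf x hx
  refine ⟨ι, inferInstance, g, a, fun m => SmoothNear.of_contMDiffOn hU (hg m) hxU, ?_⟩
  filter_upwards [hU.mem_nhds hxU, i.dom_mem_nhds hx] with y hy hyi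
  rw [extZero_of_mem i f hyi, e ⟨y, hyi⟩ hy]

theorem isSmooth_of_smoothGr {i : LocalChart n r E} {f : i.dom → GAlg n r k}
    (hf : ∀ x ∈ i.dom, SmoothGr (extZero i f) x) : i.IsSmooth f := by
  intro x hx
  obtain ⟨U, hU, hxU, ι, _, g, a, hg, e⟩ := (hf x hx).isSmoothAt
  exact ⟨U, hU, hxU, ι, inferInstance, g, a, hg, fun y hy => by
    rw [← e y hy, extZero_of_mem i f y.2]⟩

theorem smoothGr_globalFun (f : globalFun n r E k) (i : LocalChart n r E) {x : M} (hx : x ∈ i.dom) :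
    SmoothGr (extZero i (f.1 i)) x := by
  refine Submodule.iSup_induction (fun j => funDeg n r E k j)
    (motive := fun f => SmoothGr (extZero i (f i)) x) f.2
    (fun j f hf => smoothGr_of_isSmooth (hf.1 i) hx) ?_ fun f g hf hg => ?_
  · exact (SmoothGr.const 0).congr (extZero_eventuallyEq hx (Filter.Eventually.of_forall
      fun _ _ => rfl))
  · refine (hf.add hg).congr (extZero_eventuallyEq hx (Filter.Eventually.of_forall fun y hy => ?_))
    rw [extZero_of_mem i _ hy, extZero_of_mem i _ hy]
    rfl

theorem globalFun_compat (f : globalFun n r E k) (i i' : LocalChart n r E) {x : M} (hx : x ∈ i.dom)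
    (hx' : x ∈ i'.dom) : f.1 i ⟨x, hx⟩ = i.trans i' k x (f.1 i' ⟨x, hx'⟩) := by
  refine Submodule.iSup_induction (fun j => funDeg n r E k j)
    (motive := fun f => f i ⟨x, hx⟩ = i.trans i' k x (f i' ⟨x, hx'⟩)) f.2
    (fun j f hf => hf.2.1 i i' x hx hx') ?_ fun f g hf hg => ?_
  · simp
  · simp [hf, hg]

/-- For smooth `f` the directional derivatives of all functionals exist and determine the element,
so the relation becomes an equation; the same then holds for `IsFieldAt`. -/
theorem hasPartial_iff {i : LocalChart n r E} {f : i.dom → GAlg n r k} {x : M} (hx : x ∈ i.dom)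
    (hf : SmoothGr (extZero i f) x) (μ : Fin n) (a : GAlg n r k) :
    HasPartial i f x μ a ↔ a = pd i.chart μ (extZero i f) x := by
  have key : ∀ ℓ : GAlg n r k →ₗ[ℝ] ℝ, HasLineDerivAt ℝ
      (fun y => open Classical in
        if h : i.chart.symm y ∈ i.dom then ℓ (f ⟨i.chart.symm y, h⟩) else 0)
      (ℓ (pd i.chart μ (extZero i f) x)) (i.chart x) (EuclideanSpace.single μ (1 : ℝ)) := by
    intro ℓ
    have e : (fun y => open Classical in
        if h : i.chart.symm y ∈ i.dom then ℓ (f ⟨i.chart.symm y, h⟩) else 0) =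
        fun y => ℓ (extZero i f (i.chart.symm y)) := by
      funext y
      simp only [extZero]
      split_ifs <;> simp
    rw [e, functional_pd i.chart_mem hx.1 hf]
    exact ((hf.functional ℓ).differentiableAt i.chart_mem hx.1).hasFDerivAt.hasLineDerivAt _
  refine ⟨fun h => eq_of_functional fun ℓ => (h ℓ).unique (key ℓ), ?_⟩
  rintro rfl
  exact key

theorem isFieldAt_iff {i : LocalChart n r E} {f : i.dom → GAlg n r k} {x : i.dom}
    (hf : SmoothGr (extZero i f) x) (X' : GAlg n r k →ₗ[ℝ] GAlg n r k) (g : GAlg n r k) :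
    IsFieldAt i X' f x g ↔
      g = ∑ μ, gen k (.psi μ) * pd i.chart μ (extZero i f) x + X' (f x) := by
  constructor
  · rintro ⟨a, ha, rfl⟩
    simp only [(hasPartial_iff x.2 hf _ _).1 (ha _)]
  · rintro rfl
    exact ⟨_, fun μ => (hasPartial_iff x.2 hf _ _).2 rfl, rfl⟩

theorem fn_mem_funDeg (g : C^∞⟮𝓡 n, M; ℝ⟯) :
    (fun _ x => g x • 1 : LocalFamily n r E k) ∈ funDeg n r E k 0 := by
  refine ⟨fun i => isSmooth_of_smoothGr fun x hx => ?_, fun i i' x hx hx' => by simp,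
    fun i x => Submodule.smul_mem _ _ one_mem_homog⟩
  exact (SmoothGr.smul_const (SmoothNear.of_contMDiff g x) 1).congr
    (extZero_eventuallyEq hx (Filter.Eventually.of_forall fun _ _ => rfl))

variable (r k E) in
/-- A function on `M` as a global function on the graded manifold. -/
def fnGlob (g : C^∞⟮𝓡 n, M; ℝ⟯) : globalFun n r E k :=
  ⟨fun _ x => g x • 1, Submodule.mem_iSup_of_mem 0 (fn_mem_funDeg g)⟩

theorem isBaseFun_fnGlob (g : C^∞⟮𝓡 n, M; ℝ⟯) : IsBaseFun (fnGlob r k E g) :=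
  fun _ _ => Subalgebra.smul_mem _ (one_mem _) _

variable (i : LocalChart n r E) (χ : C^∞⟮𝓡 n, M; ℝ⟯)

open Classical in
/-- The coordinate `g` of the chart `i`, cut off by `χ`. -/
def genFamily (k : ℤ) (g : Gen n r) : LocalFamily n r E k :=
  fun j x => if (x : M) ∈ i.dom then χ x • j.transGen i k x g else 0

variable {χ} (hχ : tsupport χ ⊆ i.dom)
include hχ

/-- Compatibility is the cocycle identity `trans_transGen`. Smoothness across the boundary of
`i.dom` holds because `χ` vanishes near every point outside it. -/
theorem genFamily_mem (g : Gen n r) : genFamily i χ k g ∈ funDeg n r E k (g.deg k) := by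
  refine ⟨fun j => isSmooth_of_smoothGr fun x hx => ?_, fun j j' x hx hx' => ?_, fun j x => ?_⟩
  · by_cases hi : x ∈ i.dom
    · refine (SmoothGr.fun_smul (SmoothNear.of_contMDiff χ x)
        (j.smoothGr_transGen i k hx hi g)).congr (extZero_eventuallyEq hx ?_)
      filter_upwards [i.dom_mem_nhds hi] with y hy hyj
      simp only [genFamily, if_pos hy]
    · refine (SmoothGr.const 0).congr (extZero_eventuallyEq hx ?_)
      filter_upwards [(isClosed_tsupport χ).isOpen_compl.mem_nhds (fun h => hi (hχ h))] with y hy hyj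
      simp only [genFamily, image_eq_zero_of_notMem_tsupport hy, zero_smul, ite_self]
  · by_cases hi : x ∈ i.dom
    · simp only [genFamily, if_pos hi, map_smul, j.trans_transGen j' i k hx hx' hi]
    · simp only [genFamily, if_neg hi, map_zero]
  · simp only [genFamily]
    split_ifs
    · exact Submodule.smul_mem _ _ (j.transGen_mem i k _ g)
    · exact zero_mem _

/-- The coordinate `g` of the chart `i`, cut off by `χ`, as a global function. -/
def genGlob (k : ℤ) (g : Gen n r) : globalFun n r E k :=
  ⟨genFamily i χ k g, Submodule.mem_iSup_of_mem _ (genFamily_mem i hχ g)⟩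

/-- The substitution of the cut off coordinates of the chart `i`. -/
def polyGlob (k : ℤ) : GAlg n r k →ₐ[ℝ] globalFun n r E k :=
  liftAlg (genGlob i hχ k) (by
    intro g h
    apply Subtype.ext
    funext j x
    exact homog_comm ((genFamily_mem i hχ g).2.2 j x) ((genFamily_mem i hχ h).2.2 j x))

theorem polyGlob_gen (g : Gen n r) : polyGlob i hχ k (gen k g) = genGlob i hχ k g :=
  liftAlg_gen _ _ g

omit hχ in
theorem genFamily_apply {y : M} (hy : y ∈ i.dom) (h1 : χ y = 1) (g : Gen n r) :
    genFamily i χ k g i ⟨y, hy⟩ = gen k g := by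
  simp only [genFamily, if_pos hy, h1, one_smul, i.trans_self_gen k hy]

theorem polyGlob_apply {y : M} (hy : y ∈ i.dom) (h1 : χ y = 1) (a : GAlg n r k) :
    (polyGlob i hχ k a).1 i ⟨y, hy⟩ = a := by
  induction a using GAlg.induction with
  | one => simp
  | gen_mul g a ih =>
    rw [map_mul, polyGlob_gen]
    change genFamily i χ k g i ⟨y, hy⟩ * (polyGlob i hχ k a).1 i ⟨y, hy⟩ = _
    rw [ih, genFamily_apply i hy h1]
  | add a b ha hb =>
    rw [map_add]
    change (polyGlob i hχ k a).1 i ⟨y, hy⟩ + (polyGlob i hχ k b).1 i ⟨y, hy⟩ = _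
    rw [ha, hb]
  | smul t a ha =>
    rw [map_smul]
    change t • (polyGlob i hχ k a).1 i ⟨y, hy⟩ = _
    rw [ha]

omit hχ in
/-- Vector fields are local operators. -/
theorem VectorField.apply_eq_zero [T2Space M] {d : ℤ} (P : VectorField n r E k d)
    {x : M} (hx : x ∈ i.dom) (f : globalFun n r E k)
    (hf : ∀ᶠ y in 𝓝 x, extZero i (f.1 i) y = 0) : (P.toFun f).1 i ⟨x, hx⟩ = 0 := by
  obtain ⟨χ, h1, hχ⟩ := exists_bump (n := n) (Filter.inter_mem hf (i.dom_mem_nhds hx))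
  -- The support of `χ` lies where `f` vanishes. The Leibniz rule for `χ f = 0`, evaluated at `x`
  -- where `χ = 1` and `f = 0`, leaves only the value of `P f`.
  have h0 : fnGlob r k E χ * f = 0 := by
    apply Subtype.ext
    funext j y
    change (χ y • (1 : GAlg n r k)) * f.1 j y = 0
    by_cases hy : (y : M) ∈ tsupport χ
    · have := (hχ hy).1
      rw [mem_ofPred_eq, extZero_of_mem i _ (hχ hy).2] at this
      rw [globalFun_compat f j i y.2 (hχ hy).2, this]
      simp
    · rw [image_eq_zero_of_notMem_tsupport hy]; simp
  have h := P.leibniz 0 (fnGlob r k E χ) f (fn_mem_funDeg χ)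
  rw [h0, map_zero] at h
  have h' := congrArg (fun F : globalFun n r E k => F.1 i ⟨x, hx⟩) h
  have hfx : f.1 i ⟨x, hx⟩ = 0 := by rw [← extZero_of_mem i (f.1 i) hx]; exact hf.self_of_nhds
  have e : (0 : GAlg n r k) = (P.toFun (fnGlob r k E χ)).1 i ⟨x, hx⟩ * f.1 i ⟨x, hx⟩ +
    (-1 : ℝ) ^ (d * 0) • ((χ x • (1 : GAlg n r k)) * (P.toFun f).1 i ⟨x, hx⟩) := h'
  rw [hfx, h1.self_of_nhds] at e
  simpa using e.symm

omit hχ in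
theorem VectorField.apply_congr [T2Space M] {d : ℤ} (P : VectorField n r E k d)
    {x : M} (hx : x ∈ i.dom) (f g : globalFun n r E k)
    (hf : extZero i (f.1 i) =ᶠ[𝓝 x] extZero i (g.1 i)) :
    (P.toFun f).1 i ⟨x, hx⟩ = (P.toFun g).1 i ⟨x, hx⟩ := by
  rw [← sub_eq_zero]
  have h : (P.toFun (f - g)).1 i ⟨x, hx⟩ = 0 := by
    refine P.apply_eq_zero i hx _ ?_
    filter_upwards [hf, i.dom_mem_nhds hx] with y hy hyi
    rw [extZero_of_mem i _ hyi, extZero_of_mem i _ hyi] at hy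
    rw [extZero_of_mem i _ hyi]
    change f.1 i ⟨y, hyi⟩ - g.1 i ⟨y, hyi⟩ = 0
    rw [hy, sub_self]
  rw [map_sub] at h
  exact h

/-- A vector field is determined by its values on the functions on `M` and on the coordinates. -/
theorem VectorField.apply_eq [T2Space M] {d : ℤ} (P : VectorField n r E k d)
    {x : M} (hx : x ∈ i.dom) (h1 : ∀ᶠ y in 𝓝 x, χ y = 1) (ξ : Fin n → GAlg n r k)
    (hξ : ∀ g, (P.toFun (fnGlob r k E g)).1 i ⟨x, hx⟩ = ∑ μ, partialDeriv i.chart μ g x • ξ μ)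
    {v : Gen n r → GAlg n r k} (hv : ∀ g : Gen n r, v g ∈ homog n r k (g.deg k + d))
    (hv' : ∀ g, (P.toFun (genGlob i hχ k g)).1 i ⟨x, hx⟩ = v g) (f : globalFun n r E k) :
    (P.toFun f).1 i ⟨x, hx⟩ =
      ∑ μ, ξ μ * pd i.chart μ (extZero i (f.1 i)) x + der d v hv (f.1 i ⟨x, hx⟩) := by
  let A : GAlg n r k →ₗ[ℝ] GAlg n r k :=
    { toFun := fun a => (P.toFun (polyGlob i hχ k a)).1 i ⟨x, hx⟩
      map_add' := fun a b => by rw [map_add, map_add]; rfl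
      map_smul' := fun t a => by rw [map_smul, map_smul]; rfl }
  have hAd : ∀ a, A a = (P.toFun (polyGlob i hχ k a)).1 i ⟨x, hx⟩ := fun _ => rfl
  have hone : P.toFun 1 = 0 := by
    have h := P.leibniz 0 1 1 one_mem_funDeg
    simpa using h
  -- On polynomials that are constant near `x`, the field obeys the same Leibniz rule as `der d v
  -- hv` and agrees with it on the coordinates.
  have hA : ∀ a, A a = der d v hv a := by
    refine ext_of_leibniz id (fun g => (-1 : ℝ) ^ (d * g.deg k)) A (der d v hv) ?_ der_one ?_ ?_ ?_
    · rw [hAd, map_one, hone]; rfl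
    · intro g a
      rw [hAd, map_mul, polyGlob_gen, P.leibniz (g.deg k) _ _ (genFamily_mem i hχ g)]
      change _ * (polyGlob i hχ k a).1 i ⟨x, hx⟩ +
        (_ : ℝ) • (genFamily i χ k g i ⟨x, hx⟩ * A a) = _
      rw [polyGlob_apply i hχ hx h1.self_of_nhds, genFamily_apply i hx h1.self_of_nhds,
        ← polyGlob_gen]
      rfl
    · intro g a
      rw [der_gen_mul, der_gen]
      rfl
    · intro g
      rw [hAd, polyGlob_gen, hv', der_gen]
  obtain ⟨ι, _, g, a, hg, e⟩ := smoothGr_globalFun f i hx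
  -- A second bump makes the coefficient functions global, so that near `x` the function `f` is a
  -- finite sum of products of global functions on which `P` is known.
  obtain ⟨χ', h1', hχ'⟩ := exists_bump (n := n) (Filter.eventually_all.2 fun m => (hg m).eventually)
  let g' : ι → C^∞⟮𝓡 n, M; ℝ⟯ := fun m => cutoff χ' (g m) fun y hy => hχ' hy m
  have hg' : ∀ m, (g' m : M → ℝ) =ᶠ[𝓝 x] g m := by
    intro m
    filter_upwards [h1'] with y hy
    rw [cutoff_apply, hy, one_mul]
  have hval : ∀ (s : Finset ι) {y : M} (hy : y ∈ i.dom), χ y = 1 →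
      (∑ m ∈ s, fnGlob r k E (g' m) * polyGlob i hχ k (a m)).1 i ⟨y, hy⟩ =
        ∑ m ∈ s, g' m y • a m := by
    intro s y hy hy1
    classical
    induction s using Finset.induction_on with
    | empty => rfl
    | insert m s hm ih =>
      rw [Finset.sum_insert hm, Finset.sum_insert hm, ← ih]
      change (g' m y • (1 : GAlg n r k)) * (polyGlob i hχ k (a m)).1 i ⟨y, hy⟩ + _ = _
      rw [polyGlob_apply i hχ hy hy1, smul_mul_assoc, one_mul]
  have hP : ∀ s : Finset ι,
      (P.toFun (∑ m ∈ s, fnGlob r k E (g' m) * polyGlob i hχ k (a m))).1 i ⟨x, hx⟩ =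
        ∑ m ∈ s, ((∑ μ, partialDeriv i.chart μ (g' m) x • ξ μ) * a m +
          g' m x • der d v hv (a m)) := by
    intro s
    classical
    induction s using Finset.induction_on with
    | empty => rw [Finset.sum_empty, Finset.sum_empty, map_zero]; rfl
    | insert m s hm ih =>
      rw [Finset.sum_insert hm, Finset.sum_insert hm, ← ih, map_add,
        P.leibniz 0 _ _ (fn_mem_funDeg (g' m))]
      change ((P.toFun (fnGlob r k E (g' m))).1 i ⟨x, hx⟩ * (polyGlob i hχ k (a m)).1 i ⟨x, hx⟩ +
        (-1 : ℝ) ^ (d * 0) • ((g' m x • (1 : GAlg n r k)) * A (a m))) + _ = _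
      rw [polyGlob_apply i hχ hx h1.self_of_nhds, hξ, hA]
      simp
  have hcongr := P.apply_congr i hx f (∑ m, fnGlob r k E (g' m) * polyGlob i hχ k (a m)) (by
    filter_upwards [e, h1, Filter.eventually_all.2 hg', i.dom_mem_nhds hx] with y h h1 hg' hy
    rw [h, extZero_of_mem i _ hy, hval _ hy h1]
    simp only [hg'])
  have hfx : f.1 i ⟨x, hx⟩ = ∑ m, g m x • a m := by
    rw [← extZero_of_mem i (f.1 i) hx, e.self_of_nhds]
  rw [hcongr, hP, hfx, map_sum, Finset.sum_add_distrib]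
  simp only [pd_of_rep i.chart_mem hx.1 hg e, map_smul, (hg' _).self_of_nhds,
    partialDeriv_congr hx.1 (hg' _), Finset.mul_sum, Finset.sum_mul, smul_mul_assoc, mul_smul_comm]
  rw [Finset.sum_comm]

end GlobalFunctions

/-! ### Identities from the anticommuting coordinates -/

section OddCoordinates

variable {n r : ℕ} {k : ℤ}

theorem psi_mul_psi (μ ν : Fin n) : gen k (.psi μ : Gen n r) * gen k (.psi ν) =
    -(gen k (.psi ν) * gen k (.psi μ)) := by
  simpa [Gen.deg] using gen_mul_gen (k := k) (.psi μ : Gen n r) (.psi ν)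

theorem b_mul_psi (μ ν : Fin n) : gen k (.b μ : Gen n r) * gen k (.psi ν) =
    -(gen k (.psi ν) * gen k (.b μ)) := by
  simpa [Gen.deg] using gen_mul_gen (k := k) (.b μ : Gen n r) (.psi ν)

/-- Exchanging the summation indices changes the sign, since the `ψ` anticommute. -/
theorem sum_symm_psi_psi (S : Fin n → Fin n → ℝ) (hS : ∀ μ ν, S μ ν = S ν μ) :
    ∑ μ, ∑ ν, S μ ν • (gen k (.psi μ : Gen n r) * gen k (.psi ν)) = 0 := by
  have h : ∑ μ, ∑ ν, S μ ν • (gen k (.psi μ : Gen n r) * gen k (.psi ν)) =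
      -∑ μ, ∑ ν, S μ ν • (gen k (.psi μ : Gen n r) * gen k (.psi ν)) := by
    conv_lhs => rw [Finset.sum_comm]
    simp only [← Finset.sum_neg_distrib]
    exact Finset.sum_congr rfl fun μ _ => Finset.sum_congr rfl fun ν _ => by
      rw [psi_mul_psi, smul_neg, hS]
  have h2 : (2 : ℝ) • (∑ μ, ∑ ν, S μ ν • (gen k (.psi μ : Gen n r) * gen k (.psi ν))) = 0 := by
    rw [two_smul]
    nth_rewrite 1 [h]
    exact neg_add_cancel _
  exact (smul_eq_zero.1 h2).resolve_left two_ne_zero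

/-- The closedness relation contracted with the odd coordinates `ψ`. -/
theorem sum_closed_psi (D : Fin n → Fin n → Fin n → Fin n → ℝ)
    (hD : ∀ κ μ ν ρ, D κ μ ν ρ = D μ κ ν ρ - D ν κ μ ρ + D ρ κ μ ν) (κ : Fin n) :
    ∑ μ, ∑ ν, ∑ ρ, D κ μ ν ρ •
        (gen k (.psi μ : Gen n r) * gen k (.psi ν) * gen k (.psi ρ)) =
      (3 : ℝ) • ∑ μ, ∑ ν, ∑ ρ, D μ κ ν ρ •
        (gen k (.psi μ : Gen n r) * gen k (.psi ν) * gen k (.psi ρ)) := by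
  let S := ∑ μ, ∑ ν, ∑ ρ, D μ κ ν ρ •
        (gen k (.psi μ : Gen n r) * gen k (.psi ν) * gen k (.psi ρ))
  have h2 : ∑ μ, ∑ ν, ∑ ρ, D ν κ μ ρ •
      (gen k (.psi μ : Gen n r) * gen k (.psi ν) * gen k (.psi ρ)) = -S := by
    rw [Finset.sum_comm]
    simp only [S, ← Finset.sum_neg_distrib]
    refine Finset.sum_congr rfl fun μ _ => Finset.sum_congr rfl fun ν _ =>
      Finset.sum_congr rfl fun ρ _ => ?_
    rw [psi_mul_psi, neg_mul, smul_neg]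
  -- A cyclic permutation of three odd factors is even, whereas `h2` used a transposition. With the
  -- signs of `hD` all three terms therefore add up, giving the factor `3`.
  have h3 : ∑ μ, ∑ ν, ∑ ρ, D ρ κ μ ν •
      (gen k (.psi μ : Gen n r) * gen k (.psi ν) * gen k (.psi ρ)) = S := by
    calc _ = ∑ μ, ∑ ρ, ∑ ν, D ρ κ μ ν •
          (gen k (.psi μ : Gen n r) * gen k (.psi ν) * gen k (.psi ρ)) :=
          Finset.sum_congr rfl fun μ _ => Finset.sum_comm
      _ = ∑ ρ, ∑ μ, ∑ ν, D ρ κ μ ν •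
          (gen k (.psi μ : Gen n r) * gen k (.psi ν) * gen k (.psi ρ)) := Finset.sum_comm
      _ = S := by
          refine Finset.sum_congr rfl fun μ _ => Finset.sum_congr rfl fun ν _ =>
            Finset.sum_congr rfl fun ρ _ => ?_
          rw [mul_assoc, psi_mul_psi ρ μ, mul_neg, ← mul_assoc, psi_mul_psi ν μ, neg_mul, neg_neg]
  have e : ∀ μ ν ρ, D κ μ ν ρ • (gen k (.psi μ : Gen n r) * gen k (.psi ν) * gen k (.psi ρ)) =
      D μ κ ν ρ • (gen k (.psi μ : Gen n r) * gen k (.psi ν) * gen k (.psi ρ)) -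
      D ν κ μ ρ • (gen k (.psi μ : Gen n r) * gen k (.psi ν) * gen k (.psi ρ)) +
      D ρ κ μ ν • (gen k (.psi μ : Gen n r) * gen k (.psi ν) * gen k (.psi ρ)) := by
    intro μ ν ρ
    rw [hD κ μ ν ρ, add_smul, sub_smul]
  simp only [e, Finset.sum_add_distrib, Finset.sum_sub_distrib, h2, h3]
  change S - -S + S = (3 : ℝ) • S
  module

end OddCoordinates

/-! ### Lifts of `d_𝓜` in a chart, and their vanishing square on the base -/

section LocalField

variable {n r : ℕ} {k : ℤ} {M : Type*} [TopologicalSpace M]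
  [ChartedSpace (EuclideanSpace ℝ (Fin n)) M] [IsManifold (𝓡 n) ∞ M]
  {E : M → Type*} [TopologicalSpace (TotalSpace (EuclideanSpace ℝ (Fin r)) E)]
  [∀ x, AddCommGroup (E x)] [∀ x, Module ℝ (E x)] [∀ x, TopologicalSpace (E x)]
  [FiberBundle (EuclideanSpace ℝ (Fin r)) E]

/-- `½ H_{νab} ψ^a ψ^b`. -/
def halfH (H : ClosedThreeForm n M) (k : ℤ) (i : LocalChart n r E) (ν : Fin n) (y : M) :
    GAlg n r k :=
  (1 / 2 : ℝ) • ∑ a, ∑ b, H.comp i.chart ν a b y • (gen k (.psi a) * gen k (.psi b))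

variable (H : ClosedThreeForm n M) (i : LocalChart n r E) {x : M}

theorem homologicalGen_b (ν : Fin n) (y : M) :
    homologicalGen H k i y (.b ν) = gen k (.p ν) + halfH H k i ν y := rfl

theorem smoothGr_halfH (hx : x ∈ i.dom) (ν : Fin n) : SmoothGr (halfH H k i ν) x :=
  (SmoothGr.sum fun a _ => SmoothGr.sum fun b _ =>
    SmoothGr.smul_const (smoothNear_comp H i.chart_mem hx.1 ν a b) _).const_smul _

theorem smoothGr_homologicalGen (hx : x ∈ i.dom) (g : Gen n r) :
    SmoothGr (fun y => homologicalGen H k i y g) x := by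
  cases g with
  | psi μ => exact SmoothGr.const 0
  | b ν => exact (SmoothGr.const _).add (smoothGr_halfH H i hx ν)
  | s α => exact SmoothGr.const 0
  | p κ =>
    exact ((SmoothGr.sum fun μ _ => SmoothGr.sum fun ν _ => SmoothGr.sum fun ρ _ =>
      SmoothGr.smul_const ((smoothNear_comp H i.chart_mem hx.1 μ ν ρ).partialDeriv i.chart_mem
        hx.1 κ) _).const_smul _).neg

/-- By `dH = 0` the cubic term can be rewritten with the derivative index moved onto `ψ`, and `3 ·
1/6 = 1/2`. In this form the coefficient is `-d(½ H_{κab} ψ^a ψ^b)`, the one that makes `d_𝓜² b_κ =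
0`. -/
theorem homologicalGen_p (hx : x ∈ i.dom) (κ : Fin n) :
    homologicalGen H k i x (.p κ) = -((1 / 2 : ℝ) • ∑ a, ∑ b,
      (∑ l, partialDeriv i.chart l (H.comp i.chart κ a b) x • gen k (.psi l)) *
        (gen k (.psi a) * gen k (.psi b))) := by
  have h := sum_closed_psi (r := r) (k := k)
    (fun κ μ ν ρ => partialDeriv i.chart κ (H.comp i.chart μ ν ρ) x)
    (closed_comp H i.chart_mem hx.1) κ
  have h' : ∑ a, ∑ b, (∑ l, partialDeriv i.chart l (H.comp i.chart κ a b) x •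
      gen k (.psi l : Gen n r)) * (gen k (.psi a) * gen k (.psi b)) =
      ∑ μ, ∑ ν, ∑ ρ, partialDeriv i.chart μ (H.comp i.chart κ ν ρ) x •
        (gen k (.psi μ : Gen n r) * gen k (.psi ν) * gen k (.psi ρ)) := by
    simp only [Finset.sum_mul, smul_mul_assoc, mul_assoc]
    calc _ = ∑ a, ∑ l, ∑ b, partialDeriv i.chart l (H.comp i.chart κ a b) x •
          (gen k (.psi l : Gen n r) * (gen k (.psi a) * gen k (.psi b))) :=
          Finset.sum_congr rfl fun _ _ => Finset.sum_comm
      _ = _ := Finset.sum_comm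
  rw [h']
  simp only [homologicalGen]
  rw [h, smul_smul]
  norm_num

variable {v : FieldCoeff n r k M}

/-- The field `v` is a lift of the homological vector field in the chart `i`. -/
structure IsLift (H : ClosedThreeForm n M) (i : LocalChart n r E) (v : FieldCoeff n r k M) :
    Prop where
  base : ∀ y (g : Gen n r), g.IsBase → v.toFun y g = homologicalGen H k i y g
  smooth : ∀ x ∈ i.dom, ∀ g, SmoothGr (fun y => v.toFun y g) x

variable {H i} (hv : IsLift H i v) (hx : x ∈ i.dom)
include hv

namespace IsLift

theorem at'_psi (y : M) (μ : Fin n) : v.at' y (gen k (.psi μ)) = 0 := by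
  rw [FieldCoeff.at', der_gen, hv.base y (.psi μ) trivial]
  rfl

theorem at'_psi_mul (y : M) (μ : Fin n) (a : GAlg n r k) :
    v.at' y (gen k (.psi μ) * a) = -(gen k (.psi μ) * v.at' y a) := by
  rw [FieldCoeff.at', der_gen_mul, hv.base y (.psi μ) trivial]
  simp [homologicalGen, Gen.deg]

theorem at'_psi_psi (y : M) (μ ν : Fin n) :
    v.at' y (gen k (.psi μ) * gen k (.psi ν)) = 0 := by
  rw [hv.at'_psi_mul, hv.at'_psi, mul_zero, neg_zero]

include hx

theorem app_fun_psi_psi {g : M → ℝ} (hg : SmoothNear n g x) (a b : Fin n) :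
    v.app i.chart (fun y => g y • (gen k (.psi a) * gen k (.psi b))) x =
      (∑ μ, partialDeriv i.chart μ g x • gen k (.psi μ)) *
        (gen k (.psi a) * gen k (.psi b)) := by
  rw [FieldCoeff.app_fun i.chart_mem hx.1 hg, hv.at'_psi_psi, smul_zero, add_zero]

theorem app_halfH (ν : Fin n) :
    v.app i.chart (halfH H k i ν) x = -homologicalGen H k i x (.p ν) := by
  have hs := fun a b => smoothNear_comp H i.chart_mem hx.1 ν a b
  have h1 : ∀ a b : Fin n, SmoothGr (fun y => H.comp i.chart ν a b y •
    (gen k (.psi a : Gen n r) * gen k (.psi b))) x := fun a b => SmoothGr.smul_const (hs a b) _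
  unfold halfH
  rw [FieldCoeff.app_const_smul i.chart_mem hx.1 _ (SmoothGr.sum fun a _ => SmoothGr.sum fun b _ =>
    h1 a b), FieldCoeff.app_sum i.chart_mem hx.1 fun a _ => SmoothGr.sum fun b _ => h1 a b]
  simp only [FieldCoeff.app_sum i.chart_mem hx.1 fun b _ => h1 _ b, hv.app_fun_psi_psi hx (hs _ _),
    homologicalGen_p H i hx, neg_neg]

/-- Mixed partial derivatives are symmetric while `ψ^μ ψ^ν` is antisymmetric. -/
theorem app_app_fun {g : M → ℝ} (hg : SmoothNear n g x) :
    v.app i.chart (v.app i.chart fun y => g y • 1) x = 0 := by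
  have e : v.app i.chart (fun y => g y • 1) =ᶠ[𝓝 x]
      fun y => ∑ μ, partialDeriv i.chart μ g y • gen k (.psi μ) := by
    filter_upwards [hg.eventually, i.dom_mem_nhds hx] with y hy hyi
    rw [FieldCoeff.app_fun i.chart_mem hyi.1 hy]
    simp [FieldCoeff.at', der_one]
  have hs := fun μ => hg.partialDeriv i.chart_mem hx.1 μ
  rw [FieldCoeff.app_congr hx.1 e, FieldCoeff.app_sum i.chart_mem hx.1
    fun μ _ => SmoothGr.smul_const (hs μ) _]
  simp only [FieldCoeff.app_fun i.chart_mem hx.1 (hs _), hv.at'_psi, smul_zero, add_zero,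
    Finset.sum_mul, smul_mul_assoc]
  rw [Finset.sum_comm]
  exact sum_symm_psi_psi _ fun μ ν => partialDeriv_comm hg i.chart_mem hx.1 μ ν

theorem app_b_eventuallyEq (ν : Fin n) : v.app i.chart (fun _ => gen k (.b ν)) =ᶠ[𝓝 x]
    fun y => gen k (.p ν) + halfH H k i ν y := by
  filter_upwards [i.dom_mem_nhds hx] with y hy
  rw [FieldCoeff.app_const_gen i.chart_mem hy.1, hv.base y (.b ν) trivial, homologicalGen_b]

theorem app_app_b (ν : Fin n) : v.app i.chart (v.app i.chart fun _ => gen k (.b ν)) x = 0 := by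
  rw [FieldCoeff.app_congr hx.1 (hv.app_b_eventuallyEq hx ν),
    FieldCoeff.app_add i.chart_mem hx.1 (SmoothGr.const _) (smoothGr_halfH H i hx ν),
    FieldCoeff.app_const_gen i.chart_mem hx.1, hv.base x (.p ν) trivial, hv.app_halfH hx,
    add_neg_cancel]

/-- The square is a derivation that kills functions on `M`, hence is linear over them. -/
theorem app_app_fun_smul {g : M → ℝ} (hg : SmoothNear n g x) (a : GAlg n r k) :
    v.app i.chart (v.app i.chart fun y => g y • a) x =
      g x • v.app i.chart (v.app i.chart fun _ => a) x := by
  have e : (fun y => g y • a) = fun y => (g y • (1 : GAlg n r k)) * a := by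
    funext y; rw [smul_mul_assoc, one_mul]
  rw [e, FieldCoeff.app_app_mul i.chart_mem hx.1 (j := 0) (hv.smooth x hx)
    (SmoothGr.smul_const hg 1) (SmoothGr.const a)
    (Filter.Eventually.of_forall fun y => Submodule.smul_mem _ _ one_mem_homog),
    hv.app_app_fun hx hg, zero_mul, zero_add, smul_mul_assoc, one_mul]

theorem app_app_sum {ι : Type*} {s : Finset ι} {F : ι → M → GAlg n r k}
    (hF : ∀ m ∈ s, SmoothGr (F m) x) :
    v.app i.chart (v.app i.chart fun y => ∑ m ∈ s, F m y) x =
      ∑ m ∈ s, v.app i.chart (v.app i.chart (F m)) x := by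
  have e : v.app i.chart (fun y => ∑ m ∈ s, F m y) =ᶠ[𝓝 x]
      fun y => ∑ m ∈ s, v.app i.chart (F m) y := by
    filter_upwards [(Filter.eventually_all_finset s).2 fun m hm => (hF m hm).eventually,
      i.dom_mem_nhds hx] with y hy hyi
    exact FieldCoeff.app_sum i.chart_mem hyi.1 hy
  rw [FieldCoeff.app_congr hx.1 e, FieldCoeff.app_sum i.chart_mem hx.1 fun m hm =>
    FieldCoeff.smoothGr_app i.chart_mem hx.1 (hv.smooth x hx) (hF m hm)]

theorem app_app_psi_psi (a b : Fin n) :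
    v.app i.chart (v.app i.chart fun _ => gen k (.psi a) * gen k (.psi b)) x = 0 := by
  have e : v.app i.chart (fun _ => gen k (.psi a) * gen k (.psi b)) =ᶠ[𝓝 x]
      fun _ => 0 := by
    filter_upwards [i.dom_mem_nhds hx] with y hy
    rw [FieldCoeff.app_const i.chart_mem hy.1, hv.at'_psi_psi]
  rw [FieldCoeff.app_congr hx.1 e, FieldCoeff.app_const i.chart_mem hx.1, map_zero]

theorem app_app_halfH (ν : Fin n) :
    v.app i.chart (v.app i.chart (halfH H k i ν)) x = 0 := by
  have hs := fun a b => smoothNear_comp H i.chart_mem hx.1 ν a b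
  have e : halfH H k i ν = fun y => ∑ a, ∑ b, ((1 / 2 : ℝ) * H.comp i.chart ν a b y) •
      (gen k (.psi a : Gen n r) * gen k (.psi b)) := by
    funext y
    simp only [halfH, Finset.smul_sum, smul_smul]
  have h1 : ∀ a b : Fin n, SmoothGr (fun y => ((1 / 2 : ℝ) * H.comp i.chart ν a b y) •
    (gen k (.psi a : Gen n r) * gen k (.psi b))) x :=
    fun a b => SmoothGr.smul_const ((SmoothNear.const _).mul (hs a b)) _
  rw [e, hv.app_app_sum hx fun a _ => SmoothGr.sum fun b _ => h1 a b]
  refine Finset.sum_eq_zero fun a _ => ?_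
  rw [hv.app_app_sum hx fun b _ => h1 a b]
  refine Finset.sum_eq_zero fun b _ => ?_
  rw [hv.app_app_fun_smul hx ((SmoothNear.const _).mul (hs a b)), hv.app_app_psi_psi hx, smul_zero]

/-- Since `v p_ν = -v(½ H_{νab} ψ^a ψ^b)`, it is enough that the square kills functions times
products of the `ψ`. -/
theorem app_app_p (ν : Fin n) : v.app i.chart (v.app i.chart fun _ => gen k (.p ν)) x = 0 := by
  have e : v.app i.chart (fun _ => gen k (.p ν)) =ᶠ[𝓝 x]
      fun y => (-1 : ℝ) • v.app i.chart (halfH H k i ν) y := by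
    filter_upwards [i.dom_mem_nhds hx] with y hy
    rw [FieldCoeff.app_const_gen i.chart_mem hy.1, hv.base y (.p ν) trivial, hv.app_halfH hy]
    simp
  rw [FieldCoeff.app_congr hx.1 e, FieldCoeff.app_const_smul i.chart_mem hx.1 _
    (FieldCoeff.smoothGr_app i.chart_mem hx.1 (hv.smooth x hx) (smoothGr_halfH H i hx ν)),
    hv.app_app_halfH hx, smul_zero]

theorem app_app_psi (ν : Fin n) : v.app i.chart (v.app i.chart fun _ => gen k (.psi ν)) x = 0 := by
  have e : v.app i.chart (fun _ => gen k (.psi ν)) =ᶠ[𝓝 x] fun y => 0 := by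
    filter_upwards [i.dom_mem_nhds hx] with y hy
    rw [FieldCoeff.app_const i.chart_mem hy.1, hv.at'_psi]
  rw [FieldCoeff.app_congr hx.1 e, FieldCoeff.app_const i.chart_mem hx.1, map_zero]

end IsLift

end LocalField

/-! ### Compatibility of lifts with the change of coordinates -/

section Invariance

variable {n r : ℕ} {k : ℤ} {M : Type*} [TopologicalSpace M]
  [ChartedSpace (EuclideanSpace ℝ (Fin n)) M] [IsManifold (𝓡 n) ∞ M]
  {E : M → Type*} [TopologicalSpace (TotalSpace (EuclideanSpace ℝ (Fin r)) E)]
  [∀ x, AddCommGroup (E x)] [∀ x, Module ℝ (E x)] [∀ x, TopologicalSpace (E x)]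
  [FiberBundle (EuclideanSpace ℝ (Fin r)) E]
  {H : ClosedThreeForm n M} {i j : LocalChart n r E} {x : M}

theorem sum_partialDeriv_psi (hi : x ∈ i.dom) (hj : x ∈ j.dom) {g : M → ℝ}
    (hg : SmoothNear n g x) :
    ∑ μ, partialDeriv i.chart μ g x • gen k (.psi μ : Gen n r) =
      i.trans j k x (∑ σ, partialDeriv j.chart σ g x • gen k (.psi σ)) := by
  simp only [map_sum, map_smul, LocalChart.trans_gen, LocalChart.transGen,
    LocalChart.partialDeriv_chain_jac i j hi hj hg, Finset.sum_smul, Finset.smul_sum, smul_smul]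
  rw [Finset.sum_comm]
  exact Finset.sum_congr rfl fun _ _ => Finset.sum_congr rfl fun _ _ => by rw [mul_comm]

theorem trans_halfH (hi : x ∈ i.dom) (hj : x ∈ j.dom) (μ : Fin n) :
    i.trans j k x (halfH H k j μ x) = ∑ ν, j.jac i x ν μ • halfH H k i ν x := by
  -- Expressing `ψ` through the transformed `ψ'` makes both sides sums over the products `ψ'^a
  -- ψ'^b`.
  have hψ : ∀ d, ∑ a, j.jac i x d a • i.transGen j k x (.psi a) = gen k (.psi d : Gen n r) := by
    intro d
    simp only [LocalChart.transGen, Finset.smul_sum, smul_smul]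
    rw [Finset.sum_comm]
    simp only [← Finset.sum_smul, LocalChart.jac_mul_jac_self i j hi hj]
    simp
  have h2 : ∀ c d e, H.comp i.chart c d e x • (gen k (.psi d : Gen n r) * gen k (.psi e)) =
      ∑ a, ∑ b, (H.comp i.chart c d e x * (j.jac i x d a * j.jac i x e b)) •
        (i.transGen j k x (.psi a) * i.transGen j k x (.psi b)) := by
    intro c d e
    rw [← hψ d, ← hψ e, Finset.sum_mul_sum, Finset.smul_sum]
    refine Finset.sum_congr rfl fun a _ => ?_
    rw [Finset.smul_sum]
    exact Finset.sum_congr rfl fun b _ => by rw [smul_mul_smul_comm, smul_smul]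
  simp only [halfH, map_smul, map_sum, map_mul, LocalChart.trans_gen]
  simp only [smul_comm _ (1 / 2 : ℝ), ← Finset.smul_sum (r := (1 / 2 : ℝ))]
  congr 1
  simp only [h2, Finset.smul_sum, smul_smul, comp_eq_sum j i hj hi H, Finset.sum_smul]
  calc _ = ∑ a, ∑ b, ∑ c, ∑ d, ∑ e, (j.jac i x c μ * (H.comp i.chart c d e x *
        (j.jac i x d a * j.jac i x e b))) •
        (i.transGen j k x (.psi a) * i.transGen j k x (.psi b)) := by
        refine Finset.sum_congr rfl fun a _ => Finset.sum_congr rfl fun b _ =>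
          Finset.sum_congr rfl fun c _ => Finset.sum_congr rfl fun d _ =>
          Finset.sum_congr rfl fun e _ => ?_
        congr 1
        ring
    _ = ∑ a, ∑ c, ∑ b, ∑ d, ∑ e, _ := Finset.sum_congr rfl fun a _ => Finset.sum_comm
    _ = ∑ c, ∑ a, ∑ b, ∑ d, ∑ e, _ := Finset.sum_comm
    _ = ∑ c, ∑ d, ∑ e, ∑ a, ∑ b, _ := by
        refine Finset.sum_congr rfl fun c _ => ?_
        calc _ = ∑ a, ∑ d, ∑ b, ∑ e, _ := Finset.sum_congr rfl fun a _ => Finset.sum_comm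
          _ = ∑ d, ∑ a, ∑ b, ∑ e, _ := Finset.sum_comm
          _ = ∑ d, ∑ a, ∑ e, ∑ b, _ := Finset.sum_congr rfl fun d _ =>
              Finset.sum_congr rfl fun a _ => Finset.sum_comm
          _ = _ := Finset.sum_congr rfl fun d _ => Finset.sum_comm

namespace IsLift

variable {v w : FieldCoeff n r k M} (hv : IsLift H i v)
  (hi : x ∈ i.dom) (hj : x ∈ j.dom)
include hv hi hj

/-- The coordinate `ψ'^σ` is `v` applied to the function `x'^σ`, and the square of `v` kills
functions. -/
theorem app_transGen_psi (σ : Fin n) : v.app i.chart (fun y => i.transGen j k y (.psi σ)) x = 0 := by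
  have e : (fun y => i.transGen j k y (.psi σ)) =ᶠ[𝓝 x]
      v.app i.chart (fun y => j.chart y σ • 1) := by
    filter_upwards [i.dom_mem_nhds hi, j.dom_mem_nhds hj] with y hyi hyj
    rw [FieldCoeff.app_fun i.chart_mem hyi.1 (SmoothNear.coord j.chart_mem hyj.1 σ)]
    simp [FieldCoeff.at', der_one, LocalChart.transGen, LocalChart.jac_eq i j hyi hyj]
  rw [FieldCoeff.app_congr hi.1 e, hv.app_app_fun hi (SmoothNear.coord j.chart_mem hj.1 σ)]

variable [VectorBundle ℝ (EuclideanSpace ℝ (Fin r)) E]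
  [ContMDiffVectorBundle ∞ (EuclideanSpace ℝ (Fin r)) E (𝓡 n)]

theorem app_transGen_psi_psi (a b : Fin n) : v.app i.chart
    (fun y => i.transGen j k y (.psi a) * i.transGen j k y (.psi b)) x = 0 := by
  rw [FieldCoeff.app_mul i.chart_mem hi.1 (i.smoothGr_transGen j k hi hj _)
    (i.smoothGr_transGen j k hi hj _) (i.transGen_mem j k x (.psi a)),
    hv.app_transGen_psi hi hj, hv.app_transGen_psi hi hj]
  simp

/-- Differentiating the inverse Jacobian in `b'` produces exactly the inhomogeneous term of `p'`,
and the `H` term is tensorial by `trans_halfH`. -/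
theorem app_transGen_b (μ : Fin n) : v.app i.chart (fun y => i.transGen j k y (.b μ)) x =
    i.trans j k x (homologicalGen H k j x (.b μ)) := by
  have hs := fun ν => LocalChart.smoothNear_jac j i hj hi ν μ
  rw [homologicalGen_b, map_add, trans_halfH hi hj, LocalChart.trans_gen,
    LocalChart.transGen_p i j k hi hj]
  simp only [LocalChart.transGen]
  rw [FieldCoeff.app_sum i.chart_mem hi.1 fun ν _ => SmoothGr.smul_const (hs ν) _]
  simp only [FieldCoeff.app_fun i.chart_mem hi.1 (hs _), FieldCoeff.at', der_gen,
    hv.base x (.b _) trivial, homologicalGen_b, smul_add, Finset.sum_add_distrib, Finset.sum_mul,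
    smul_mul_assoc]
  rw [Finset.sum_comm]
  abel

/-- By `app_transGen_b`, `p'_μ` equals `v b'_μ - ½ H'_{μab} ψ'^a ψ'^b`. The first term is killed by
`v`, because `b'_μ` is a combination of the `b_ν` with functions as coefficients; the second gives
the coefficient of `∂/∂p'_μ` by closedness of `H`. -/
theorem app_transGen_p (μ : Fin n) : v.app i.chart (fun y => i.transGen j k y (.p μ)) x =
    i.trans j k x (homologicalGen H k j x (.p μ)) := by
  have hs := fun ν => LocalChart.smoothNear_jac j i hj hi ν μ
  have hH := fun a b => smoothNear_comp H j.chart_mem hj.1 μ a b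
  have hT := fun g => i.smoothGr_transGen j k hi hj g
  have hb := hT (.b μ)
  have e : (fun y => i.transGen j k y (.p μ)) =ᶠ[𝓝 x] fun y =>
      v.app i.chart (fun y => i.transGen j k y (.b μ)) y + ∑ a, ∑ b,
        (-(1 / 2 : ℝ) * H.comp j.chart μ a b y) •
          (i.transGen j k y (.psi a) * i.transGen j k y (.psi b)) := by
    filter_upwards [i.dom_mem_nhds hi, j.dom_mem_nhds hj] with y hyi hyj
    rw [hv.app_transGen_b hyi hyj, homologicalGen_b, map_add, LocalChart.trans_gen]
    simp only [halfH, map_smul, map_sum, map_mul, LocalChart.trans_gen, mul_smul,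
      Finset.smul_sum, neg_smul, Finset.sum_neg_distrib]
    abel
  have hψ : ∀ a b, SmoothGr (fun y => (-(1 / 2 : ℝ) * H.comp j.chart μ a b y) •
      (i.transGen j k y (.psi a) * i.transGen j k y (.psi b))) x := fun a b =>
    SmoothGr.fun_smul ((SmoothNear.const _).mul (hH a b)) ((hT _).mul (hT _))
  have h0 : v.app i.chart (v.app i.chart (fun y => i.transGen j k y (.b μ))) x = 0 := by
    simp only [LocalChart.transGen]
    rw [hv.app_app_sum hi fun ν _ => SmoothGr.smul_const (hs ν) _]
    refine Finset.sum_eq_zero fun ν _ => ?_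
    rw [hv.app_app_fun_smul hi (hs ν), hv.app_app_b hi, smul_zero]
  have h1 : ∀ a b, v.app i.chart (fun y => (-(1 / 2 : ℝ) * H.comp j.chart μ a b y) •
      (i.transGen j k y (.psi a) * i.transGen j k y (.psi b))) x =
      -((1 / 2 : ℝ) • i.trans j k x ((∑ l, partialDeriv j.chart l (H.comp j.chart μ a b) x •
        gen k (.psi l)) * (gen k (.psi a) * gen k (.psi b)))) := by
    intro a b
    have e : (fun y => (-(1 / 2 : ℝ) * H.comp j.chart μ a b y) •
        (i.transGen j k y (.psi a) * i.transGen j k y (.psi b))) = fun y => (-(1 / 2 : ℝ)) •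
        (H.comp j.chart μ a b y •
        (i.transGen j k y (.psi a) * i.transGen j k y (.psi b))) := by
      funext y; rw [mul_smul]
    rw [e, FieldCoeff.app_const_smul i.chart_mem hi.1 _
      (SmoothGr.fun_smul (hH a b) ((hT _).mul (hT _))),
      FieldCoeff.app_fun_smul i.chart_mem hi.1 (hH a b) ((hT _).mul (hT _)),
      hv.app_transGen_psi_psi hi hj, smul_zero, add_zero, map_mul,
      ← sum_partialDeriv_psi hi hj (hH a b), map_mul, LocalChart.trans_gen, LocalChart.trans_gen,
      neg_smul]
  rw [FieldCoeff.app_congr hi.1 e, FieldCoeff.app_add i.chart_mem hi.1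
    (FieldCoeff.smoothGr_app i.chart_mem hi.1 (hv.smooth x hi) hb)
    (SmoothGr.sum fun a _ => SmoothGr.sum fun b _ => hψ a b), h0, zero_add,
    FieldCoeff.app_sum i.chart_mem hi.1 fun a _ => SmoothGr.sum fun b _ => hψ a b]
  simp only [FieldCoeff.app_sum i.chart_mem hi.1 fun b _ => hψ _ b, h1, homologicalGen_p H j hj,
    map_neg, map_smul, map_sum, Finset.sum_neg_distrib, Finset.smul_sum]

variable (hw : IsLift H j w)
include hw

/-- Two lifts of the homological vector field which are compatible on the fibre coordinates are
compatible on all coordinates. -/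
theorem app_transGen (hs : ∀ α, v.app i.chart (fun y => i.transGen j k y (.s α)) x =
    i.trans j k x (w.toFun x (.s α))) (g : Gen n r) :
    v.app i.chart (fun y => i.transGen j k y g) x = i.trans j k x (w.toFun x g) := by
  cases g with
  | psi σ =>
    rw [hv.app_transGen_psi hi hj, hw.base x (.psi σ) trivial]
    exact (map_zero _).symm
  | b μ => rw [hv.app_transGen_b hi hj, hw.base x (.b μ) trivial]
  | p μ => rw [hv.app_transGen_p hi hj, hw.base x (.p μ) trivial]
  | s α => exact hs α

theorem app_trans_const (hs : ∀ α, v.app i.chart (fun y => i.transGen j k y (.s α)) x =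
    i.trans j k x (w.toFun x (.s α))) (a : GAlg n r k) :
    v.app i.chart (fun y => i.trans j k y a) x = i.trans j k x (w.at' x a) := by
  have hT := fun a => i.smoothGr_trans j k hi hj a
  induction a using GAlg.induction with
  | one =>
    simp only [map_one]
    rw [FieldCoeff.app_const i.chart_mem hi.1]
    simp [FieldCoeff.at', der_one]
  | gen_mul g a ih =>
    simp only [map_mul, LocalChart.trans_gen]
    rw [FieldCoeff.app_mul i.chart_mem hi.1 (i.smoothGr_transGen j k hi hj g) (hT a)
      (i.transGen_mem j k x g), ih, hv.app_transGen hi hj hw hs]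
    simp only [FieldCoeff.at', der_gen_mul, map_add, map_mul, map_smul, LocalChart.trans_gen,
      one_mul]
  | add a b ha hb =>
    simp only [map_add]
    rw [FieldCoeff.app_add i.chart_mem hi.1 (hT a) (hT b), ha, hb]
  | smul t a ha =>
    simp only [map_smul]
    rw [FieldCoeff.app_const_smul i.chart_mem hi.1 t (hT a), ha]

/-- This is what lets local fields glue. Constant polynomials are covered by `app_trans_const`, and
function coefficients only contribute their differential, which is independent of the chart. -/
theorem app_trans (hs : ∀ α, v.app i.chart (fun y => i.transGen j k y (.s α)) x =
    i.trans j k x (w.toFun x (.s α))) {F : M → GAlg n r k} (hF : SmoothGr F x) :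
    v.app i.chart (fun y => i.trans j k y (F y)) x = i.trans j k x (w.app j.chart F x) := by
  obtain ⟨ι, _, g, a, hg, e⟩ := hF
  have hT := fun a => i.smoothGr_trans j k hi hj a
  have e' : (fun y => i.trans j k y (F y)) =ᶠ[𝓝 x] fun y => ∑ m, g m y • i.trans j k y (a m) := by
    filter_upwards [e] with y hy
    simp only [hy, map_sum, map_smul]
  rw [FieldCoeff.app_congr hi.1 e', FieldCoeff.app_congr hj.1 e,
    FieldCoeff.app_sum i.chart_mem hi.1 fun m _ => SmoothGr.fun_smul (hg m) (hT (a m)),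
    FieldCoeff.app_sum j.chart_mem hj.1 fun m _ => SmoothGr.smul_const (hg m) (a m), map_sum]
  refine Finset.sum_congr rfl fun m _ => ?_
  rw [FieldCoeff.app_fun_smul i.chart_mem hi.1 (hg m) (hT (a m)),
    FieldCoeff.app_fun j.chart_mem hj.1 (hg m), hv.app_trans_const hi hj hw hs, map_add, map_mul,
    map_smul, sum_partialDeriv_psi hi hj (hg m)]

end IsLift

end Invariance

/-! ### The local field of `∇ + V` -/

section ConnectionField

variable {n r : ℕ} {k : ℤ} {M : Type*} [TopologicalSpace M]
  [ChartedSpace (EuclideanSpace ℝ (Fin n)) M] [IsManifold (𝓡 n) ∞ M]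
  {E : M → Type*} [TopologicalSpace (TotalSpace (EuclideanSpace ℝ (Fin r)) E)]
  [∀ x, AddCommGroup (E x)] [∀ x, Module ℝ (E x)] [∀ x, TopologicalSpace (E x)]
  [FiberBundle (EuclideanSpace ℝ (Fin r)) E]

/-- `C^α_β = Γ_μ^α_β ψ^μ + V^{μα}_β b_μ` at the point `x`. -/
def connAt (k : ℤ) (i : LocalChart n r E) (Γ : Fin n → Fin r → Fin r → M → ℝ)
    (V : EndSection n r M E) (x : M) (α β : Fin r) : GAlg n r k :=
  connMatrix k (fun μ α β => Γ μ α β x) (fun μ α β => compEnd i μ α β (V.toFun x)) α β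

/-- The coefficients of the vector field `d_𝓜 + C^α_β s_α ∂/∂s_β` in the chart `i`. -/
def connField (H : ClosedThreeForm n M) (k : ℤ) (i : LocalChart n r E)
    (Γ : Fin n → Fin r → Fin r → M → ℝ) (V : EndSection n r M E) : FieldCoeff n r k M where
  toFun x g := homologicalGen H k i x g + match g with
    | .s β => ∑ α, connAt k i Γ V x α β * gen k (.s α)
    | _ => 0
  mem x g := by
    refine add_mem (homologicalGen_mem H k i x g) ?_
    cases g with
    | s β =>
      exact sum_mem fun α _ => mul_mem_homog_of_eq (connMatrix_mem _ _ α β) (s_mem_homog α)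
        (add_comm _ _)
    | _ => exact zero_mem _

variable (H : ClosedThreeForm n M) (i : LocalChart n r E) {Γ : Fin n → Fin r → Fin r → M → ℝ}
  (V : EndSection n r M E) {x : M}

theorem connField_s (y : M) (β : Fin r) : (connField H k i Γ V).toFun y (.s β) =
    ∑ α, connAt k i Γ V y α β * gen k (.s α) := zero_add _

theorem connField_at' (y : M) (a : GAlg n r k) : (connField H k i Γ V).at' y a =
    homologicalField H k i y a + fibreField 1
      (connMatrix k (fun μ α β => Γ μ α β y) (fun μ α β => compEnd i μ α β (V.toFun y)))
      (connMatrix_mem _ _) a := by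
  rw [← LinearMap.add_apply]
  refine ext_of_leibniz id (fun g => (-1 : ℝ) ^ (1 * g.deg k)) _ _ ?_ ?_ ?_ ?_ ?_ a
  · simp [FieldCoeff.at', der_one]
  · simp [homologicalField, fibreField, der_one]
  · intro g a
    simp only [FieldCoeff.at', der_gen_mul, der_gen, id]
  · intro g a
    simp only [homologicalField, fibreField, LinearMap.add_apply, der_gen_mul, der_gen, id,
      add_mul, mul_add, smul_add]
    abel
  · intro g
    simp only [FieldCoeff.at', homologicalField, fibreField, LinearMap.add_apply, der_gen]
    rfl

theorem smoothGr_connAt (hΓ : ∀ μ α β, ContMDiffOn (𝓡 n) 𝓘(ℝ, ℝ) ∞ (Γ μ α β) i.dom)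
    (hx : x ∈ i.dom) (α β : Fin r) : SmoothGr (fun y => connAt k i Γ V y α β) x := by
  unfold connAt connMatrix
  exact SmoothGr.sum fun μ _ =>
    (SmoothGr.smul_const (SmoothNear.of_contMDiffOn i.isOpen_dom (hΓ μ α β) hx) _).add
    (SmoothGr.smul_const (SmoothNear.of_contMDiffOn i.isOpen_dom (V.smooth i μ α β) hx) _)

theorem isLift_connField (hΓ : ∀ μ α β, ContMDiffOn (𝓡 n) 𝓘(ℝ, ℝ) ∞ (Γ μ α β) i.dom) :
    IsLift H i (connField H k i Γ V) where
  base y g hg := by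
    cases g with
    | s β => exact hg.elim
    | _ => exact add_zero _
  smooth x hx g := by
    refine (smoothGr_homologicalGen H i hx g).add ?_
    cases g with
    | s β =>
      exact SmoothGr.sum fun α _ => (smoothGr_connAt i V hΓ hx α β).mul (SmoothGr.const _)
    | _ => exact SmoothGr.const 0

variable [VectorBundle ℝ (EuclideanSpace ℝ (Fin r)) E]
  [ContMDiffVectorBundle ∞ (EuclideanSpace ℝ (Fin r)) E (𝓡 n)]
  [T2Space M] {N : Connection n r M E}

theorem sum_comm_reverse {ι κ ν A : Type*} [Fintype ι] [Fintype κ] [Fintype ν] [AddCommMonoid A]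
    (f : ι → κ → ν → A) : ∑ a, ∑ b, ∑ c, f a b c = ∑ c, ∑ b, ∑ a, f a b c :=
  calc _ = ∑ b, ∑ a, ∑ c, f a b c := Finset.sum_comm
    _ = ∑ b, ∑ c, ∑ a, f a b c := Finset.sum_congr rfl fun _ _ => Finset.sum_comm
    _ = _ := Finset.sum_comm

/-- The differentials of the components together with the `Γ ψ` term are the local formula for `∇
σ`, and the `V b` term is `V σ`. -/
theorem app_section (hΓ : IsConnCoeff N i Γ) (hx : x ∈ i.dom)
    (σ : Cₛ^∞⟮𝓡 n; EuclideanSpace ℝ (Fin r), E⟯) :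
    (connField H k i Γ V).app i.chart (fun y => ∑ α, i.coeff α (σ y) • gen k (.s α)) x =
      tensorToFun i k (sumAt N V σ x) := by
  have hs := fun α => i.smoothNear_section σ hx α
  rw [FieldCoeff.app_sum i.chart_mem hx.1 fun α _ => SmoothGr.smul_const (hs α) _]
  simp only [FieldCoeff.app_fun i.chart_mem hx.1 (hs _), FieldCoeff.at', der_gen, connField_s,
    tensorToFun, compForm_sumAt N V i hx, compVec_sumAt N V i hx, hΓ.2 σ x hx, connAt, connMatrix,
    add_smul, Finset.sum_smul, Finset.sum_add_distrib, Finset.sum_mul, Finset.smul_sum, add_mul,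
    smul_mul_assoc, smul_add, smul_smul]
  rw [sum_comm_reverse fun α γ μ => (i.coeff α (σ x) * Γ μ γ α x) •
    (gen k (.psi μ : Gen n r) * gen k (.s γ)), sum_comm_reverse fun α γ μ =>
    (i.coeff α (σ x) * compEnd i μ γ α (V.toFun x)) • (gen k (.b μ : Gen n r) * gen k (.s γ)),
    Finset.sum_comm, add_assoc]
  simp only [mul_comm (i.coeff _ (σ x))]

/-- Near the point, `s'_α` is the linear function of a cut off frame section of `j`. Both sides are
therefore one tensor, the value of `∇ + V` on that section, and `trans_tensorToFun` compares its
expressions in the two charts. -/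
theorem app_transGen_s {j : LocalChart n r E} {Γ' : Fin n → Fin r → Fin r → M → ℝ}
    (hΓ : IsConnCoeff N i Γ) (hΓ' : IsConnCoeff N j Γ') (hi : x ∈ i.dom) (hj : x ∈ j.dom)
    (α : Fin r) :
    (connField H k i Γ V).app i.chart (fun y => i.transGen j k y (.s α)) x =
      i.trans j k x ((connField H k j Γ' V).toFun x (.s α)) := by
  obtain ⟨χ, h1, hχ⟩ := exists_bump (n := n) (j.dom_mem_nhds hj)
  have e : (fun y => i.transGen j k y (.s α)) =ᶠ[𝓝 x]
      fun y => ∑ β, i.coeff β (frameSection j χ hχ α y) • gen k (.s β : Gen n r) := by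
    filter_upwards [h1] with y hy
    simp only [frameSection_apply, hy, one_smul]
    rfl
  have e' : (fun _ => gen k (.s α : Gen n r)) =ᶠ[𝓝 x]
      fun y => ∑ β, j.coeff β (frameSection j χ hχ α y) • gen k (.s β : Gen n r) := by
    filter_upwards [h1, j.dom_mem_nhds hj] with y hy hyj
    simp only [frameSection_apply, hy, one_smul, j.coeff_frame hyj]
    simp
  rw [← FieldCoeff.app_const_gen (v := connField H k j Γ' V) j.chart_mem hj.1,
    FieldCoeff.app_congr hi.1 e, FieldCoeff.app_congr hj.1 e', app_section H i V hΓ hi,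
    app_section H j V hΓ' hj, trans_tensorToFun i j hi hj]

end ConnectionField

/-! ### Gluing compatible local fields to a global vector field -/

section Gluing

variable {n r : ℕ} {k : ℤ} {M : Type*} [TopologicalSpace M]
  [ChartedSpace (EuclideanSpace ℝ (Fin n)) M] [IsManifold (𝓡 n) ∞ M]
  {E : M → Type*} [TopologicalSpace (TotalSpace (EuclideanSpace ℝ (Fin r)) E)]
  [∀ x, AddCommGroup (E x)] [∀ x, Module ℝ (E x)] [∀ x, TopologicalSpace (E x)]
  [FiberBundle (EuclideanSpace ℝ (Fin r)) E] [VectorBundle ℝ (EuclideanSpace ℝ (Fin r)) E]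
  [ContMDiffVectorBundle ∞ (EuclideanSpace ℝ (Fin r)) E (𝓡 n)]

theorem extZero_add (i : LocalChart n r E) (f g : i.dom → GAlg n r k) :
    extZero i (f + g) = fun y => extZero i f y + extZero i g y := by
  funext y
  by_cases hy : y ∈ i.dom
  · simp only [extZero_of_mem i _ hy, Pi.add_apply]
  · simp only [extZero, dif_neg hy, add_zero]

theorem extZero_mul (i : LocalChart n r E) (f g : i.dom → GAlg n r k) :
    extZero i (f * g) = fun y => extZero i f y * extZero i g y := by
  funext y
  by_cases hy : y ∈ i.dom
  · simp only [extZero_of_mem i _ hy, Pi.mul_apply]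
  · simp only [extZero, dif_neg hy, mul_zero]

theorem extZero_smul (i : LocalChart n r E) (t : ℝ) (f : i.dom → GAlg n r k) :
    extZero i (t • f) = fun y => t • extZero i f y := by
  funext y
  by_cases hy : y ∈ i.dom
  · simp only [extZero_of_mem i _ hy, Pi.smul_apply]
  · simp only [extZero, dif_neg hy, smul_zero]

/-- The action of a family of local vector fields on a family of local functions. -/
def localApp (X : LocalChart n r E → FieldCoeff n r k M) (f : LocalFamily n r E k) :
    LocalFamily n r E k :=
  fun i x => (X i).app i.chart (extZero i (f i)) x

/-- A family of local vector fields is compatible with the coordinate transformations. -/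
structure IsCompatible (X : LocalChart n r E → FieldCoeff n r k M) : Prop where
  smooth : ∀ (i : LocalChart n r E), ∀ x ∈ i.dom, ∀ g, SmoothGr (fun y => (X i).toFun y g) x
  app_trans : ∀ (i j : LocalChart n r E) (x : M), x ∈ i.dom → x ∈ j.dom →
    ∀ F : M → GAlg n r k, SmoothGr F x →
    (X i).app i.chart (fun y => i.trans j k y (F y)) x = i.trans j k x ((X j).app j.chart F x)

variable {X : LocalChart n r E → FieldCoeff n r k M}

namespace IsCompatible

variable (hX : IsCompatible X)
include hX

theorem localApp_mem_funDeg {j : ℤ} {f : LocalFamily n r E k} (hf : f ∈ funDeg n r E k j) :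
    localApp X f ∈ funDeg n r E k (j + 1) := by
  have hs : ∀ (i : LocalChart n r E), ∀ x ∈ i.dom, SmoothGr (extZero i (f i)) x :=
    fun i x hx => smoothGr_of_isSmooth (hf.1 i) hx
  refine ⟨fun i => isSmooth_of_smoothGr fun x hx => ?_, fun i i' x hx hx' => ?_, fun i x => ?_⟩
  · exact (FieldCoeff.smoothGr_app i.chart_mem hx.1 (hX.smooth i x hx) (hs i x hx)).congr
      (extZero_eventuallyEq hx (Filter.Eventually.of_forall fun _ _ => rfl))
  · have e : extZero i (f i) =ᶠ[𝓝 x] fun y => i.trans i' k y (extZero i' (f i') y) := by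
      filter_upwards [i.dom_mem_nhds hx, i'.dom_mem_nhds hx'] with y hy hy'
      rw [extZero_of_mem i _ hy, extZero_of_mem i' _ hy', hf.2.1 i i' y hy hy']
    change (X i).app i.chart (extZero i (f i)) x = _
    rw [FieldCoeff.app_congr hx.1 e, hX.app_trans i i' x hx hx' _ (hs i' x hx')]
    rfl
  · refine FieldCoeff.app_mem_homog i.chart_mem x.2.1 (hs i x x.2) ?_
    filter_upwards [i.dom_mem_nhds x.2] with y hy
    rw [extZero_of_mem i _ hy]
    exact hf.2.2 i ⟨y, hy⟩

omit hX in
theorem localApp_add {f g : LocalFamily n r E k}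
    (hf : ∀ (i : LocalChart n r E), ∀ x ∈ i.dom, SmoothGr (extZero i (f i)) x)
    (hg : ∀ (i : LocalChart n r E), ∀ x ∈ i.dom, SmoothGr (extZero i (g i)) x) :
    localApp X (f + g) = localApp X f + localApp X g := by
  funext i x
  change (X i).app i.chart (extZero i (f i + g i)) x = _
  rw [extZero_add, FieldCoeff.app_add i.chart_mem x.2.1 (hf i x x.2) (hg i x x.2)]
  rfl

theorem localApp_mem (f : globalFun n r E k) : localApp X f.1 ∈ globalFun n r E k := by
  -- Smoothness is carried through the induction because additivity of `localApp` requires it.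
  refine (Submodule.iSup_induction (fun j => funDeg n r E k j)
    (motive := fun f => (∀ (i : LocalChart n r E), ∀ x ∈ i.dom, SmoothGr (extZero i (f i)) x) ∧
      localApp X f ∈ globalFun n r E k) f.2 ?_ ?_ ?_).2
  · exact fun j f hf => ⟨fun i x hx => smoothGr_of_isSmooth (hf.1 i) hx,
      Submodule.mem_iSup_of_mem _ (hX.localApp_mem_funDeg hf)⟩
  · have h0 : (0 : LocalFamily n r E k) ∈ funDeg n r E k 0 := zero_mem _
    exact ⟨fun i x hx => smoothGr_of_isSmooth (h0.1 i) hx,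
      Submodule.mem_iSup_of_mem _ (hX.localApp_mem_funDeg h0)⟩
  · rintro f g ⟨hf, hf'⟩ ⟨hg, hg'⟩
    refine ⟨fun i x hx => ?_, ?_⟩
    · rw [Pi.add_apply, extZero_add]
      exact (hf i x hx).add (hg i x hx)
    · rw [localApp_add hf hg]
      exact add_mem hf' hg'

/-- The global vector field given by compatible local ones. -/
def vectorField : VectorField n r E k 1 where
  toFun :=
    { toFun := fun f => ⟨localApp X f.1, hX.localApp_mem f⟩
      map_add' := fun f g => Subtype.ext (localApp_add (fun i _ hx => smoothGr_globalFun f i hx)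
        fun i _ hx => smoothGr_globalFun g i hx)
      map_smul' := fun t f => by
        apply Subtype.ext
        funext i x
        change (X i).app i.chart (extZero i (t • f.1 i)) x = _
        rw [extZero_smul, FieldCoeff.app_const_smul i.chart_mem x.2.1 t
          (smoothGr_globalFun f i x.2)]
        rfl }
  degree j f hf := hX.localApp_mem_funDeg hf
  leibniz j f g hf := by
    apply Subtype.ext
    funext i x
    have hx := extZero_of_mem i (f.1 i) x.2
    have hx' := extZero_of_mem i (g.1 i) x.2
    change (X i).app i.chart (extZero i (f.1 i * g.1 i)) x = (X i).app i.chart (extZero i (f.1 i)) x *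
      g.1 i x + (-1 : ℝ) ^ (1 * j) • (f.1 i x * (X i).app i.chart (extZero i (g.1 i)) x)
    rw [extZero_mul, FieldCoeff.app_mul i.chart_mem x.2.1 (j := j) (smoothGr_globalFun f i x.2)
      (smoothGr_globalFun g i x.2) (by rw [hx]; exact hf.2.2 i x), hx, hx', one_mul]

end IsCompatible

end Gluing

/-! ### The bijection between `Q`-connections and generalized connections -/

section QConnections

variable {n r : ℕ} {k : ℤ} {M : Type*} [TopologicalSpace M]
  [ChartedSpace (EuclideanSpace ℝ (Fin n)) M] [IsManifold (𝓡 n) ∞ M]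
  {E : M → Type*} [TopologicalSpace (TotalSpace (EuclideanSpace ℝ (Fin r)) E)]
  [∀ x, AddCommGroup (E x)] [∀ x, Module ℝ (E x)] [∀ x, TopologicalSpace (E x)]
  [FiberBundle (EuclideanSpace ℝ (Fin r)) E] [VectorBundle ℝ (EuclideanSpace ℝ (Fin r)) E]
  [ContMDiffVectorBundle ∞ (EuclideanSpace ℝ (Fin r)) E (𝓡 n)]

theorem homologicalGen_mem_basePart (H : ClosedThreeForm n M) (i : LocalChart n r E) (x : M)
    (g : Gen n r) : homologicalGen H k i x g ∈ basePart n r k := by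
  have hψ : ∀ l : Fin n, gen k (.psi l : Gen n r) ∈ basePart n r k :=
    fun l => gen_mem_basePart trivial
  cases g with
  | psi μ => exact zero_mem _
  | s α => exact zero_mem _
  | b μ =>
    exact add_mem (gen_mem_basePart trivial) (Subalgebra.smul_mem _ (sum_mem fun _ _ =>
      sum_mem fun _ _ => Subalgebra.smul_mem _ (mul_mem (hψ _) (hψ _)) _) _)
  | p κ =>
    exact neg_mem (Subalgebra.smul_mem _ (sum_mem fun _ _ => sum_mem fun _ _ => sum_mem fun _ _ =>
      Subalgebra.smul_mem _ (mul_mem (mul_mem (hψ _) (hψ _)) (hψ _)) _) _)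

theorem connAt_mem_basePart (i : LocalChart n r E) (Γ : Fin n → Fin r → Fin r → M → ℝ)
    (V : EndSection n r M E) (x : M) (α β : Fin r) : connAt k i Γ V x α β ∈ basePart n r k := by
  unfold connAt connMatrix
  exact sum_mem fun μ _ => add_mem
    (Subalgebra.smul_mem _ (gen_mem_basePart (g := .psi μ) trivial) _)
    (Subalgebra.smul_mem _ (gen_mem_basePart (g := .b μ) trivial) _)

theorem linSection_apply (σ : Cₛ^∞⟮𝓡 n; EuclideanSpace ℝ (Fin r), E⟯) (i : LocalChart n r E)
    (x : i.dom) : (linSection k σ).1 i x = ∑ α, i.coeff α (σ x) • gen k (.s α) := rfl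

theorem linSection_mem_funDeg (σ : Cₛ^∞⟮𝓡 n; EuclideanSpace ℝ (Fin r), E⟯) :
    (linSection k σ).1 ∈ funDeg n r E k (-k) := by
  refine ⟨fun i => isSmooth_of_smoothGr fun x hx => ?_, fun i i' x hx hx' =>
    globalFun_compat _ i i' hx hx', fun i x => ?_⟩
  rotate_left
  · rw [linSection_apply]
    exact sum_mem fun α _ => Submodule.smul_mem _ _ (s_mem_homog α)
  exact (SmoothGr.sum fun α _ => SmoothGr.smul_const (i.smoothNear_section σ hx α) _).congr
    (extZero_eventuallyEq (F := fun y => ∑ α, i.coeff α (σ y) • gen k (.s α)) hx (Filter.Eventually.of_forall fun _ _ => rfl))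

theorem isLinFun_linSection (σ : Cₛ^∞⟮𝓡 n; EuclideanSpace ℝ (Fin r), E⟯) :
    IsLinFun (linSection k σ) := fun i x => by
  rw [linSection_apply]
  exact sum_mem fun α _ => Submodule.smul_mem _ _ (s_mem_linPart α)

theorem extZero_linSection (σ : Cₛ^∞⟮𝓡 n; EuclideanSpace ℝ (Fin r), E⟯) (i : LocalChart n r E)
    {x : M} (hx : x ∈ i.dom) : extZero i ((linSection k σ).1 i) =ᶠ[𝓝 x]
      fun y => ∑ α, i.coeff α (σ y) • gen k (.s α : Gen n r) :=
  extZero_eventuallyEq hx (Filter.Eventually.of_forall fun _ _ => rfl)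

theorem fnGlob_mul_linSection (f : C^∞⟮𝓡 n, M; ℝ⟯)
    (σ : Cₛ^∞⟮𝓡 n; EuclideanSpace ℝ (Fin r), E⟯) :
    linSection k (smulSection f σ) = fnGlob r k E f * linSection k σ := by
  apply Subtype.ext
  funext i x
  change ∑ α, i.coeff α (f x • σ x) • gen k (.s α) =
    (f x • (1 : GAlg n r k)) * ∑ α, i.coeff α (σ x) • gen k (.s α)
  simp only [i.coeff_smul x.2, smul_mul_assoc, one_mul, Finset.smul_sum, mul_smul]

theorem QConnection.ext_toFun {H : ClosedThreeForm n M} {Q Q' : QConnection r E H k}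
    (h : ∀ f i x, (Q.toFun f).1 i x = (Q'.toFun f).1 i x) : Q = Q' := by
  have h' : Q.toFun = Q'.toFun := LinearMap.ext fun f => Subtype.ext (funext fun i =>
    funext fun x => h f i x)
  obtain ⟨⟨q, _, _⟩, _, _⟩ := Q
  obtain ⟨⟨q', _, _⟩, _, _⟩ := Q'
  obtain rfl : q = q' := h'
  rfl

theorem QConnection.apply_fnGlob {H : ClosedThreeForm n M} (Q : QConnection r E H k)
    (g : C^∞⟮𝓡 n, M; ℝ⟯) (i : LocalChart n r E) (x : i.dom) :
    (Q.toFun (fnGlob r k E g)).1 i x =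
      ∑ μ, partialDeriv i.chart μ g x • gen k (.psi μ) := by
  have h := ((Q.projects _ (isBaseFun_fnGlob g)).2 i x)
  rw [isFieldAt_iff (smoothGr_globalFun _ i x.2)] at h
  have e : extZero i ((fnGlob r k E g).1 i) =ᶠ[𝓝 (x : M)] fun y => g y • 1 :=
    extZero_eventuallyEq x.2 (Filter.Eventually.of_forall fun _ _ => rfl)
  have h1 : homologicalField H k i x ((fnGlob r k E g).1 i x) = 0 := by
    change homologicalField H k i x (g x • 1) = 0
    rw [map_smul, homologicalField, der_one, smul_zero]
  rw [h, h1, add_zero]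
  simp only [pd_congr x.2.1 e, pd_smul_const i.chart_mem x.2.1 (SmoothNear.of_contMDiff g _),
    mul_smul_comm, mul_one]

theorem extZero_genGlob (i : LocalChart n r E) {χ : C^∞⟮𝓡 n, M; ℝ⟯} (hχ : tsupport χ ⊆ i.dom)
    {x : M} (hx : x ∈ i.dom) (h1 : ∀ᶠ y in 𝓝 x, χ y = 1) (g : Gen n r) :
    extZero i ((genGlob i hχ k g).1 i) =ᶠ[𝓝 x] fun _ => gen k g :=
  extZero_eventuallyEq hx (by
    filter_upwards [h1] with y hy hyi
    exact genFamily_apply i hyi hy g)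

variable [T2Space M]

/-- The values of a `Q`-connection on the sections of `E` determine it. -/
theorem QConnection.apply_eq_app {H : ClosedThreeForm n M} (Q : QConnection r E H k)
    (N : Connection n r M E) (V : EndSection n r M E)
    (hQ : ∀ σ (i : LocalChart n r E) (x : i.dom),
      (Q.toFun (linSection k σ)).1 i x = tensorToFun i k (sumAt N V σ x))
    {i : LocalChart n r E} {Γ : Fin n → Fin r → Fin r → M → ℝ} (hΓ : IsConnCoeff N i Γ)
    (f : globalFun n r E k) (x : i.dom) :
    (Q.toFun f).1 i x = (connField H k i Γ V).app i.chart (extZero i (f.1 i)) x := by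
  have hl := isLift_connField (k := k) H i V hΓ.1
  obtain ⟨χ, h1, hχ⟩ := exists_bump (n := n) (i.dom_mem_nhds x.2)
  have hgen : ∀ g, (Q.toFun (genGlob i hχ k g)).1 i x = (connField H k i Γ V).toFun x g := by
    intro g
    have e := extZero_genGlob (k := k) i hχ x.2 h1 g
    -- Base coordinates are governed by the projection to `d_𝓜`. A fibre coordinate agrees near `x`
    -- with the linear function of a cut off frame section, where the value is prescribed by `hQ`.
    by_cases hg : g.IsBase
    · have hb : IsBaseFun (genGlob i hχ k g) := by
        intro j y
        change genFamily i χ k g j y ∈ _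
        simp only [genFamily]
        split_ifs
        · exact Subalgebra.smul_mem _ (j.transGen_mem_basePart i k hg) _
        · exact zero_mem _
      have h := (Q.projects _ hb).2 i x
      rw [isFieldAt_iff (smoothGr_globalFun _ i x.2)] at h
      have hx : (genGlob i hχ k g).1 i x = gen k g := genFamily_apply i x.2 h1.self_of_nhds g
      rw [h, hx, homologicalField, der_gen, hl.base x g hg]
      simp [pd_congr x.2.1 e, pd_const i.chart_mem x.2.1]
    · cases g with
      | s β =>
        have e' : (fun _ => gen k (.s β : Gen n r)) =ᶠ[𝓝 (x : M)]
            fun y => ∑ α, i.coeff α (frameSection i χ hχ β y) • gen k (.s α) := by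
          filter_upwards [h1, i.dom_mem_nhds x.2] with y hy hyi
          simp only [coeff_frameSection i χ hχ β _ hyi, hy]
          simp
        rw [Q.apply_congr i x.2 _ (linSection k (frameSection i χ hχ β))
          ((e.trans e').trans (extZero_linSection _ i x.2).symm), hQ _ i x,
          ← app_section H i V hΓ x.2, ← FieldCoeff.app_congr x.2.1 e',
          FieldCoeff.app_const_gen i.chart_mem x.2.1]
      | _ => exact (hg trivial).elim
  rw [FieldCoeff.app, extZero_of_mem i _ x.2]
  exact Q.apply_eq i hχ x.2 h1 (fun μ => gen k (.psi μ)) (fun g => Q.apply_fnGlob g i x)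
    ((connField H k i Γ V).mem x) hgen f

/-- The `Q`-connection of `D = ∇ + V`. -/
theorem exists_qConnection (H : ClosedThreeForm n M) (k : ℤ) (N : Connection n r M E)
    (V : EndSection n r M E) : ∃ Q : QConnection r E H k, ∀ σ (i : LocalChart n r E) (x : i.dom),
      (Q.toFun (linSection k σ)).1 i x = tensorToFun i k (sumAt N V σ x) := by
  choose Γ hΓ using fun i : LocalChart n r E => exists_isConnCoeff N i
  let X : LocalChart n r E → FieldCoeff n r k M := fun i => connField H k i (Γ i) V
  have hl : ∀ i, IsLift H i (X i) := fun i => isLift_connField H i V (hΓ i).1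
  have hX : IsCompatible X :=
    { smooth := fun i => (hl i).smooth
      app_trans := fun i j x hi hj F hF => (hl i).app_trans hi hj (hl j)
        (app_transGen_s H i V (hΓ i) (hΓ j) hi hj) hF }
  refine ⟨{ hX.vectorField with preserves_lin := ?_, projects := ?_ }, fun σ i x => ?_⟩
  · intro f hf i x
    change (X i).app i.chart (extZero i (f.1 i)) x ∈ _
    have hW : ∀ᶠ y in 𝓝 (x : M), extZero i (f.1 i) y ∈ linPart n r k := by
      filter_upwards [i.dom_mem_nhds x.2] with y hy
      rw [extZero_of_mem i _ hy]
      exact hf i ⟨y, hy⟩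
    refine add_mem (sum_mem fun μ _ => base_mul_mem_linPart (gen_mem_basePart trivial)
      (pd_mem i.chart_mem x.2.1 (smoothGr_globalFun f i x.2) hW μ)) ?_
    refine der_mem_linPart (fun g hg => ?_) (fun α => ?_) hW.self_of_nhds
    · rw [(hl i).base x g hg]
      exact homologicalGen_mem_basePart H i x g
    · rw [connField_s]
      exact sum_mem fun β _ => base_mul_mem_linPart (connAt_mem_basePart _ _ _ _ _ _)
        (s_mem_linPart β)
  · intro f hf
    have hW : ∀ (i : LocalChart n r E) (x : i.dom), ∀ᶠ y in 𝓝 (x : M),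
        extZero i (f.1 i) y ∈ Subalgebra.toSubmodule (basePart n r k) := by
      intro i x
      filter_upwards [i.dom_mem_nhds x.2] with y hy
      rw [extZero_of_mem i _ hy]
      exact hf i ⟨y, hy⟩
    refine ⟨fun i x => ?_, fun i x => ?_⟩
    · change (X i).app i.chart (extZero i (f.1 i)) x ∈ _
      refine add_mem (sum_mem fun μ _ => mul_mem (gen_mem_basePart trivial)
        (pd_mem i.chart_mem x.2.1 (smoothGr_globalFun f i x.2) (hW i x) μ)) ?_
      refine der_mem_basePart (fun g hg => ?_) (hW i x).self_of_nhds
      rw [(hl i).base x g hg]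
      exact homologicalGen_mem_basePart H i x g
    · rw [isFieldAt_iff (smoothGr_globalFun f i x.2)]
      change (X i).app i.chart (extZero i (f.1 i)) x = _
      rw [FieldCoeff.app, connField_at', extZero_of_mem i _ x.2]
      congr 1
      rw [fibreField, der_eq_zero_of_base _ (hf i x), add_zero]
      intro g hg
      cases g with
      | s β => exact hg.elim
      | _ => rfl
  · change (X i).app i.chart (extZero i ((linSection k σ).1 i)) x = _
    rw [FieldCoeff.app_congr x.2.1 (extZero_linSection σ i x.2), app_section H i V (hΓ i) x.2]

omit [T2Space M] in
theorem tensorToFun_injective {i : LocalChart n r E} {x : M} (hx : x ∈ i.dom)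
    {t t' : GTan n x ⊗[ℝ] E x} (h : tensorToFun i k t = tensorToFun i k t') : t = t' := by
  rw [tensorToFun_eq_linPoly, tensorToFun_eq_linPoly] at h
  obtain ⟨hA, hB⟩ := linPoly_injective h
  exact gtan_ext i hx (fun μ α => congrFun (congrFun hA μ) α)
    fun μ α => congrFun (congrFun hB μ) α

omit [T2Space M] in
theorem tensorToFun_add {i : LocalChart n r E} {x : M} (hx : x ∈ i.dom)
    (t t' : GTan n x ⊗[ℝ] E x) :
    tensorToFun i k (t + t') = tensorToFun i k t + tensorToFun i k t' := by
  simp only [tensorToFun_eq_linPoly, compForm_add i hx, compVec_add i hx, ← linPoly_add]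
  rfl

omit [T2Space M] in
theorem tensorToFun_smul {i : LocalChart n r E} {x : M} (hx : x ∈ i.dom) (a : ℝ)
    (t : GTan n x ⊗[ℝ] E x) : tensorToFun i k (a • t) = a • tensorToFun i k t := by
  simp only [tensorToFun_eq_linPoly, compForm_smul i hx, compVec_smul i hx, ← linPoly_smul]
  rfl

omit [T2Space M] in
theorem tensorToFun_differential (i : LocalChart n r E) {x : M} (hx : x ∈ i.dom)
    (f : C^∞⟮𝓡 n, M; ℝ⟯) (u : E x) :
    tensorToFun i k (((0, differential f x) : GTan n x) ⊗ₜ[ℝ] u) =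
      (∑ μ, partialDeriv i.chart μ f x • gen k (.psi μ)) *
        ∑ α, i.coeff α u • gen k (.s α) := by
  have h1 : ∀ μ α, compForm i μ α (((0, differential f x) : GTan n x) ⊗ₜ[ℝ] u) =
      partialDeriv i.chart μ f x * i.coeff α u := fun μ α => by
    rw [compForm, contract_tmul, pairing_apply, i.coeff_smul hx]
    simp [differential_coordVec i.chart_mem hx.1]
  have h2 : ∀ μ α, compVec i μ α (((0, differential f x) : GTan n x) ⊗ₜ[ℝ] u) = 0 :=
    fun μ α => by
      rw [compVec, contract_tmul, pairing_apply, i.coeff_smul hx]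
      simp
  simp only [tensorToFun, h1, h2, zero_smul, add_zero, Finset.sum_mul_sum, smul_mul_smul_comm]

namespace QConnection

variable {H : ClosedThreeForm n M} (Q : QConnection r E H k)

-- The image of a section is linear in the fibre coordinates and of degree `1 - k`, so in one chart
-- it is a `linPoly` and hence a tensor. The identification with tensors is chart independent, so
-- the same tensor works in every chart.
omit [T2Space M] in
theorem exists_gtan (σ : Cₛ^∞⟮𝓡 n; EuclideanSpace ℝ (Fin r), E⟯) (x : M) :
    ∃ t : GTan n x ⊗[ℝ] E x, ∀ (i : LocalChart n r E) (hx : x ∈ i.dom),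
      (Q.toFun (linSection k σ)).1 i ⟨x, hx⟩ = tensorToFun i k t := by
  have hj := LocalChart.mem_dom_around (n := n) (r := r) (E := E) x
  set j := LocalChart.around n r E x
  obtain ⟨A, B, h⟩ := exists_linPoly (Q.preserves_lin _ (isLinFun_linSection σ) j ⟨x, hj⟩)
    ((Q.degree _ _ (linSection_mem_funDeg σ)).2.2 j ⟨x, hj⟩)
  obtain ⟨t, hA, hB⟩ := GradedCourant.exists_gtan j hj A B
  have ht : (Q.toFun (linSection k σ)).1 j ⟨x, hj⟩ = tensorToFun j k t := by
    rw [h, tensorToFun_eq_linPoly]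
    simp only [hA, hB]
  refine ⟨t, fun i hi => ?_⟩
  rw [globalFun_compat _ i j hi hj, ht, trans_tensorToFun i j hi hj]

/-- The restriction of a `Q`-connection to the sections of `E`. -/
def restrict (σ : Cₛ^∞⟮𝓡 n; EuclideanSpace ℝ (Fin r), E⟯) (x : M) : GTan n x ⊗[ℝ] E x :=
  (Q.exists_gtan σ x).choose

omit [T2Space M] in
theorem tensorToFun_restrict (σ : Cₛ^∞⟮𝓡 n; EuclideanSpace ℝ (Fin r), E⟯) (i : LocalChart n r E)
    (x : i.dom) : tensorToFun i k (Q.restrict σ x) = (Q.toFun (linSection k σ)).1 i x :=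
  ((Q.exists_gtan σ x).choose_spec i x.2).symm

omit [T2Space M] in
theorem restrict_eq (σ : Cₛ^∞⟮𝓡 n; EuclideanSpace ℝ (Fin r), E⟯) (x : M)
    {t : GTan n x ⊗[ℝ] E x} (h : ∀ (i : LocalChart n r E) (hx : x ∈ i.dom),
      (Q.toFun (linSection k σ)).1 i ⟨x, hx⟩ = tensorToFun i k t) : Q.restrict σ x = t := by
  have hj := LocalChart.mem_dom_around (n := n) (r := r) (E := E) x
  refine tensorToFun_injective (k := k) hj ?_
  rw [← h _ hj]
  exact Q.tensorToFun_restrict σ _ ⟨x, hj⟩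

theorem linSection_add (σ τ : Cₛ^∞⟮𝓡 n; EuclideanSpace ℝ (Fin r), E⟯) :
    linSection k (σ + τ) = linSection k σ + linSection k τ := by
  apply Subtype.ext
  funext i x
  change ∑ α, i.coeff α (σ x + τ x) • gen k (.s α) = ∑ α, i.coeff α (σ x) • gen k (.s α) +
    ∑ α, i.coeff α (τ x) • gen k (.s α)
  simp only [i.coeff_add x.2, add_smul, Finset.sum_add_distrib]

theorem linSection_smul (t : ℝ) (σ : Cₛ^∞⟮𝓡 n; EuclideanSpace ℝ (Fin r), E⟯) :
    linSection k (t • σ) = t • linSection k σ := by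
  apply Subtype.ext
  funext i x
  change ∑ α, i.coeff α (t • σ x) • gen k (.s α) = t • ∑ α, i.coeff α (σ x) • gen k (.s α)
  simp only [i.coeff_smul x.2, mul_smul, Finset.smul_sum]

theorem restrict_add (σ τ : Cₛ^∞⟮𝓡 n; EuclideanSpace ℝ (Fin r), E⟯) (x : M) :
    Q.restrict (σ + τ) x = Q.restrict σ x + Q.restrict τ x := by
  refine Q.restrict_eq _ x fun i hx => ?_
  have h1 := Q.tensorToFun_restrict σ i ⟨x, hx⟩
  have h2 := Q.tensorToFun_restrict τ i ⟨x, hx⟩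
  rw [linSection_add, map_add, tensorToFun_add hx, h1, h2]
  rfl

theorem restrict_smul (t : ℝ) (σ : Cₛ^∞⟮𝓡 n; EuclideanSpace ℝ (Fin r), E⟯) (x : M) :
    Q.restrict (t • σ) x = t • Q.restrict σ x := by
  refine Q.restrict_eq _ x fun i hx => ?_
  have h1 := Q.tensorToFun_restrict σ i ⟨x, hx⟩
  rw [linSection_smul, map_smul, tensorToFun_smul hx, h1]
  rfl

/-- A function `f` on `M` has degree `0`, so no sign appears, and `Q f = ψ^μ ∂_μ f` corresponds to
`ρ* df`. -/
theorem restrict_leibniz (f : C^∞⟮𝓡 n, M; ℝ⟯)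
    (σ : Cₛ^∞⟮𝓡 n; EuclideanSpace ℝ (Fin r), E⟯) (x : M) :
    Q.restrict (smulSection f σ) x =
      f x • Q.restrict σ x + ((0, differential f x) : GTan n x) ⊗ₜ[ℝ] σ x := by
  refine Q.restrict_eq _ x fun i hx => ?_
  have h1 := Q.tensorToFun_restrict σ i ⟨x, hx⟩
  have h2 := Q.apply_fnGlob f i ⟨x, hx⟩
  rw [fnGlob_mul_linSection, Q.leibniz 0 _ _ (fn_mem_funDeg f), tensorToFun_add hx,
    tensorToFun_smul hx, tensorToFun_differential i hx, ← h2, h1, mul_zero, zpow_zero, one_smul]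
  change (Q.toFun (fnGlob r k E f)).1 i ⟨x, hx⟩ * (linSection k σ).1 i ⟨x, hx⟩ +
    (f x • (1 : GAlg n r k)) * (Q.toFun (linSection k σ)).1 i ⟨x, hx⟩ = _
  rw [smul_mul_assoc, one_mul, add_comm, linSection_apply]

/-- The components are values of the fixed linear functionals `coef` on a smooth function with
values in the graded algebra. -/
theorem restrict_smooth (σ : Cₛ^∞⟮𝓡 n; EuclideanSpace ℝ (Fin r), E⟯) :
    IsSmoothGTan (r := r) (Q.restrict σ) := by
  intro i μ α
  have key : ∀ x ∈ i.dom, ∀ᶠ y in 𝓝 x, extZero i ((Q.toFun (linSection k σ)).1 i) y =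
      linPoly k (fun μ α => compForm i μ α (Q.restrict σ y))
        fun μ α => compVec i μ α (Q.restrict σ y) := by
    intro x hx
    filter_upwards [i.dom_mem_nhds hx] with y hy
    rw [extZero_of_mem i _ hy, ← Q.tensorToFun_restrict σ i ⟨y, hy⟩, tensorToFun_eq_linPoly]
  constructor
  · refine contMDiffOn_of_smoothNear fun x hx => ((smoothGr_globalFun
      (Q.toFun (linSection k σ)) i hx).functional (coef k (.psi μ) (.s α))).congr ?_
    filter_upwards [key x hx] with y hy
    rw [hy, coef_psi_linPoly]
  · refine contMDiffOn_of_smoothNear fun x hx => ((smoothGr_globalFun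
      (Q.toFun (linSection k σ)) i hx).functional (coef k (.b μ) (.s α))).congr ?_
    filter_upwards [key x hx] with y hy
    rw [hy, coef_b_linPoly]

/-- The generalized connection given by a `Q`-connection. -/
def genConnection : GenConnection n r M E where
  toFun :=
    { toFun := fun σ x => Q.restrict σ x
      map_add' := fun σ τ => funext fun x => Q.restrict_add σ τ x
      map_smul' := fun t σ => funext fun x => Q.restrict_smul t σ x }
  smooth σ := Q.restrict_smooth σ
  leibniz f σ x := Q.restrict_leibniz f σ x

theorem genConnection_apply (σ : Cₛ^∞⟮𝓡 n; EuclideanSpace ℝ (Fin r), E⟯) (i : LocalChart n r E)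
    (x : i.dom) : (Q.toFun (linSection k σ)).1 i x =
      tensorToFun i k (Q.genConnection.toFun σ x) :=
  (Q.tensorToFun_restrict σ i x).symm

end QConnection

theorem GenConnection.ext_toFun {D D' : GenConnection n r M E}
    (h : ∀ σ x, D.toFun σ x = D'.toFun σ x) : D = D' := by
  have h' : D.toFun = D'.toFun := LinearMap.ext fun σ => funext fun x => h σ x
  cases D
  cases D'
  cases h'
  rfl

/-- Once the common generalized connection is split as `∇ + V`, both `Q`-connections are given by
the same local formula `QConnection.apply_eq_app`. -/
theorem QConnection.genConnection_injective (H : ClosedThreeForm n M) (k : ℤ) :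
    Function.Injective (QConnection.genConnection : QConnection r E H k → GenConnection n r M E) := by
  intro Q Q' h
  refine QConnection.ext_toFun fun f i x => ?_
  obtain ⟨⟨N, V⟩, hD⟩ := (sumEquiv n r M E).surjective Q.genConnection
  obtain ⟨Γ, hΓ⟩ := exists_isConnCoeff N i
  have hD' : ∀ σ y, Q.genConnection.toFun σ y = sumAt N V σ y := fun σ y => by
    rw [← hD]
    rfl
  have h1 : ∀ σ (j : LocalChart n r E) (y : j.dom),
      (Q.toFun (linSection k σ)).1 j y = tensorToFun j k (sumAt N V σ y) := fun σ j y => by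
    rw [Q.genConnection_apply, hD']
  have h2 : ∀ σ (j : LocalChart n r E) (y : j.dom),
      (Q'.toFun (linSection k σ)).1 j y = tensorToFun j k (sumAt N V σ y) := fun σ j y => by
    rw [Q'.genConnection_apply, ← h, hD']
  rw [Q.apply_eq_app N V h1 hΓ, Q'.apply_eq_app N V h2 hΓ]

theorem QConnection.genConnection_surjective (H : ClosedThreeForm n M) (k : ℤ) :
    Function.Surjective
      (QConnection.genConnection : QConnection r E H k → GenConnection n r M E) := by
  intro D
  obtain ⟨⟨N, V⟩, hD⟩ := (sumEquiv n r M E).surjective D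
  obtain ⟨Q, hQ⟩ := exists_qConnection H k N V
  have hD' : ∀ σ y, D.toFun σ y = sumAt N V σ y := fun σ y => by
    rw [← hD]
    rfl
  refine ⟨Q, GenConnection.ext_toFun fun σ x => ?_⟩
  rw [hD']
  exact Q.restrict_eq σ x fun i hx => hQ σ i ⟨x, hx⟩

variable (r E) in
/-- `Q`-connections are the same as generalized connections. -/
def genConnectionEquiv (H : ClosedThreeForm n M) (k : ℤ) :
    QConnection r E H k ≃ GenConnection n r M E :=
  Equiv.ofBijective QConnection.genConnection
    ⟨QConnection.genConnection_injective H k, QConnection.genConnection_surjective H k⟩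

end QConnections

/-! ### The square as a vector field of degree `2` -/

section Square

variable {n r : ℕ} {k : ℤ} {M : Type*} [TopologicalSpace M]
  [ChartedSpace (EuclideanSpace ℝ (Fin n)) M]
  {E : M → Type*} [TopologicalSpace (TotalSpace (EuclideanSpace ℝ (Fin r)) E)]
  [∀ x, AddCommGroup (E x)] [∀ x, TopologicalSpace (E x)]
  [FiberBundle (EuclideanSpace ℝ (Fin r)) E]

/-- The square of a vector field of degree `1`. -/
def VectorField.square (P : VectorField n r E k 1) : VectorField n r E k 2 where
  toFun := P.toFun ∘ₗ P.toFun
  degree j f hf := by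
    have h := P.degree _ _ (P.degree j f hf)
    rwa [add_assoc, one_add_one_eq_two] at h
  leibniz j f g hf := by
    have h := P.leibniz j f g hf
    simp only [LinearMap.comp_apply, h, map_add, map_smul, P.leibniz (j + 1) _ g (P.degree j f hf),
      P.leibniz j f _ hf, smul_add, smul_smul, one_mul, zpow_neg_one_sq, one_smul, zpow_mul,
      zpow_add_one₀ (by norm_num : (-1 : ℝ) ≠ 0)]
    simp only [mul_neg, mul_one, neg_smul]
    norm_num

end Square

/-! ### The local form of `Q_𝓔` and its curvature -/

section Curvature

variable {n r : ℕ} {k : ℤ} {M : Type*} [TopologicalSpace M]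
  [ChartedSpace (EuclideanSpace ℝ (Fin n)) M] [IsManifold (𝓡 n) ∞ M]
  {E : M → Type*} [TopologicalSpace (TotalSpace (EuclideanSpace ℝ (Fin r)) E)]
  [∀ x, AddCommGroup (E x)] [∀ x, Module ℝ (E x)] [∀ x, TopologicalSpace (E x)]
  [FiberBundle (EuclideanSpace ℝ (Fin r)) E]

/-- The relation `b_μ ψ^ν = -ψ^ν b_μ` merges the two mixed products and produces the minus sign in
`R^{(1,1)}`. -/
theorem connMatrix_mul (Γ V : Fin n → Fin r → Fin r → ℝ) (α β γ : Fin r) :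
    (connMatrix k Γ V α γ * connMatrix k Γ V γ β : GAlg n r k) =
      ∑ μ, ∑ ν, (Γ μ α γ * Γ ν γ β) • (gen k (.psi μ) * gen k (.psi ν)) +
      ∑ μ, ∑ ν, (V μ α γ * V ν γ β) • (gen k (.b μ) * gen k (.b ν)) +
      ∑ μ, ∑ ν, (Γ μ α γ * V ν γ β - Γ μ γ β * V ν α γ) • (gen k (.psi μ) * gen k (.b ν)) := by
  have h : ∑ μ, ∑ ν, (V μ α γ * Γ ν γ β) • (gen k (.b μ : Gen n r) * gen k (.psi ν)) =
      -∑ μ, ∑ ν, (Γ μ γ β * V ν α γ) • (gen k (.psi μ : Gen n r) * gen k (.b ν)) := by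
    rw [Finset.sum_comm]
    simp only [← Finset.sum_neg_distrib]
    exact Finset.sum_congr rfl fun μ _ => Finset.sum_congr rfl fun ν _ => by
      rw [b_mul_psi, smul_neg, mul_comm]
  simp only [connMatrix, Finset.sum_add_distrib, add_mul, mul_add, Finset.sum_mul_sum,
    smul_mul_smul_comm, h, sub_smul, Finset.sum_sub_distrib]
  abel

variable {H : ClosedThreeForm n M} {i : LocalChart n r E} {Γ : Fin n → Fin r → Fin r → M → ℝ}
  {V : EndSection n r M E} {x : M}
  (hΓ : ∀ μ α β, ContMDiffOn (𝓡 n) 𝓘(ℝ, ℝ) ∞ (Γ μ α β) i.dom) (hx : x ∈ i.dom)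

/-- The components of the curvature at the point `x`. -/
def curvAt (H : ClosedThreeForm n M) (k : ℤ) (i : LocalChart n r E)
    (Γ : Fin n → Fin r → Fin r → M → ℝ) (V : EndSection n r M E) (x : M) (α β : Fin r) :
    GAlg n r k :=
  curvMatrix k (fun μ ν ρ => H.comp i.chart μ ν ρ x) (fun μ α β => Γ μ α β x)
    (fun μ α β => compEnd i μ α β (V.toFun x))
    (fun μ ν α β => partialDeriv i.chart μ (Γ ν α β) x)
    (fun μ ν α β => partialDeriv i.chart μ (fun y => compEnd i ν α β (V.toFun y)) x) α β

theorem connAt_mem_homog (α β : Fin r) : connAt k i Γ V x α β ∈ homog n r k 1 :=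
  connMatrix_mem _ _ α β

include hΓ hx

/-- Differentiating the coefficients gives the `∂Γ` and `∂V` terms. The `ψ` are killed, while `v b_ν
= p_ν + ½ H_{νab} ψ^a ψ^b` contributes both the `p` term and `H_V`. -/
theorem app_connAt (α β : Fin r) :
    (connField H k i Γ V).app i.chart (fun y => connAt k i Γ V y α β) x =
      ∑ μ, ∑ ν, partialDeriv i.chart μ (Γ ν α β) x • (gen k (.psi μ) * gen k (.psi ν)) +
      ∑ μ, ∑ ν, partialDeriv i.chart μ (fun y => compEnd i ν α β (V.toFun y)) x •
        (gen k (.psi μ) * gen k (.b ν)) +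
      ∑ μ, compEnd i μ α β (V.toFun x) • gen k (.p μ) +
      ∑ μ, ∑ ν, ((1 / 2 : ℝ) * ∑ ρ, H.comp i.chart ρ μ ν x * compEnd i ρ α β (V.toFun x)) •
        (gen k (.psi μ) * gen k (.psi ν)) := by
  have hl := isLift_connField (k := k) H i V hΓ
  have hψ : ∀ μ, (connField H k i Γ V).toFun x (.psi μ) = 0 := fun μ =>
    hl.base x (.psi μ) trivial
  have h1 := fun μ => SmoothNear.of_contMDiffOn i.isOpen_dom (hΓ μ α β) hx
  have h2 := fun μ => SmoothNear.of_contMDiffOn i.isOpen_dom (V.smooth i μ α β) hx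
  have hh : ∑ ν, compEnd i ν α β (V.toFun x) • halfH H k i ν x =
      ∑ μ, ∑ ν, ((1 / 2 : ℝ) * ∑ ρ, H.comp i.chart ρ μ ν x * compEnd i ρ α β (V.toFun x)) •
        (gen k (.psi μ : Gen n r) * gen k (.psi ν)) := by
    simp only [halfH, Finset.mul_sum, Finset.sum_smul, Finset.smul_sum, smul_smul]
    rw [Finset.sum_comm]
    refine Finset.sum_congr rfl fun μ _ => ?_
    rw [Finset.sum_comm]
    refine Finset.sum_congr rfl fun ν _ => Finset.sum_congr rfl fun ρ _ => ?_
    congr 1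
    ring
  unfold connAt connMatrix
  rw [FieldCoeff.app_sum i.chart_mem hx.1 fun μ _ =>
    (SmoothGr.smul_const (h1 μ) _).add (SmoothGr.smul_const (h2 μ) _)]
  simp only [FieldCoeff.app_add i.chart_mem hx.1 (SmoothGr.smul_const (h1 _) _)
    (SmoothGr.smul_const (h2 _) _), FieldCoeff.app_fun i.chart_mem hx.1 (h1 _),
    FieldCoeff.app_fun i.chart_mem hx.1 (h2 _), FieldCoeff.at', der_gen, hψ,
    hl.base x (.b _) trivial, homologicalGen_b, smul_zero, add_zero, smul_add,
    Finset.sum_add_distrib, Finset.sum_mul, smul_mul_assoc, hh]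
  rw [Finset.sum_comm, Finset.sum_comm (f := fun ν μ =>
    partialDeriv i.chart μ (fun y => compEnd i ν α β (V.toFun y)) x • _)]
  abel

theorem app_connAt_add_mul (α β : Fin r) :
    (connField H k i Γ V).app i.chart (fun y => connAt k i Γ V y α β) x +
      ∑ γ, connAt k i Γ V x α γ * connAt k i Γ V x γ β = curvAt H k i Γ V x α β := by
  rw [app_connAt hΓ hx]
  simp only [connAt, connMatrix_mul, curvAt, curvMatrix, curvNabla, curvH, curvVV, curvMixed,
    add_smul, Finset.sum_smul, Finset.sum_add_distrib]
  simp only [Finset.sum_comm (s := (Finset.univ : Finset (Fin n))) (t := (Finset.univ : Finset (Fin r)))]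
  abel

/-- By the Leibniz rule `v(C^α_β s_α) = (v C^α_β) s_α - C^α_β C^γ_α s_γ`, and exchanging the two odd
factors turns the last term into `+ C^γ_α C^α_β s_γ`, the matrix square of `C`. -/
theorem app_app_s (β : Fin r) : (connField H k i Γ V).app i.chart
      ((connField H k i Γ V).app i.chart fun _ => gen k (.s β)) x =
    ∑ α, curvAt H k i Γ V x α β * gen k (.s α) := by
  have hl := isLift_connField (k := k) H i V hΓ
  have e : (connField H k i Γ V).app i.chart (fun _ => gen k (.s β)) =ᶠ[𝓝 x]
      fun y => ∑ α, connAt k i Γ V y α β * gen k (.s α) := by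
    filter_upwards [i.dom_mem_nhds hx] with y hy
    rw [FieldCoeff.app_const_gen i.chart_mem hy.1, connField_s]
  have hs := fun α => smoothGr_connAt (k := k) i V hΓ hx α β
  rw [FieldCoeff.app_congr hx.1 e, FieldCoeff.app_sum i.chart_mem hx.1 fun α _ =>
    (hs α).mul (SmoothGr.const _)]
  simp only [FieldCoeff.app_mul i.chart_mem hx.1 (hs _) (SmoothGr.const _)
    (connAt_mem_homog _ β), FieldCoeff.app_const_gen i.chart_mem hx.1,
    connField_s, zpow_one, neg_smul, one_smul, ← app_connAt_add_mul hΓ hx, add_mul,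
    Finset.sum_add_distrib, Finset.mul_sum, Finset.sum_mul]
  congr 1
  rw [Finset.sum_comm]
  simp only [← Finset.sum_neg_distrib]
  refine Finset.sum_congr rfl fun α _ => Finset.sum_congr rfl fun γ _ => ?_
  rw [← mul_assoc, homog_comm (connAt_mem_homog α β) (connAt_mem_homog γ α)]
  simp

variable [VectorBundle ℝ (EuclideanSpace ℝ (Fin r)) E]
  [ContMDiffVectorBundle ∞ (EuclideanSpace ℝ (Fin r)) E (𝓡 n)] [T2Space M]

omit hΓ hx in
theorem QConnection.apply_apply (Q : QConnection r E H k) (N : Connection n r M E)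
    (V : EndSection n r M E) (hQ : ∀ σ (i : LocalChart n r E) (x : i.dom),
      (Q.toFun (linSection k σ)).1 i x = tensorToFun i k (sumAt N V σ x))
    (hΓ : IsConnCoeff N i Γ) (f : globalFun n r E k) (x : i.dom) :
    (Q.toFun (Q.toFun f)).1 i x = fibreField 2 (curvAt H k i Γ V x)
      (curvMatrix_mem _ _ _ _ _) (f.1 i x) := by
  have hl := isLift_connField (k := k) H i V hΓ.1
  -- The local formula holds throughout the chart domain, not just at `x`, so it can be applied
  -- twice.
  have hQQ : ∀ (f : globalFun n r E k) (F : M → GAlg n r k), extZero i (f.1 i) =ᶠ[𝓝 (x : M)] F →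
      (Q.toFun (Q.toFun f)).1 i x =
        (connField H k i Γ V).app i.chart ((connField H k i Γ V).app i.chart F) x := by
    intro f F hF
    rw [Q.apply_eq_app N V hQ hΓ]
    refine FieldCoeff.app_congr x.2.1 (extZero_eventuallyEq x.2 ?_)
    filter_upwards [eventually_eventually_nhds.2 hF] with y hy hyi
    rw [Q.apply_eq_app N V hQ hΓ f ⟨y, hyi⟩, FieldCoeff.app_congr hyi.1 hy]
  obtain ⟨χ, h1, hχ⟩ := exists_bump (n := n) (i.dom_mem_nhds x.2)
  -- The square has no `∂/∂x^μ` part, so the symbol is `0`; only its values on the cut off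
  -- coordinates remain, and those of the base vanish.
  have h := Q.square.apply_eq i hχ x.2 h1 (fun _ => 0) (fun g => ?_)
    (v := fun g : Gen n r => match g with
      | .s β => ∑ α, curvAt H k i Γ V x α β * gen k (.s α)
      | _ => 0) (fun g => ?_) (fun g => ?_) f
  · simp only [zero_mul, Finset.sum_const_zero, zero_add] at h
    exact h
  · have e : extZero i ((fnGlob r k E g).1 i) =ᶠ[𝓝 (x : M)] fun y => g y • 1 :=
      extZero_eventuallyEq x.2 (Filter.Eventually.of_forall fun _ _ => rfl)
    have h := hQQ _ _ e
    rw [hl.app_app_fun x.2 (SmoothNear.of_contMDiff g x)] at h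
    simp only [smul_zero, Finset.sum_const_zero]
    exact h
  · cases g with
    | s β =>
      exact sum_mem fun α _ => mul_mem_homog_of_eq (curvMatrix_mem _ _ _ _ _ α β) (s_mem_homog α)
        (add_comm _ _)
    | _ => exact zero_mem _
  · have h := hQQ _ _ (extZero_genGlob (k := k) i hχ x.2 h1 g)
    cases g with
    | s β =>
      rw [app_app_s hΓ.1 x.2] at h
      exact h
    | psi μ =>
      rw [hl.app_app_psi x.2] at h
      exact h
    | b μ =>
      rw [hl.app_app_b x.2] at h
      exact h
    | p μ =>
      rw [hl.app_app_p x.2] at h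
      exact h

omit hΓ hx in
theorem QConnection.isFieldAt (Q : QConnection r E H k) (N : Connection n r M E)
    (V : EndSection n r M E) (hQ : ∀ σ (i : LocalChart n r E) (x : i.dom),
      (Q.toFun (linSection k σ)).1 i x = tensorToFun i k (sumAt N V σ x))
    (hΓ : IsConnCoeff N i Γ) (f : globalFun n r E k) (x : i.dom) :
    IsFieldAt i (homologicalField H k i x + fibreField 1
      (connMatrix k (fun μ α β => Γ μ α β x) (fun μ α β => compEnd i μ α β (V.toFun x)))
      (connMatrix_mem _ _)) (f.1 i) x ((Q.toFun f).1 i x) := by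
  rw [isFieldAt_iff (smoothGr_globalFun f i x.2), Q.apply_eq_app N V hQ hΓ, FieldCoeff.app,
    connField_at', extZero_of_mem i _ x.2]
  rfl

end Curvature

end GradedCourant

end

/-! ### The main theorem -/

theorem mainTheorem1 {n r : ℕ} {M : Type*} [TopologicalSpace M] [T2Space M]
    [SecondCountableTopology M] [ChartedSpace (EuclideanSpace ℝ (Fin n)) M]
    [IsManifold (𝓡 n) ∞ M]
    {E : M → Type*} [TopologicalSpace (TotalSpace (EuclideanSpace ℝ (Fin r)) E)]
    [∀ x, AddCommGroup (E x)] [∀ x, Module ℝ (E x)] [∀ x, TopologicalSpace (E x)]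
    [FiberBundle (EuclideanSpace ℝ (Fin r)) E] [VectorBundle ℝ (EuclideanSpace ℝ (Fin r)) E]
    [ContMDiffVectorBundle ∞ (EuclideanSpace ℝ (Fin r)) E (𝓡 n)]
    (H : GradedCourant.ClosedThreeForm n M) (k : ℤ) :
    ∃ (Φ : GradedCourant.QConnection r E H k ≃ GradedCourant.GenConnection n r M E)
      (Ψ : GradedCourant.Connection n r M E × GradedCourant.EndSection n r M E ≃
        GradedCourant.GenConnection n r M E),
      -- under `Γ(E) ⊆ Γ(p*E[k])` and `Γ(𝕋M ⊗ E) ⊆ Γ(p*E[k])`, `Q_𝓔` restricts to `D = Φ Q_𝓔`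
      (∀ (Q : GradedCourant.QConnection r E H k)
        (σ : Cₛ^∞⟮𝓡 n; EuclideanSpace ℝ (Fin r), E⟯)
        (i : GradedCourant.LocalChart n r E) (x : i.dom),
        (Q.toFun (GradedCourant.linSection k σ)).1 i x =
          GradedCourant.tensorToFun i k ((Φ Q).toFun σ x)) ∧
      -- `D = ∇ + V`
      (∀ (N : GradedCourant.Connection n r M E) (V : GradedCourant.EndSection n r M E)
        (σ : Cₛ^∞⟮𝓡 n; EuclideanSpace ℝ (Fin r), E⟯) (x : M),
        (Ψ (N, V)).toFun σ x = GradedCourant.sumAt N V σ x) ∧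
      -- the local form of `Q_𝓔` and of its curvature `Q_𝓔²`, when `Φ Q_𝓔 = ∇ + V`
      (∀ (Q : GradedCourant.QConnection r E H k) (N : GradedCourant.Connection n r M E)
        (V : GradedCourant.EndSection n r M E), Φ Q = Ψ (N, V) →
        ∀ i : GradedCourant.LocalChart n r E, ∃ Γ : Fin n → Fin r → Fin r → M → ℝ,
          GradedCourant.IsConnCoeff N i Γ ∧
          ∀ (f : GradedCourant.globalFun n r E k) (x : i.dom),
            GradedCourant.IsFieldAt i
              (GradedCourant.homologicalField H k i x +
                GradedCourant.fibreField 1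
                  (GradedCourant.connMatrix k (fun μ α β => Γ μ α β x)
                    (fun μ α β => GradedCourant.compEnd i μ α β (V.toFun x)))
                  (GradedCourant.connMatrix_mem _ _))
              (f.1 i) x ((Q.toFun f).1 i x) ∧
            (Q.toFun (Q.toFun f)).1 i x =
              GradedCourant.fibreField 2
                (GradedCourant.curvMatrix k
                  (fun μ ν ρ => H.comp i.chart μ ν ρ x)
                  (fun μ α β => Γ μ α β x)
                  (fun μ α β => GradedCourant.compEnd i μ α β (V.toFun x))
                  (fun μ ν α β => GradedCourant.partialDeriv i.chart μ (Γ ν α β) x)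
                  (fun μ ν α β => GradedCourant.partialDeriv i.chart μ
                    (fun y => GradedCourant.compEnd i ν α β (V.toFun y)) x))
                (GradedCourant.curvMatrix_mem _ _ _ _ _)
                (f.1 i x)) := by
  refine ⟨GradedCourant.genConnectionEquiv r E H k, GradedCourant.sumEquiv n r M E,
    fun Q σ i x => Q.genConnection_apply σ i x, fun N V σ x => rfl, fun Q N V hQ i => ?_⟩
  have hQ' : ∀ σ (j : GradedCourant.LocalChart n r E) (y : j.dom),
      (Q.toFun (GradedCourant.linSection k σ)).1 j y =
        GradedCourant.tensorToFun j k (GradedCourant.sumAt N V σ y) := fun σ j y => by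
    rw [Q.genConnection_apply,
      show Q.genConnection = GradedCourant.sumEquiv n r M E (N, V) from hQ]
    rfl
  obtain ⟨Γ, hΓ⟩ := GradedCourant.exists_isConnCoeff N i
  exact ⟨Γ, hΓ, fun f x => ⟨Q.isFieldAt N V hQ' hΓ f x, Q.apply_apply N V hQ' hΓ f x⟩⟩
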